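/- Let $\mathbb F_\epsilon$ be a finite field with $\hat q$ elements, $A_\epsilon=\mathbb F_\epsilon[[z]]$, $Q_\epsilon=\operatorname{Quot}(A_\epsilon)$. Let $R\supset\mathbb F_\epsilon$ be a complete discrete valuation ring with maximal ideal $\mathfrak m_R$ and fraction field $K$, let $0\neq\zeta\in\mathfrak m_R$ (so that $z\mapsto\zeta$ defines an injection $A_\epsilon\hookrightarrow R$), let $K^{\rm sep}$ be a separable closure of $K$, $G=\operatorname{Gal}(K^{\rm sep}/K)$, and let $d\ge 0$ be an integer. On $B[[z]]$, for an $\mathbb F_\epsilon$-algebra $B$, let $\hat\sigma$ be the endomorphism with $\hat\sigma(z)=z$ and $\hat\sigma(b)=b^{\hat q}$ for $b\in B$. A *torsion local shtuka* over $R$ is a pair $(\hat M,\tau)$ of a finitely presented $R[[z]]$-module $\hat M$ that is $z$-power torsion and free over $R$, and an isomorphism $\tau\colon\hat\sigma^*\hat M[\frac1{z-\zeta}]\to\hat M[\frac1{z-\zeta}]$, where $\hat\sigma^*\hat M=\hat M\otimes_{R[[z]],\hat\sigma}R[[z]]$. It is *effective* if $\tau(\hat\sigma^*\hat M)\subset\hat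 M$, and *of height $\le d$* if $(z-\zeta)^d\hat M\subset\tau(\hat\sigma^*\hat M)\subset\hat M$. Its (dual) Tate module is the $A_\epsilon[G]$-module $\check T_\epsilon\hat M=\{m\in\hat M\otimes_{R[[z]]}K^{\rm sep}[[z]]:\tau(\hat\sigma^*m)=m\}$, with $G$ acting through $K^{\rm sep}[[z]]$. Let $\operatorname{Rep}^{\rm tors}_{A_\epsilon}G$ be the category of finite-length torsion $A_\epsilon$-modules with a discrete $A_\epsilon$-linear action of $G$. An object $T$ *admits an effective torsion local shtuka model of height $\le d$* if $T\cong\check T_\epsilon\hat M$ as $A_\epsilon[G]$-modules for some effective torsion local shtuka $(\hat M,\tau)$ of height $\le d$. Let $\chi_\epsilon\colon G\to A_\epsilon^\times$ be the cyclotomic character given by $g(\ell_+)=\chi_\epsilon(g)\,\ell_+$, where $\ell_+=\sum_{i\ge0}\ell_iz^i\in K^{\rm sep}[[z]]$ with $\ell_0^{\hat q-1}=-\zeta$ and $\ell_i^{\hat q}+\zeta\ell_i=\ell_{i-1}$ for $i\ge1$ (it does not depend on the choice of the $\ell_i$). **Proposition.** The full subcategory of $\operatorname{Rep}^{\rm tors}_{A_\epsilon}G$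 consisting of the objects that admit an effective torsion local shtuka model of height $\le d$ is stable under subquotients, finite direct products, and the twisted duality $T\mapsto\operatorname{Hom}_{A_\epsilon}(T,Q_\epsilon/A_\epsilon)\otimes\chi_\epsilon^{-d}$, where $G$ acts on $\operatorname{Hom}_{A_\epsilon}(T,Q_\epsilon/A_\epsilon)$ by $(g\cdot f)(t)=f(g^{-1}t)$. -/

import Mathlib

open scoped PowerSeries TensorProduct

universe u

noncomputable section

/-! ### Extension of scalars along a ring homomorphism -/

section ScalarExt

variable {A B C : Type*} [CommRing A] [CommRing B] [CommRing C]

/-- The extension of scalars `B ⊗_{A, f} M` of an `A`-module `M` along `f : A → B`. -/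
def ScalarExt (f : A →+* B) (M : Type*) [AddCommGroup M] [Module A M] : Type _ :=
  @TensorProduct A _ B M _ _ f.toAlgebra.toModule _

namespace ScalarExt

variable (f : A →+* B) (M : Type*) [AddCommGroup M] [Module A M]

instance : AddCommGroup (ScalarExt f M) :=
  @TensorProduct.addCommGroup A _ B M _ _ f.toAlgebra.toModule _

/-- `B` acts on `B ⊗_{A, f} M` through the left factor. -/
instance : Module B (ScalarExt f M) :=
  letI := f.toAlgebra
  TensorProduct.leftModule

variable {M}

/-- The pure tensor `b ⊗ m`. -/
def tmul (b : B) (m : M) : ScalarExt f M :=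
  letI := f.toAlgebra
  (b ⊗ₜ[A] m : B ⊗[A] M)

/-- The canonical `f`-semilinear map `M → B ⊗_{A, f} M`, `m ↦ 1 ⊗ m`. -/
def ι : M →ₛₗ[f] ScalarExt f M where
  toFun m := tmul f 1 m
  map_add' x y := by
    let _ := f.toAlgebra
    exact TensorProduct.tmul_add (R := A) (1 : B) x y
  map_smul' a x := by
    let _ := f.toAlgebra
    change (1 : B) ⊗ₜ[A] (a • x) = ((f a) * 1 : B) ⊗ₜ[A] x
    rw [← TensorProduct.smul_tmul, Algebra.smul_def]
    rfl

theorem smul_ι (b : B) (m : M) : b • ι f m = tmul f b m := by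
  let _ := f.toAlgebra
  change ((b * 1 : B) ⊗ₜ[A] m) = b ⊗ₜ[A] m
  rw [mul_one]

theorem induction {p : ScalarExt f M → Prop} (h0 : p 0) (hι : ∀ (b : B) (m : M), p (b • ι f m))
    (hadd : ∀ x y, p x → p y → p (x + y)) (x : ScalarExt f M) : p x := by
  let _ := f.toAlgebra
  have hι' : ∀ (b : B) (m : M), p (tmul f b m) := fun b m => smul_ι f b m ▸ hι b m
  exact @TensorProduct.induction_on A _ B M _ _ _ _ p x h0 hι' hadd

variable {f}

/-- The universal property: a map `φ : M → N` that is semilinear along `g ∘ f` extends to a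
`g`-semilinear map `B ⊗_{A, f} M → N`, `b ⊗ m ↦ g b • φ m`. -/
def lift {N : Type*} [AddCommGroup N] [Module C N] (g : B →+* C) (φ : M →+ N)
    (hφ : ∀ a m, φ (a • m) = g (f a) • φ m) : ScalarExt f M →ₛₗ[g] N :=
  letI := f.toAlgebra
  let F : B ⊗[A] M →+ N :=
    TensorProduct.liftAddHom
      { toFun := fun b =>
          { toFun := fun m => g b • φ m
            map_zero' := by simp
            map_add' := by simp }
        map_zero' := by ext; simp
        map_add' := by intros; ext; simp [add_smul] }
      (by
        intro a b m
        change g (f a * b) • φ m = g b • φ (a • m)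
        rw [hφ, smul_smul, map_mul, mul_comm])
  { toFun := F
    map_add' := F.map_add
    map_smul' := by
      intro c x
      refine TensorProduct.induction_on (R := A) (M := B) (N := M)
        (motive := fun x => F (c • x) = g c • F x) x ?_ ?_ ?_
      · simp
      · intro b m
        change g (c * b) • φ m = g c • g b • φ m
        rw [map_mul, mul_smul]
      · intro x y hx hy
        rw [smul_add, map_add, map_add, hx, hy, smul_add] }

theorem lift_ι {N : Type*} [AddCommGroup N] [Module C N] (g : B →+* C) (φ : M →+ N)
    (hφ : ∀ a m, φ (a • m) = g (f a) • φ m) (m : M) : lift g φ hφ (ι f m) = φ m := by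
  change g 1 • φ m = φ m
  rw [map_one, one_smul]

end ScalarExt

theorem isUnit_algebraMap_end_compHom {N : Type*} [AddCommGroup N] [Module B N] (f : A →+* B)
    (a : A) (h : IsUnit (f a)) :
    letI : Module A N := Module.compHom N f
    IsUnit (algebraMap A (Module.End A N) a) := by
  let _ : Module A N := Module.compHom N f
  obtain ⟨v, hv⟩ := h
  refine (Module.End.isUnit_iff _).2
    (Function.bijective_iff_has_inverse.2 ⟨fun n => (↑v⁻¹ : B) • n, fun n => ?_, fun n => ?_⟩)
  · change (↑v⁻¹ : B) • f a • n = n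
    rw [← hv, smul_smul, Units.inv_mul, one_smul]
  · change f a • (↑v⁻¹ : B) • n = n
    rw [← hv, smul_smul, Units.mul_inv, one_smul]

/-- An `f`-semilinear map `φ : M → N` extends to the localization `S⁻¹M` if `f` maps `S` to
units. -/
def LocalizedModule.liftSemilinear {M N : Type*} [AddCommGroup M] [Module A M] [AddCommGroup N]
    [Module B N] (S : Submonoid A) (f : A →+* B) (φ : M →ₛₗ[f] N) (h : ∀ s ∈ S, IsUnit (f s)) :
    LocalizedModule S M →ₛₗ[f] N :=
  letI : Module A N := Module.compHom N f
  let φ' : M →ₗ[A] N := { toFun := φ, map_add' := φ.map_add, map_smul' := φ.map_smulₛₗ }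
  let l : LocalizedModule S M →ₗ[A] N :=
    LocalizedModule.lift S φ' fun s => isUnit_algebraMap_end_compHom f s.1 (h s.1 s.2)
  { toFun := l, map_add' := l.map_add, map_smul' := l.map_smul }

theorem LocalizedModule.liftSemilinear_mk_one {M N : Type*} [AddCommGroup M] [Module A M]
    [AddCommGroup N] [Module B N] (S : Submonoid A) (f : A →+* B) (φ : M →ₛₗ[f] N)
    (h : ∀ s ∈ S, IsUnit (f s)) (m : M) :
    LocalizedModule.liftSemilinear S f φ h (LocalizedModule.mk m 1) = φ m := by
  let _ : Module A N := Module.compHom N f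
  exact LocalizedModule.lift_mk_one S
    ({ toFun := φ, map_add' := φ.map_add, map_smul' := φ.map_smulₛₗ } : M →ₗ[A] N)
    (fun s => isUnit_algebraMap_end_compHom f s.1 (h s.1 s.2)) m

theorem LocalizedModule.smul_liftSemilinear {M N : Type*} [AddCommGroup M] [Module A M]
    [AddCommGroup N] [Module B N] (S : Submonoid A) (f : A →+* B) (φ : M →ₛₗ[f] N)
    (h : ∀ s ∈ S, IsUnit (f s)) (m : M) (s : S) :
    f s • LocalizedModule.liftSemilinear S f φ h (LocalizedModule.mk m s) = φ m := by
  rw [← map_smulₛₗ, LocalizedModule.smul'_mk, ← Submonoid.smul_def, LocalizedModule.mk_cancel,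
    LocalizedModule.liftSemilinear_mk_one]

end ScalarExt

/-! ### Torsion local shtukas -/

section Shtuka

/-- The endomorphism `σ̂` of `B⟦z⟧` with `σ̂(z) = z` and `σ̂(b) = b ^ #F` for `b ∈ B`. -/
def frobSeries (F : Type*) [Field F] [Fintype F] (B : Type*) [CommRing B] [Algebra F B] :
    B⟦X⟧ →+* B⟦X⟧ :=
  PowerSeries.map (FiniteField.frobeniusAlgHom F B : B →+* B)

/-- The multiplicative set of powers of `z - ζ` in `R⟦z⟧`. -/
abbrev zSubPowers {R : Type*} [CommRing R] (ζ : R) : Submonoid R⟦X⟧ :=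
  Submonoid.powers (PowerSeries.X - PowerSeries.C ζ)

/-- A torsion local shtuka over `R`: a finitely presented `R⟦z⟧`-module `M` that is `z`-power
torsion and free over `R`, with an isomorphism `τ : (σ̂^* M)[1/(z - ζ)] ≃ M[1/(z - ζ)]`.
(An `R⟦z⟧`-linear map between modules over `R⟦z⟧[1/(z - ζ)]` is automatically linear over the
latter ring. As `M` is finitely generated over `R⟦z⟧`, nothing is lost by taking it in the
universe of `R`.) -/
structure TorsionLocalShtuka (F : Type*) [Field F] [Fintype F] {R : Type u} [CommRing R]
    [Algebra F R] (ζ : R) where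
  M : Type u
  [addCommGroup : AddCommGroup M]
  [module : Module R⟦X⟧ M]
  [moduleBase : Module R M]
  [isScalarTower : IsScalarTower R R⟦X⟧ M]
  finitePresentation : Module.FinitePresentation R⟦X⟧ M
  free : Module.Free R M
  torsion : ∀ m : M, ∃ n : ℕ, (PowerSeries.X : R⟦X⟧) ^ n • m = 0
  τ : LocalizedModule (zSubPowers ζ) (ScalarExt (frobSeries F R) M) ≃ₗ[R⟦X⟧]
    LocalizedModule (zSubPowers ζ) M

namespace TorsionLocalShtuka

attribute [instance] addCommGroup module moduleBase isScalarTower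

variable {F : Type*} [Field F] [Fintype F] {R : Type u} [CommRing R] [Algebra F R] {ζ : R}
  (N : TorsionLocalShtuka F ζ)

/-- (The image of) `M` in `M[1/(z - ζ)]`. -/
def lattice : Submodule R⟦X⟧ (LocalizedModule (zSubPowers ζ) N.M) :=
  LinearMap.range (LocalizedModule.mkLinearMap (zSubPowers ζ) N.M)

/-- `τ(σ̂^* M)` in `M[1/(z - ζ)]`. -/
def frobLattice : Submodule R⟦X⟧ (LocalizedModule (zSubPowers ζ) N.M) :=
  (LinearMap.range (LocalizedModule.mkLinearMap (zSubPowers ζ)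
    (ScalarExt (frobSeries F R) N.M))).map N.τ.toLinearMap

/-- `τ(σ̂^* M) ⊆ M`. -/
def IsEffective : Prop := N.frobLattice ≤ N.lattice

/-- `(z - ζ)^d M ⊆ τ(σ̂^* M) ⊆ M`. -/
def HeightLE (d : ℕ) : Prop :=
  (∀ m ∈ N.lattice, (PowerSeries.X - PowerSeries.C ζ : R⟦X⟧) ^ d • m ∈ N.frobLattice) ∧
    N.frobLattice ≤ N.lattice

end TorsionLocalShtuka

end Shtuka

/-! ### The Tate module and its Galois action -/

section Series

theorem frobSeries_map_algebraMap {F R L : Type*} [Field F] [Fintype F] [CommRing R] [Field L]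
    [Algebra F R] [Algebra F L] [Algebra R L] (a : R⟦X⟧) :
    frobSeries F L (PowerSeries.map (algebraMap R L) a) =
      PowerSeries.map (algebraMap R L) (frobSeries F R a) := by
  ext n
  simp [frobSeries]

theorem frobSeries_map_const {F L : Type*} [Field F] [Fintype F] [Field L] [Algebra F L]
    (a : F⟦X⟧) :
    frobSeries F L (PowerSeries.map (algebraMap F L) a) = PowerSeries.map (algebraMap F L) a := by
  ext n
  simp [frobSeries]

/-- The coefficientwise action of `g ∈ Gal(L/K)` on `L⟦z⟧`. -/
def galSeries {K L : Type*} [Field K] [Field L] [Algebra K L] (g : L ≃ₐ[K] L) : L⟦X⟧ →+* L⟦X⟧ :=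
  PowerSeries.map (g : L →+* L)

theorem galSeries_map_algebraMap {R K L : Type*} [CommRing R] [Field K] [Field L] [Algebra R K]
    [Algebra K L] [Algebra R L] [IsScalarTower R K L] (g : L ≃ₐ[K] L) (a : R⟦X⟧) :
    galSeries g (PowerSeries.map (algebraMap R L) a) = PowerSeries.map (algebraMap R L) a := by
  ext n
  simp [galSeries, IsScalarTower.algebraMap_apply R K L]

theorem galSeries_map_const {F : Type*} (R : Type*) {K L : Type*} [Field F] [CommRing R] [Field K]
    [Field L] [Algebra R K] [Algebra K L] [Algebra R L] [IsScalarTower R K L] [Algebra F R]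
    [Algebra F L] [IsScalarTower F R L] (g : L ≃ₐ[K] L) (a : F⟦X⟧) :
    galSeries g (PowerSeries.map (algebraMap F L) a) = PowerSeries.map (algebraMap F L) a := by
  ext n
  simp [galSeries, IsScalarTower.algebraMap_apply F R L, IsScalarTower.algebraMap_apply R K L]

theorem galSeries_frobSeries {F K L : Type*} [Field F] [Fintype F] [Field K] [Field L]
    [Algebra K L] [Algebra F L] (g : L ≃ₐ[K] L) (a : L⟦X⟧) :
    galSeries g (frobSeries F L a) = frobSeries F L (galSeries g a) := by
  ext n
  simp [galSeries, frobSeries]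

theorem isUnit_map_zSub {R : Type*} (K L : Type*) [CommRing R] [Field K] [Field L] [Algebra R K]
    [FaithfulSMul R K] [Algebra K L] [Algebra R L] [IsScalarTower R K L] {ζ : R} [NeZero ζ]
    (s : R⟦X⟧) (hs : s ∈ zSubPowers ζ) : IsUnit (PowerSeries.map (algebraMap R L) s) := by
  obtain ⟨n, rfl⟩ := hs
  change IsUnit (PowerSeries.map (algebraMap R L) ((PowerSeries.X - PowerSeries.C ζ) ^ n))
  rw [map_pow]
  refine IsUnit.pow n (PowerSeries.isUnit_iff_constantCoeff.2 ?_)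
  have h : algebraMap R L ζ ≠ 0 := by
    rw [IsScalarTower.algebraMap_apply R K L]
    simpa using NeZero.ne ζ
  simpa using h

end Series

namespace TorsionLocalShtuka

/-- `M ⊗_{R⟦z⟧} L⟦z⟧`. -/
def Fiber {F : Type*} [Field F] [Fintype F] {R : Type u} [CommRing R] [Algebra F R] {ζ : R}
    (N : TorsionLocalShtuka F ζ) (L : Type*) [Field L] [Algebra R L] : Type _ :=
  ScalarExt (PowerSeries.map (algebraMap R L)) N.M

section Fiber

variable {F : Type*} [Field F] [Fintype F] {R : Type u} [CommRing R] [Algebra F R] {ζ : R}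
variable (N : TorsionLocalShtuka F ζ) (K : Type*) [Field K] [Algebra R K]
variable (L : Type*) [Field L] [Algebra K L] [Algebra R L] [IsScalarTower R K L]

instance : AddCommGroup (N.Fiber L) := ScalarExt.instAddCommGroup _ _

instance : Module L⟦X⟧ (N.Fiber L) := ScalarExt.instModule _ _

/-- The action of `F⟦z⟧ ⊆ L⟦z⟧`. -/
instance [Algebra F L] : Module F⟦X⟧ (N.Fiber L) :=
  Module.compHom _ (PowerSeries.map (algebraMap F L))

theorem const_smul_def [Algebra F L] (a : F⟦X⟧) (x : N.Fiber L) :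
    a • x = PowerSeries.map (algebraMap F L) a • x := rfl

/-- The map `M → M ⊗ L⟦z⟧`, `m ↦ m ⊗ 1`. -/
def toFiber : N.M →ₛₗ[PowerSeries.map (algebraMap R L)] N.Fiber L :=
  ScalarExt.ι _

/-- The canonical map `M[1/(z - ζ)] → M ⊗ L⟦z⟧`; it exists as `z - ζ` is a unit in `L⟦z⟧`. -/
def locToFiber [FaithfulSMul R K] [NeZero ζ] :
    LocalizedModule (zSubPowers ζ) N.M →ₛₗ[PowerSeries.map (algebraMap R L)] N.Fiber L :=
  LocalizedModule.liftSemilinear _ _ (N.toFiber L) (isUnit_map_zSub K L)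

/-- `M → M ⊗ L⟦z⟧`, `m ↦ τ(σ̂^* m)`, where `σ̂^* m = m ⊗ 1 ∈ σ̂^* M`. -/
def tauFrob [FaithfulSMul R K] [NeZero ζ] : N.M →+ N.Fiber L where
  toFun m := N.locToFiber K L (N.τ (LocalizedModule.mk (ScalarExt.ι (frobSeries F R) m) 1))
  map_zero' := by simp
  map_add' x y := by
    rw [← map_add, ← map_add, LocalizedModule.mk_add_mk, one_smul, one_smul, one_mul, map_add]

theorem tauFrob_smul [FaithfulSMul R K] [NeZero ζ] [Algebra F L] (a : R⟦X⟧) (m : N.M) :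
    N.tauFrob K L (a • m) =
      frobSeries F L (PowerSeries.map (algebraMap R L) a) • N.tauFrob K L m := by
  rw [frobSeries_map_algebraMap]
  simp only [tauFrob, AddMonoidHom.coe_mk, ZeroHom.coe_mk]
  rw [map_smulₛₗ, ← LocalizedModule.smul'_mk, map_smul, map_smulₛₗ]

/-- The `σ̂`-semilinear endomorphism `x ↦ τ(σ̂^* x)` of `M ⊗ L⟦z⟧`,
`b ⊗ m ↦ σ̂(b) • τ(σ̂^* m)`. -/
def phi [FaithfulSMul R K] [NeZero ζ] [Algebra F L] : N.Fiber L →ₛₗ[frobSeries F L] N.Fiber L :=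
  ScalarExt.lift (frobSeries F L) (N.tauFrob K L) (N.tauFrob_smul K L)

theorem phi_toFiber [FaithfulSMul R K] [NeZero ζ] [Algebra F L] (m : N.M) :
    N.phi K L (N.toFiber L m) = N.tauFrob K L m :=
  ScalarExt.lift_ι _ _ _ m

variable {K L} in
/-- The semilinear action of `g ∈ Gal(L/K)` on `M ⊗ L⟦z⟧` through the second factor. -/
def gal (g : L ≃ₐ[K] L) : N.Fiber L →ₛₗ[galSeries g] N.Fiber L :=
  ScalarExt.lift (galSeries g) (N.toFiber L).toAddMonoidHom (by
    intro a m
    rw [galSeries_map_algebraMap]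
    exact (N.toFiber L).map_smulₛₗ a m)

theorem gal_toFiber (g : L ≃ₐ[K] L) (m : N.M) : N.gal g (N.toFiber L m) = N.toFiber L m :=
  ScalarExt.lift_ι _ _ _ m

theorem fiber_induction {p : N.Fiber L → Prop} (h0 : p 0) (hι : ∀ (b : L⟦X⟧) (m : N.M), p (b • N.toFiber L m))
    (hadd : ∀ x y, p x → p y → p (x + y)) (x : N.Fiber L) : p x :=
  ScalarExt.induction _ h0 hι hadd x

theorem gal_locToFiber [FaithfulSMul R K] [NeZero ζ] (g : L ≃ₐ[K] L) (y : LocalizedModule (zSubPowers ζ) N.M) :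
    N.gal g (N.locToFiber K L y) = N.locToFiber K L y := by
  induction y using LocalizedModule.induction_on with
  | h m s =>
    have h := LocalizedModule.smul_liftSemilinear _ _ (N.toFiber L)
      (isUnit_map_zSub (ζ := ζ) K L) m s
    have h' := congrArg (N.gal g) h
    rw [map_smulₛₗ, galSeries_map_algebraMap, gal_toFiber, ← h] at h'
    exact (isUnit_map_zSub (ζ := ζ) K L s.1 s.2).smul_left_cancel.1 h'

theorem gal_phi [FaithfulSMul R K] [NeZero ζ] [Algebra F L] (g : L ≃ₐ[K] L) (x : N.Fiber L) :
    N.gal g (N.phi K L x) = N.phi K L (N.gal g x) := by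
  induction x using fiber_induction with
  | h0 => simp
  | hι b m =>
    rw [map_smulₛₗ, map_smulₛₗ, map_smulₛₗ, map_smulₛₗ, gal_toFiber, phi_toFiber,
      galSeries_frobSeries]
    congr 1
    exact N.gal_locToFiber K L g _
  | hadd x y hx hy => simp only [map_add, hx, hy]

theorem gal_one (x : N.Fiber L) : N.gal (1 : L ≃ₐ[K] L) x = x := by
  induction x using fiber_induction with
  | h0 => simp
  | hι b m =>
    rw [map_smulₛₗ, gal_toFiber]
    congr 1
  | hadd x y hx hy => simp only [map_add, hx, hy]

theorem gal_mul (g h : L ≃ₐ[K] L) (x : N.Fiber L) : N.gal (g * h) x = N.gal g (N.gal h x) := by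
  induction x using fiber_induction with
  | h0 => simp
  | hι b m =>
    rw [map_smulₛₗ, map_smulₛₗ, map_smulₛₗ, gal_toFiber, gal_toFiber, gal_toFiber]
    congr 1
  | hadd x y hx hy => simp only [map_add, hx, hy]

/-- The (dual) Tate module `{x ∈ M ⊗ L⟦z⟧ | τ(σ̂^* x) = x}`. -/
def tate [FaithfulSMul R K] [NeZero ζ] [Algebra F L] : Submodule F⟦X⟧ (N.Fiber L) where
  carrier := {x | N.phi K L x = x}
  zero_mem' := map_zero _
  add_mem' {x y} hx hy := by
    simp only [Set.mem_ofPred_eq, map_add] at *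
    rw [hx, hy]
  smul_mem' a x hx := by
    simp only [Set.mem_ofPred_eq, const_smul_def] at *
    rw [map_smulₛₗ, frobSeries_map_const, hx]

/-- The action of `Gal(L/K)` on the (dual) Tate module. -/
def tateRep [FaithfulSMul R K] [NeZero ζ] [Algebra F L] [IsScalarTower F R L] :
    Representation F⟦X⟧ (L ≃ₐ[K] L) (N.tate K L) where
  toFun g :=
    { toFun := fun x => ⟨N.gal g x, by
        have hx : N.phi K L x = x := x.2
        change N.phi K L (N.gal g x) = N.gal g x
        rw [← gal_phi, hx]⟩
      map_add' := fun x y => Subtype.ext (map_add (N.gal g) _ _)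
      map_smul' := fun a x => Subtype.ext (by
        change N.gal g (a • (x : N.Fiber L)) = a • N.gal g (x : N.Fiber L)
        rw [const_smul_def, map_smulₛₗ, galSeries_map_const R, ← const_smul_def]) }
  map_one' := by
    ext x
    exact N.gal_one K L x
  map_mul' g h := by
    ext x
    exact N.gal_mul K L g h x

end Fiber

end TorsionLocalShtuka

/-! ### The cyclotomic character -/

section Cyclotomic

set_option linter.unusedSectionVars false

variable {F : Type*} [Field F] [Fintype F] {L : Type*} [Field L] [Algebra F L]

/-- The equations `ℓ₀ ^ (q̂ - 1) = -ζ` and `ℓᵢ ^ q̂ + ζ ℓᵢ = ℓᵢ₋₁` for `i ≥ 1`, where `q̂ = #F`. -/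
def IsDivisionTower (F : Type*) [Fintype F] {L : Type*} [Field L] (ζ : L) (ℓ : ℕ → L) : Prop :=
  ℓ 0 ^ (Fintype.card F - 1) = -ζ ∧ ∀ i, ℓ (i + 1) ^ Fintype.card F + ζ * ℓ (i + 1) = ℓ i

variable (F) in
theorem cast_card_eq_zero_of_algebra : (Fintype.card F : L) = 0 := by
  rw [← map_natCast (algebraMap F L), FiniteField.cast_card_eq_zero, map_zero]

variable (F) in
theorem exists_isDivisionTower [IsSepClosed L] {ζ : L} (hζ : ζ ≠ 0) :
    ∃ ℓ : ℕ → L, IsDivisionTower F ζ ℓ := by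
  have hq : 2 ≤ Fintype.card F := Fintype.one_lt_card
  have h0 : (Fintype.card F : L) = 0 := cast_card_eq_zero_of_algebra F
  have hne : NeZero ((Fintype.card F - 1 : ℕ) : L) := ⟨by
    rw [Nat.cast_sub (by omega), h0]
    simp⟩
  obtain ⟨x, hx⟩ := IsSepClosed.exists_pow_nat_eq (-ζ) (Fintype.card F - 1)
  have hs : ∀ c : L, ∃ y : L, y ^ Fintype.card F + ζ * y = c := by
    intro c
    obtain ⟨y, hy⟩ := IsSepClosed.exists_root_C_mul_X_pow_add_C_mul_X_add_C 1 ζ (-c) h0 hq hζ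
    exact ⟨y, by linear_combination hy⟩
  choose s hs using hs
  exact ⟨fun i => Nat.rec x (fun _ y => s y) i, hx, fun i => hs _⟩

namespace IsDivisionTower

variable {ζ : L} {ℓ : ℕ → L}

theorem isUnit_mk (h : IsDivisionTower F ζ ℓ) (hζ : ζ ≠ 0) : IsUnit (PowerSeries.mk ℓ) := by
  rw [PowerSeries.isUnit_iff_constantCoeff, PowerSeries.constantCoeff_mk, isUnit_iff_ne_zero]
  intro h0
  have h1 := h.1
  have hq : 1 < Fintype.card F := Fintype.one_lt_card
  rw [h0, zero_pow (by omega)] at h1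
  exact hζ (neg_eq_zero.1 h1.symm)

/-- `σ̂(ℓ₊) = (z - ζ) ℓ₊`. -/
theorem frobSeries_mk (h : IsDivisionTower F ζ ℓ) :
    frobSeries F L (PowerSeries.mk ℓ) =
      (PowerSeries.X - PowerSeries.C ζ) * PowerSeries.mk ℓ := by
  have hq : 1 < Fintype.card F := Fintype.one_lt_card
  ext n
  rw [sub_mul, map_sub, PowerSeries.coeff_C_mul]
  cases n with
  | zero =>
    have h1 := h.1
    have : Fintype.card F = Fintype.card F - 1 + 1 := by omega
    simp only [frobSeries, PowerSeries.coeff_map, PowerSeries.coeff_mk,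
      PowerSeries.coeff_zero_X_mul]
    change ℓ 0 ^ Fintype.card F = _
    rw [this, pow_succ, h1]
    ring
  | succ n =>
    simp only [frobSeries, PowerSeries.coeff_map, PowerSeries.coeff_mk,
      PowerSeries.coeff_succ_X_mul]
    change ℓ (n + 1) ^ Fintype.card F = _
    linear_combination h.2 n

end IsDivisionTower

theorem exists_algebraMap_eq_of_pow_card {x : L} (hx : x ^ Fintype.card F = x) :
    ∃ a : F, algebraMap F L a = x := by
  classical
  have hq : 1 < Fintype.card F := Fintype.one_lt_card
  let p : Polynomial L := Polynomial.X ^ Fintype.card F - Polynomial.X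
  have hp : p ≠ 0 := FiniteField.X_pow_card_sub_X_ne_zero L hq
  have hroot : ∀ y : L, y ∈ p.roots.toFinset ↔ y ^ Fintype.card F = y := by
    intro y
    rw [Multiset.mem_toFinset, Polynomial.mem_roots hp]
    simp [p, sub_eq_zero]
  have hsub : Finset.univ.image (algebraMap F L) ⊆ p.roots.toFinset := by
    intro y hy
    obtain ⟨a, -, rfl⟩ := Finset.mem_image.1 hy
    rw [hroot, ← map_pow, FiniteField.pow_card]
  have hcard : p.roots.toFinset.card ≤ (Finset.univ.image (algebraMap F L)).card := by
    rw [Finset.card_image_of_injective _ (algebraMap F L).injective, Finset.card_univ]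
    calc p.roots.toFinset.card ≤ Multiset.card p.roots := Multiset.toFinset_card_le _
      _ ≤ p.natDegree := Polynomial.card_roots' p
      _ = Fintype.card F := FiniteField.X_pow_card_sub_X_natDegree_eq L hq
  have hmem : x ∈ Finset.univ.image (algebraMap F L) := by
    rw [Finset.eq_of_subset_of_card_le hsub hcard, hroot]
    exact hx
  obtain ⟨a, -, ha⟩ := Finset.mem_image.1 hmem
  exact ⟨a, ha⟩

/-- Two solutions of `σ̂(y) = c y`, the second of them a unit, differ by a factor in `F⟦z⟧`. -/
theorem exists_eq_map_mul_of_frobSeries {a b c : L⟦X⟧} (ha : frobSeries F L a = c * a)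
    (hb : frobSeries F L b = c * b) (hu : IsUnit b) :
    ∃ v : F⟦X⟧, a = PowerSeries.map (algebraMap F L) v * b := by
  obtain ⟨b, rfl⟩ := hu
  have hu : frobSeries F L (a * ↑b⁻¹) = a * ↑b⁻¹ := by
    have h1 : frobSeries F L (a * ↑b⁻¹) * frobSeries F L b = a * ↑b⁻¹ * frobSeries F L b := by
      rw [← map_mul, mul_assoc, Units.inv_mul, mul_one, ha, hb]
      linear_combination (-c * a) * b.inv_mul
    exact (b.isUnit.map (frobSeries F L)).mul_right_cancel h1
  have hco : ∀ n, ∃ v : F, algebraMap F L v = PowerSeries.coeff n (a * ↑b⁻¹ : L⟦X⟧) := by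
    intro n
    apply exists_algebraMap_eq_of_pow_card
    conv_rhs => rw [← hu]
    rfl
  choose v hv using hco
  refine ⟨PowerSeries.mk v, ?_⟩
  have : PowerSeries.map (algebraMap F L) (PowerSeries.mk v) = a * ↑b⁻¹ := by
    ext n
    simp [hv]
  rw [this, mul_assoc, Units.inv_mul, mul_one]

end Cyclotomic

section Character

set_option linter.unusedSectionVars false

variable (F : Type*) [Field F] [Fintype F] {R : Type*} [CommRing R] [Algebra F R] (ζ : R)
variable (K : Type*) [Field K] [Algebra R K] [FaithfulSMul R K]
variable (L : Type*) [Field L] [Algebra K L] [Algebra R L] [IsScalarTower R K L] [Algebra F L]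

variable {L} in
theorem IsDivisionTower.exists_galSeries_eq [NeZero ζ] {ℓ ℓ' : ℕ → L}
    (h : IsDivisionTower F (algebraMap R L ζ) ℓ) (h' : IsDivisionTower F (algebraMap R L ζ) ℓ')
    (g : L ≃ₐ[K] L) : ∃ v : F⟦X⟧,
      galSeries g (PowerSeries.mk ℓ') = PowerSeries.map (algebraMap F L) v * PowerSeries.mk ℓ := by
  have hζ : algebraMap R L ζ ≠ 0 := by
    rw [IsScalarTower.algebraMap_apply R K L]
    simpa using NeZero.ne ζ
  refine exists_eq_map_mul_of_frobSeries
    (c := PowerSeries.X - PowerSeries.C (algebraMap R L ζ)) ?_ h.frobSeries_mk (h.isUnit_mk hζ)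
  rw [← galSeries_frobSeries, h'.frobSeries_mk, map_mul]
  congr 1
  have := galSeries_map_algebraMap g (PowerSeries.X - PowerSeries.C ζ)
  simpa using this

theorem exists_isDivisionTower_algebraMap [NeZero ζ] [IsSepClosure K L] :
    ∃ ℓ : ℕ → L, IsDivisionTower F (algebraMap R L ζ) ℓ := by
  have := IsSepClosure.sep_closed K (K := L)
  refine exists_isDivisionTower F ?_
  rw [IsScalarTower.algebraMap_apply R K L]
  simpa using NeZero.ne ζ

/-- The `ε`-adic cyclotomic character `χ : Gal(L/K) → F⟦z⟧ˣ`, characterized by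
`g(ℓ₊) = χ(g) ℓ₊` where `ℓ₊ = ∑ ℓᵢ zⁱ` for some (equivalently, any) `ℓ` that satisfies
`IsDivisionTower`; see `galSeries_mk_eq_cyclotomicChar_mul`. -/
def cyclotomicChar [IsScalarTower F R L] [NeZero ζ] [IsSepClosure K L] :
    (L ≃ₐ[K] L) →* F⟦X⟧ˣ :=
  let h := (exists_isDivisionTower_algebraMap F ζ K L).choose_spec
  let hex := fun g : L ≃ₐ[K] L => h.exists_galSeries_eq F ζ K h g
  have hinj : ∀ v w : F⟦X⟧, PowerSeries.map (algebraMap F L) v *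
      PowerSeries.mk (exists_isDivisionTower_algebraMap F ζ K L).choose =
      PowerSeries.map (algebraMap F L) w *
      PowerSeries.mk (exists_isDivisionTower_algebraMap F ζ K L).choose → v = w := by
    intro v w hvw
    have hζ : algebraMap R L ζ ≠ 0 := by
      rw [IsScalarTower.algebraMap_apply R K L]
      simpa using NeZero.ne ζ
    exact PowerSeries.map_injective _ (algebraMap F L).injective
      ((h.isUnit_mk hζ).mul_right_cancel hvw)
  MonoidHom.toHomUnits
    { toFun := fun g => (hex g).choose
      map_one' := hinj _ _ (by
        rw [← (hex 1).choose_spec, map_one, one_mul]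
        rfl)
      map_mul' := fun g g' => hinj _ _ (by
        rw [← (hex (g * g')).choose_spec, map_mul, mul_right_comm, ← (hex g).choose_spec]
        have h1 := congrArg (galSeries g) (hex g').choose_spec
        rw [map_mul, galSeries_map_const R, mul_comm] at h1
        exact h1) }

theorem galSeries_mk_eq_cyclotomicChar_mul [IsScalarTower F R L] [NeZero ζ] [IsSepClosure K L]
    {ℓ : ℕ → L} (h : IsDivisionTower F (algebraMap R L ζ) ℓ) (g : L ≃ₐ[K] L) :
    galSeries g (PowerSeries.mk ℓ) =
      PowerSeries.map (algebraMap F L) (cyclotomicChar F ζ K L g) * PowerSeries.mk ℓ := by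
  have h₀ := (exists_isDivisionTower_algebraMap F ζ K L).choose_spec
  have hg : galSeries g (PowerSeries.mk (exists_isDivisionTower_algebraMap F ζ K L).choose) =
      PowerSeries.map (algebraMap F L) (cyclotomicChar F ζ K L g) *
        PowerSeries.mk (exists_isDivisionTower_algebraMap F ζ K L).choose :=
    (h₀.exists_galSeries_eq F ζ K h₀ g).choose_spec
  obtain ⟨v, hv⟩ := h₀.exists_galSeries_eq F ζ K h (1 : L ≃ₐ[K] L)
  have hv' : PowerSeries.mk ℓ = PowerSeries.map (algebraMap F L) v *
      PowerSeries.mk (exists_isDivisionTower_algebraMap F ζ K L).choose := hv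
  rw [hv', map_mul, galSeries_map_const R, hg]
  ring

end Character

/-! ### Torsion Galois representations -/

section Representation

/-- The twist `ρ ⊗ ψ` of a representation by a character. -/
def Representation.twist {A G V : Type*} [CommRing A] [Group G] [AddCommGroup V] [Module A V]
    (ρ : Representation A G V) (ψ : G →* Aˣ) : Representation A G V where
  toFun g := (ψ g : A) • ρ g
  map_one' := by simp
  map_mul' g h := by
    ext x
    simp only [map_mul, Units.val_mul, LinearMap.smul_apply, Module.End.mul_apply, map_smul,
      mul_smul]
    rw [smul_comm]

/-- The direct product of a family of representations. -/
def Representation.piRep {A G ι : Type*} [CommRing A] [Group G] {V : ι → Type*}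
    [∀ i, AddCommGroup (V i)] [∀ i, Module A (V i)] (ρ : ∀ i, Representation A G (V i)) :
    Representation A G (∀ i, V i) where
  toFun g := LinearMap.pi fun i => ρ i g ∘ₗ LinearMap.proj i
  map_one' := by
    ext x i
    simp
  map_mul' g h := by
    ext x i
    simp

/-- The module `Q / A`, where `Q` is the fraction field of the domain `A`. -/
abbrev FractionQuotient (A : Type*) [CommRing A] [IsDomain A] : Type _ :=
  FractionRing A ⧸ LinearMap.range (Algebra.linearMap A (FractionRing A))

/-- The contragredient representation on `Hom_A(V, Q / A)`: `(g • f)(v) = f(g⁻¹ v)`. -/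
def Representation.pontryaginDual {A G V : Type*} [CommRing A] [IsDomain A] [Group G]
    [AddCommGroup V] [Module A V] (ρ : Representation A G V) :
    Representation A G (V →ₗ[A] FractionQuotient A) :=
  ρ.linHom (Representation.trivial A G (FractionQuotient A))

variable {F : Type*} [Field F] [Fintype F] {R : Type u} [CommRing R] [Algebra F R] (ζ : R)
  [NeZero ζ]
variable {K : Type*} [Field K] [Algebra R K] [FaithfulSMul R K]
variable {L : Type*} [Field L] [Algebra K L] [Algebra R L] [IsScalarTower R K L] [Algebra F L]
  [IsScalarTower F R L]
variable {T : Type*} [AddCommGroup T] [Module F⟦X⟧ T]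

/-- `T` is a finite-length torsion `F⟦z⟧`-module with a discrete action of `Gal(L/K)`. -/
structure IsTorsionGaloisRep {F K L T : Type*} [Field F] [Field K] [Field L] [Algebra K L]
    [AddCommGroup T] [Module F⟦X⟧ T] (ρ : Representation F⟦X⟧ (L ≃ₐ[K] L) T) : Prop where
  finiteLength : IsFiniteLength F⟦X⟧ T
  torsion : Module.IsTorsion F⟦X⟧ T
  discrete : ∀ t : T, IsOpen {g : L ≃ₐ[K] L | ρ g t = t}

/-- `T` admits an effective torsion local shtuka model with height `≤ d`. -/
def AdmitsEffectiveModel (d : ℕ) (ρ : Representation F⟦X⟧ (L ≃ₐ[K] L) T) : Prop :=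
  ∃ N : TorsionLocalShtuka F ζ, N.IsEffective ∧ N.HeightLE d ∧
    Nonempty (Representation.Equiv ρ (N.tateRep K L))

/-- The objects of the full subcategory of the category of torsion representations of `Gal(L/K)`
formed by those that admit an effective torsion local shtuka model with height `≤ d`. -/
def IsEffectiveTorsionRep (d : ℕ) (ρ : Representation F⟦X⟧ (L ≃ₐ[K] L) T) : Prop :=
  IsTorsionGaloisRep ρ ∧ AdmitsEffectiveModel ζ d ρ

end Representation

end

/-! The problem is first reduced to semilinear algebra over `R`. If `M` is finite free over `R` and
`z` acts nilpotently, then `z - ζ` acts injectively, because `z` would act as `ζ ≠ 0` on its kernel.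
Hence `M` embeds in `M[1/(z - ζ)]`, and an effective torsion local shtuka of height `≤ d` is the
same as such an `M` with a `σ̂`-semilinear `φ` for which `(z - ζ)^d M` lies in the span of `φ(M)`
(`IsFrobeniusModel`). Comparing ranks shows that the linearization of `φ` is injective.

Over `L` the element `z - ζ` becomes invertible, so `φ` becomes étale, and Lang's theorem
(`span_fixed_eq_top`) gives the fibre an `L`-basis of fixed vectors. The Tate module therefore has
`q^(rank M)` elements, where `q = #F`, and its submodules can be recovered from their `L`-spans.
Such counts replace exactness arguments: an equivariant injection between finite sets of the right
size is an isomorphism.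

Subquotients: the `L`-span of a Galois stable submodule `T` of the Tate module is Galois stable,
hence by descent spanned by its intersection `P` with `M`. This `P` is saturated and `φ`-stable, and
both `P` and `M/P` keep height `≤ d` (`IsFrobeniusModel.restrict`, `IsFrobeniusModel.quotient`).
Their Tate modules are `T` and the quotient by `T` (`exists_sub`, `exists_quotient`). Products are
formed on models.

Duality: `Hom_R(M, R)` carries a Frobenius `φ'` with `⟨φ' f, φ m⟩ = (z - ζ)^d σ̂⟨f, m⟩`, where `⟨f,
m⟩ = ∑ f(z^(n-k) m) z^k` modulo `z^(n+1)`. On fixed vectors `x`, `y` the value `B` satisfies `B = (z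
- ζ)^d σ̂(B)`. Since `σ̂(ℓ₊) = (z - ζ) ℓ₊`, the product `ℓ₊^d B` is `σ̂`-invariant. It thus lies in
`F⟦z⟧/z^(n+1)`, which embeds in `Q/A`. The Galois action on `ℓ₊^d` produces the twist by `χ^(-d)`.
The resulting map from the Tate module of the dual to the twisted Pontryagin dual is injective, and
counting makes it an isomorphism. -/

noncomputable section

/-! ### Modules over power series on which the variable acts nilpotently -/

section Nilpotent

variable {R M : Type*} [CommRing R] [AddCommGroup M] [Module R⟦X⟧ M] [Module R M]
  [IsScalarTower R R⟦X⟧ M]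

theorem PowerSeries.C_smul (r : R) (m : M) : (PowerSeries.C r : R⟦X⟧) • m = r • m := by
  rw [← mul_one (PowerSeries.C r), ← PowerSeries.smul_eq_C_mul, smul_assoc, one_smul]

/-- Only the truncation of `a` acts on an element killed by `z^n`. Statements about `R⟦z⟧`-modules
thereby become linear algebra over `R` with a nilpotent operator `z`. -/
theorem PowerSeries.smul_eq_sum_of_X_pow_smul_eq_zero {n : ℕ} {m : M}
    (h : (PowerSeries.X : R⟦X⟧) ^ n • m = 0) (a : R⟦X⟧) :
    a • m = ∑ k ∈ Finset.range n, PowerSeries.coeff k a • (PowerSeries.X : R⟦X⟧) ^ k • m := by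
  have ht : (PowerSeries.trunc n a : R⟦X⟧) = ∑ k ∈ Finset.range n,
      PowerSeries.C (PowerSeries.coeff k a) * PowerSeries.X ^ k := by
    ext j
    simp [PowerSeries.coeff_trunc, PowerSeries.coeff_X_pow]
  conv_lhs => rw [PowerSeries.eq_shift_mul_X_pow_add_trunc n a]
  rw [add_smul, mul_smul, h, smul_zero, zero_add, ht, Finset.sum_smul]
  refine Finset.sum_congr rfl fun k _ => ?_
  rw [mul_smul, PowerSeries.C_smul]

theorem PowerSeries.smul_comm_base (r : R) (a : R⟦X⟧) (m : M) : r • a • m = a • r • m := by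
  rw [← PowerSeries.C_smul, ← PowerSeries.C_smul r m, smul_comm]

end Nilpotent

/-! ### Bases of extensions of scalars -/

section Residue

set_option linter.unusedSectionVars false

variable {R L M : Type*} [CommRing R] [CommRing L] [AddCommGroup M] [Module R⟦X⟧ M] [Module R M]
  [IsScalarTower R R⟦X⟧ M] {f : R →+* L}

/-- The quotient `L⟦z⟧ / z ^ (n + 1)`. -/
abbrev TruncSeries (L : Type*) [CommRing L] (n : ℕ) : Type _ :=
  L⟦X⟧ ⧸ Ideal.span {(PowerSeries.X : L⟦X⟧) ^ (n + 1)}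

theorem TruncSeries.mk_eq_mk_iff {n : ℕ} {a b : L⟦X⟧} :
    (Ideal.Quotient.mk _ a : TruncSeries L n) = Ideal.Quotient.mk _ b ↔
      ∀ k ≤ n, PowerSeries.coeff k a = PowerSeries.coeff k b := by
  rw [Ideal.Quotient.eq, Ideal.mem_span_singleton, PowerSeries.X_pow_dvd_iff]
  simp only [map_sub, sub_eq_zero, Nat.lt_succ_iff]

/-- The series `∑ k ≤ n, lam (z ^ (n - k) m) z ^ k` modulo `z ^ (n + 1)`; its top coefficient is
`lam m`. -/
def residueHom {n : ℕ} (hX : ∀ m : M, (PowerSeries.X : R⟦X⟧) ^ (n + 1) • m = 0)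
    (lam : M →ₛₗ[f] L) : M →ₛₗ[PowerSeries.map f] TruncSeries L n where
  toFun m := Ideal.Quotient.mk _
    (PowerSeries.mk fun k => lam ((PowerSeries.X : R⟦X⟧) ^ (n - k) • m))
  map_add' x y := by
    rw [← map_add]
    congr 1
    ext k
    simp
  map_smul' a m := by
    rw [← Ideal.Quotient.mk_eq_mk, ← Ideal.Quotient.mk_eq_mk, ← Submodule.Quotient.mk_smul,
      Ideal.Quotient.mk_eq_mk, Ideal.Quotient.mk_eq_mk, TruncSeries.mk_eq_mk_iff]
    intro k hk
    -- As `z^(k+1)` kills `z^(n-k) m`, only the coefficients of `a` up to degree `k` contribute, and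
    -- these give exactly the Cauchy product.
    rw [smul_eq_mul, PowerSeries.coeff_mul, Finset.Nat.sum_antidiagonal_eq_sum_range_succ_mk,
      PowerSeries.coeff_mk, smul_comm, PowerSeries.smul_eq_sum_of_X_pow_smul_eq_zero (n := k + 1),
      map_sum]
    · refine Finset.sum_congr rfl fun i hi => ?_
      have hi' : i ≤ k := Nat.lt_succ_iff.1 (Finset.mem_range.1 hi)
      rw [map_smulₛₗ, PowerSeries.coeff_map, PowerSeries.coeff_mk, smul_smul, ← pow_add,
        smul_eq_mul]
      congr 5
      omega
    · rw [smul_smul, ← pow_add, show k + 1 + (n - k) = n + 1 by omega, hX]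

theorem residueHom_apply {n : ℕ} (hX : ∀ m : M, (PowerSeries.X : R⟦X⟧) ^ (n + 1) • m = 0)
    (lam : M →ₛₗ[f] L) (m : M) : residueHom hX lam m = Ideal.Quotient.mk _
    (PowerSeries.mk fun k => lam ((PowerSeries.X : R⟦X⟧) ^ (n - k) • m)) := rfl

/-- The coefficient of `z ^ n` on `L⟦z⟧ / z ^ (n + 1)`. -/
def TruncSeries.topCoeff (L : Type*) [CommRing L] (n : ℕ) : TruncSeries L n →+ L :=
  QuotientAddGroup.lift _ (PowerSeries.coeff n : L⟦X⟧ →ₗ[L] L).toAddMonoidHom (by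
    intro x hx
    have hx' : x ∈ Ideal.span {(PowerSeries.X : L⟦X⟧) ^ (n + 1)} := hx
    rw [Ideal.mem_span_singleton, PowerSeries.X_pow_dvd_iff] at hx'
    exact hx' n (Nat.lt_succ_self n))

theorem TruncSeries.topCoeff_mk {n : ℕ} (a : L⟦X⟧) :
    TruncSeries.topCoeff L n (Ideal.Quotient.mk _ a) = PowerSeries.coeff n a := rfl

theorem TruncSeries.topCoeff_C_smul {n : ℕ} (c : L) (x : TruncSeries L n) :
    TruncSeries.topCoeff L n ((PowerSeries.C c : L⟦X⟧) • x) = c * TruncSeries.topCoeff L n x := by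
  obtain ⟨a, rfl⟩ := Ideal.Quotient.mk_surjective x
  rw [← Ideal.Quotient.mk_eq_mk, ← Submodule.Quotient.mk_smul, Ideal.Quotient.mk_eq_mk,
    Ideal.Quotient.mk_eq_mk, topCoeff_mk, topCoeff_mk, smul_eq_mul, PowerSeries.coeff_C_mul]

theorem topCoeff_residueHom {n : ℕ} (hX : ∀ m : M, (PowerSeries.X : R⟦X⟧) ^ (n + 1) • m = 0)
    (lam : M →ₛₗ[f] L) (m : M) : TruncSeries.topCoeff L n (residueHom hX lam m) = lam m := by
  rw [residueHom_apply, TruncSeries.topCoeff_mk, PowerSeries.coeff_mk, Nat.sub_self, pow_zero,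
    one_smul]

namespace ScalarExt

/-- The action of the coefficients on a module over power series. -/
instance moduleCoeff {A B : Type*} [CommRing A] [CommRing B] [Module A M] (g : A →+* B⟦X⟧) :
    Module B (ScalarExt g M) :=
  Module.compHom _ (PowerSeries.C : B →+* B⟦X⟧)

instance isScalarTower_coeff {A B : Type*} [CommRing A] [CommRing B] [Module A M]
    (g : A →+* B⟦X⟧) : IsScalarTower B B⟦X⟧ (ScalarExt g M) :=
  ⟨fun r a x => by
    rw [PowerSeries.smul_eq_C_mul, mul_smul]
    rfl⟩

/-- A semilinear functional on `M` extends to the extension of scalars. -/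
theorem exists_functional {n : ℕ} (hX : ∀ m : M, (PowerSeries.X : R⟦X⟧) ^ n • m = 0)
    (lam : M →ₛₗ[f] L) : ∃ Lam : ScalarExt (PowerSeries.map f) M →ₗ[L] L,
      ∀ m, Lam (ι (PowerSeries.map f) m) = lam m := by
  -- `TruncSeries L n` is a quotient by `z^(n+1)`, so the nilpotency exponent is raised by one.
  have hX' : ∀ m : M, (PowerSeries.X : R⟦X⟧) ^ (n + 1) • m = 0 := fun m => by
    rw [pow_succ', mul_smul, hX, smul_zero]
  -- `lam` itself is only linear over the coefficients and cannot be extended along `R⟦z⟧ → L⟦z⟧`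
  -- directly. Its residue series is semilinear over power series, hence extends, and the top
  -- coefficient recovers `lam`.
  let l : ScalarExt (PowerSeries.map f) M →ₛₗ[RingHom.id L⟦X⟧] TruncSeries L n :=
    lift (RingHom.id _) (residueHom hX' lam).toAddMonoidHom
      (fun a m => (residueHom hX' lam).map_smulₛₗ a m)
  refine ⟨{ toFun := fun x => TruncSeries.topCoeff L n (l x),
            map_add' := fun x y => by rw [map_add, map_add],
            map_smul' := fun c x => ?_ }, fun m => ?_⟩
  · rw [← PowerSeries.C_smul, map_smul, TruncSeries.topCoeff_C_smul]
    rfl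
  · change TruncSeries.topCoeff L n (l (ι (PowerSeries.map f) m)) = lam m
    rw [show l (ι (PowerSeries.map f) m) = residueHom hX' lam m from lift_ι _ _ _ m]
    exact topCoeff_residueHom hX' lam m

theorem ι_smul_base (r : R) (m : M) :
    ι (PowerSeries.map f) (r • m) = f r • ι (PowerSeries.map f) m := by
  rw [← PowerSeries.C_smul, map_smulₛₗ, PowerSeries.map_C, PowerSeries.C_smul]

theorem X_pow_smul_eq_zero {n : ℕ} (hX : ∀ m : M, (PowerSeries.X : R⟦X⟧) ^ n • m = 0)
    (x : ScalarExt (PowerSeries.map f) M) : (PowerSeries.X : L⟦X⟧) ^ n • x = 0 := by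
  induction x using ScalarExt.induction with
  | h0 => simp
  | hι b m =>
    have h := (ι (PowerSeries.map f)).map_smulₛₗ ((PowerSeries.X : R⟦X⟧) ^ n) m
    rw [hX, map_zero, map_pow, PowerSeries.map_X] at h
    rw [smul_comm, ← h, smul_zero]
  | hadd x y hx hy => rw [smul_add, hx, hy, add_zero]

theorem span_range_ι {n : ℕ} (hX : ∀ m : M, (PowerSeries.X : R⟦X⟧) ^ n • m = 0) :
    Submodule.span L (Set.range (ι (PowerSeries.map f) (M := M))) = ⊤ := by
  rw [eq_top_iff]
  rintro x -
  induction x using ScalarExt.induction with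
  | h0 => exact zero_mem _
  | hι b m =>
    rw [PowerSeries.smul_eq_sum_of_X_pow_smul_eq_zero (X_pow_smul_eq_zero hX _)]
    refine sum_mem fun k _ => Submodule.smul_mem _ _ (Submodule.subset_span
      ⟨(PowerSeries.X : R⟦X⟧) ^ k • m, ?_⟩)
    rw [map_smulₛₗ, map_pow, PowerSeries.map_X]
  | hadd x y hx hy => exact add_mem hx hy

theorem span_range_ι_basis {n : ℕ} (hX : ∀ m : M, (PowerSeries.X : R⟦X⟧) ^ n • m = 0)
    {κ : Type*} {b : κ → M} (hb : Submodule.span R (Set.range b) = ⊤) :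
    Submodule.span L (Set.range fun i => ι (PowerSeries.map f) (b i)) = ⊤ := by
  rw [eq_top_iff, ← span_range_ι hX, Submodule.span_le]
  rintro _ ⟨m, rfl⟩
  have hm : m ∈ Submodule.span R (Set.range b) := hb ▸ Submodule.mem_top
  induction hm using Submodule.span_induction with
  | mem x hx =>
    obtain ⟨i, rfl⟩ := hx
    exact Submodule.subset_span ⟨i, rfl⟩
  | zero => rw [map_zero]; exact zero_mem _
  | add x y _ _ hx hy => rw [map_add]; exact add_mem hx hy
  | smul r x _ hx => rw [ι_smul_base]; exact Submodule.smul_mem _ _ hx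

/-- Elements with a dual family of functionals stay linearly independent after an extension of
scalars. -/
theorem linearIndependent_ι {n : ℕ} (hX : ∀ m : M, (PowerSeries.X : R⟦X⟧) ^ n • m = 0)
    {κ : Type*} [DecidableEq κ] {b : κ → M} {c : κ → M →ₗ[R] R}
    (hb : ∀ i j, c i (b j) = if i = j then 1 else 0) :
    LinearIndependent L fun i => ι (PowerSeries.map f) (b i) := by
  rw [linearIndependent_iff']
  intro s g hg i hi
  let lam : M →ₛₗ[f] L :=
    { toFun := fun m => f (c i m), map_add' := by simp, map_smul' := by simp }
  obtain ⟨Lam, hLam⟩ := exists_functional hX lam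
  have h := congrArg Lam hg
  simp only [map_sum, map_smul, hLam, map_zero] at h
  simpa [lam, hb, hi] using h

/-- A basis of `M` over `R` gives a basis of the extension of scalars of `M` over `L`. -/
def basis {n : ℕ} (hX : ∀ m : M, (PowerSeries.X : R⟦X⟧) ^ n • m = 0) {κ : Type*}
    (b : Module.Basis κ R M) (f : R →+* L) :
    Module.Basis κ L (ScalarExt (PowerSeries.map f) M) :=
  letI := Classical.decEq κ
  Module.Basis.mk (v := fun i => ι (PowerSeries.map f) (b i))
    (linearIndependent_ι hX (c := b.coord) (by
      intro i j
      simp [Finsupp.single_apply, eq_comm]))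
    (span_range_ι_basis hX b.span_eq).ge

theorem basis_apply {n : ℕ} (hX : ∀ m : M, (PowerSeries.X : R⟦X⟧) ^ n • m = 0) {κ : Type*}
    (b : Module.Basis κ R M) (f : R →+* L) (i : κ) :
    basis hX b f i = ι (PowerSeries.map f) (b i) := by
  rw [basis, Module.Basis.mk_apply]

end ScalarExt

end Residue

/-! ### Frobenius modules of bounded height -/

section FrobeniusModel

set_option linter.unusedSectionVars false

variable {F : Type*} [Field F] [Fintype F] {R : Type*} [CommRing R] [Algebra F R]
variable {M : Type*} [AddCommGroup M] [Module R⟦X⟧ M] [Module R M] [IsScalarTower R R⟦X⟧ M]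

/-- A `σ̂`-semilinear endomorphism `φ` of an `R⟦z⟧`-module `M` such that `z` is nilpotent on `M`
and `(z - ζ) ^ d M` is contained in the span of the image of `φ`. -/
structure IsFrobeniusModel (ζ : R) (d : ℕ) (φ : M →ₛₗ[frobSeries F R] M) : Prop where
  nilpotent : ∃ n, ∀ m : M, (PowerSeries.X : R⟦X⟧) ^ n • m = 0
  height : ∀ m : M, (PowerSeries.X - PowerSeries.C ζ : R⟦X⟧) ^ d • m ∈
    Submodule.span R (Set.range φ)

theorem frobSeries_C (r : R) :
    frobSeries F R (PowerSeries.C r) = PowerSeries.C (r ^ Fintype.card F) :=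
  PowerSeries.map_C _ _

theorem frobSeries_X : frobSeries F R PowerSeries.X = PowerSeries.X :=
  PowerSeries.map_X _

theorem frob_smul_base {N : Type*} [AddCommGroup N] [Module R⟦X⟧ N] [Module R N]
    [IsScalarTower R R⟦X⟧ N] (φ : M →ₛₗ[frobSeries F R] N) (r : R) (m : M) :
    φ (r • m) = r ^ Fintype.card F • φ m := by
  rw [← PowerSeries.C_smul, map_smulₛₗ, frobSeries_C, PowerSeries.C_smul]

theorem frob_X_pow_smul (φ : M →ₛₗ[frobSeries F R] M) (k : ℕ) (m : M) :
    φ ((PowerSeries.X : R⟦X⟧) ^ k • m) = (PowerSeries.X : R⟦X⟧) ^ k • φ m := by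
  rw [map_smulₛₗ, map_pow, frobSeries_X]

theorem span_range_frob (φ : M →ₛₗ[frobSeries F R] M) {κ : Type*} {b : κ → M}
    (hb : Submodule.span R (Set.range b) = ⊤) :
    Submodule.span R (Set.range φ) = Submodule.span R (Set.range fun i => φ (b i)) := by
  apply le_antisymm
  · rw [Submodule.span_le]
    rintro _ ⟨m, rfl⟩
    have hm : m ∈ Submodule.span R (Set.range b) := hb ▸ Submodule.mem_top
    induction hm using Submodule.span_induction with
    | mem x hx =>
      obtain ⟨i, rfl⟩ := hx
      exact Submodule.subset_span ⟨i, rfl⟩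
    | zero => rw [map_zero]; exact zero_mem _
    | add x y _ _ hx hy => rw [map_add]; exact add_mem hx hy
    | smul r x _ hx => rw [frob_smul_base]; exact Submodule.smul_mem _ _ hx
  · exact Submodule.span_mono (by rintro _ ⟨i, rfl⟩; exact ⟨b i, rfl⟩)

/-- Since `σ̂(z) = z`, the operator `z` commutes with `φ`. The `R`-span of the image is therefore
already an `R⟦z⟧`-submodule. -/
theorem smul_mem_span_range_frob (φ : M →ₛₗ[frobSeries F R] M)
    {n : ℕ} (hX : ∀ m : M, (PowerSeries.X : R⟦X⟧) ^ n • m = 0) (a : R⟦X⟧) {x : M}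
    (hx : x ∈ Submodule.span R (Set.range φ)) : a • x ∈ Submodule.span R (Set.range φ) := by
  induction hx using Submodule.span_induction with
  | mem x hx =>
    obtain ⟨m, rfl⟩ := hx
    rw [PowerSeries.smul_eq_sum_of_X_pow_smul_eq_zero (hX _)]
    exact sum_mem fun k _ => Submodule.smul_mem _ _
      (Submodule.subset_span ⟨(PowerSeries.X : R⟦X⟧) ^ k • m, frob_X_pow_smul _ _ _⟩)
  | zero => rw [smul_zero]; exact zero_mem _
  | add x y _ _ hx hy => rw [smul_add]; exact add_mem hx hy
  | smul r x _ hx => rw [← PowerSeries.smul_comm_base]; exact Submodule.smul_mem _ _ hx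

/-- By induction it suffices to treat the kernel of `z - ζ`. There `z` acts as `ζ`, so `z^n = 0`
forces `ζ^n x = 0` and torsion-freeness gives `x = 0`. -/
theorem zSub_pow_smul_eq_zero [IsDomain R] [Module.IsTorsionFree R M] {ζ : R} (hζ : ζ ≠ 0)
    {n : ℕ} (hX : ∀ m : M, (PowerSeries.X : R⟦X⟧) ^ n • m = 0) {d : ℕ} {m : M}
    (h : (PowerSeries.X - PowerSeries.C ζ : R⟦X⟧) ^ d • m = 0) : m = 0 := by
  induction d with
  | zero => simpa using h
  | succ d ih =>
    apply ih
    rw [pow_succ', mul_smul] at h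
    generalize (PowerSeries.X - PowerSeries.C ζ : R⟦X⟧) ^ d • m = x at h
    rw [sub_smul, sub_eq_zero, PowerSeries.C_smul] at h
    have hk : ∀ k : ℕ, (PowerSeries.X : R⟦X⟧) ^ k • x = ζ ^ k • x := by
      intro k
      induction k with
      | zero => simp
      | succ k ih =>
        rw [pow_succ, mul_smul, h, ← PowerSeries.smul_comm_base, ih, smul_smul, ← pow_succ']
    have := hk n
    rw [hX] at this
    exact (smul_eq_zero.1 this.symm).resolve_left (pow_ne_zero _ hζ)

namespace IsFrobeniusModel

variable {ζ : R} {d : ℕ} {φ : M →ₛₗ[frobSeries F R] M}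

/-- Multiplication by `(z - ζ)^d` embeds `M` into the span of the `φ(b i)`, which therefore has full
rank. The map `b i ↦ φ(b i)` then has a kernel of rank zero in a free module, hence no kernel. This
is the injectivity of `σ̂^* M → M`. -/
theorem linearIndependent [IsDomain R] [IsPrincipalIdealRing R] [Module.Finite R M]
    (h : IsFrobeniusModel ζ d φ) (hζ : ζ ≠ 0) {κ : Type*} (b : Module.Basis κ R M) :
    LinearIndependent R fun i => φ (b i) := by
  have : Module.Free R M := Module.Free.of_basis b
  obtain ⟨n, hn⟩ := h.nilpotent
  let g : M →ₗ[R] M := b.constr R fun i => φ (b i)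
  let z : M →ₗ[R] M := (LinearMap.lsmul R⟦X⟧ M
    ((PowerSeries.X - PowerSeries.C ζ : R⟦X⟧) ^ d)).restrictScalars R
  have hz : Function.Injective z := (injective_iff_map_eq_zero _).2 fun m hm =>
    zSub_pow_smul_eq_zero hζ hn hm
  have hle : LinearMap.range z ≤ LinearMap.range g := by
    rintro _ ⟨m, rfl⟩
    rw [Module.Basis.constr_range, ← span_range_frob φ b.span_eq]
    exact h.height m
  have h1 := Submodule.finrank_mono hle
  rw [LinearMap.finrank_range_of_inj hz] at h1
  have h2 := Submodule.finrank_quotient_add_finrank (LinearMap.ker g)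
  rw [LinearEquiv.finrank_eq g.quotKerEquivRange] at h2
  have h3 : LinearMap.ker g = ⊥ := Submodule.finrank_eq_zero.1 (by omega)
  have h4 := b.linearIndependent.map' g h3
  have h5 : g ∘ b = fun i => φ (b i) := by
    ext i
    simp [g]
  rwa [h5] at h4

end IsFrobeniusModel

end FrobeniusModel

/-! ### Torsion local shtukas of bounded height as Frobenius modules -/

namespace TorsionLocalShtuka

section Models

variable {F : Type*} [Field F] [Fintype F] {R : Type u} [CommRing R] [Algebra F R] {ζ : R}

/-- `τ` is induced by the endomorphism `φ` of `M`. -/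
def IsFrobenius (N : TorsionLocalShtuka F ζ) (φ : N.M →ₛₗ[frobSeries F R] N.M) : Prop :=
  ∀ m, N.τ (LocalizedModule.mk (ScalarExt.ι (frobSeries F R) m) 1) = LocalizedModule.mk (φ m) 1

/-- A common exponent for finitely many generators `x` works for all of `M`, and then the finitely
many `z^k x` with `k` below it generate over `R`. -/
theorem finite_and_nilpotent {M : Type*} [AddCommGroup M] [Module R⟦X⟧ M] [Module R M]
    [IsScalarTower R R⟦X⟧ M] [Module.Finite R⟦X⟧ M]
    (ht : ∀ m : M, ∃ n : ℕ, (PowerSeries.X : R⟦X⟧) ^ n • m = 0) :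
    Module.Finite R M ∧ ∃ n, ∀ m : M, (PowerSeries.X : R⟦X⟧) ^ n • m = 0 := by
  obtain ⟨s, hs⟩ := Module.Finite.fg_top (R := R⟦X⟧) (M := M)
  choose e he using ht
  have hn : ∀ m : M, (PowerSeries.X : R⟦X⟧) ^ (s.sup e) • m = 0 := by
    intro m
    have hm : m ∈ Submodule.span R⟦X⟧ (s : Set M) := hs ▸ Submodule.mem_top
    induction hm using Submodule.span_induction with
    | mem x hx =>
      obtain ⟨k, hk⟩ := Nat.exists_eq_add_of_le' (Finset.le_sup (f := e) hx)
      rw [hk, pow_add, mul_smul, he, smul_zero]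
    | zero => rw [smul_zero]
    | add x y _ _ hx hy => rw [smul_add, hx, hy, add_zero]
    | smul a x _ hx => rw [smul_comm, hx, smul_zero]
  refine ⟨⟨?_⟩, _, hn⟩
  classical
  refine ⟨s.biUnion fun x => (Finset.range (s.sup e)).image fun k =>
    (PowerSeries.X : R⟦X⟧) ^ k • x, ?_⟩
  rw [eq_top_iff]
  rintro m -
  have hm : m ∈ Submodule.span R⟦X⟧ (s : Set M) := hs ▸ Submodule.mem_top
  obtain ⟨f, -, rfl⟩ := Submodule.mem_span_finset.1 hm
  refine sum_mem fun x hx => ?_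
  rw [PowerSeries.smul_eq_sum_of_X_pow_smul_eq_zero (hn x)]
  refine sum_mem fun k hk => Submodule.smul_mem _ _ (Submodule.subset_span ?_)
  exact Finset.mem_biUnion.2 ⟨x, hx, Finset.mem_image.2 ⟨k, hk, rfl⟩⟩

/-- The kernel of the localization map consists of elements killed by a power of `z - ζ`, and these
vanish. -/
theorem lattice_injective {M : Type*} [AddCommGroup M] [Module R⟦X⟧ M] [Module R M]
    [IsScalarTower R R⟦X⟧ M] [IsDomain R] [Module.IsTorsionFree R M] (hζ : ζ ≠ 0) {n : ℕ}
    (hX : ∀ m : M, (PowerSeries.X : R⟦X⟧) ^ n • m = 0) {m m' : M}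
    (h : (LocalizedModule.mk m 1 : LocalizedModule (zSubPowers ζ) M) = LocalizedModule.mk m' 1) :
    m = m' := by
  obtain ⟨⟨_, k, rfl⟩, hu⟩ := LocalizedModule.mk_eq.1 h
  rw [one_smul, one_smul] at hu
  rw [← sub_eq_zero]
  refine zSub_pow_smul_eq_zero (d := k) hζ hX ?_
  rw [smul_sub, sub_eq_zero]
  exact hu

/-- The Frobenius of a torsion local shtuka of height `≤ d`. -/
theorem HeightLE.exists_isFrobenius [IsDomain R] [NeZero ζ] {N : TorsionLocalShtuka F ζ} {d : ℕ}
    (h : N.HeightLE d) : Module.Finite R N.M ∧ Module.Free R N.M ∧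
      ∃ φ : N.M →ₛₗ[frobSeries F R] N.M, N.IsFrobenius φ ∧ IsFrobeniusModel ζ d φ := by
  have := N.finitePresentation
  have := N.free
  obtain ⟨hfin, n, hn⟩ := finite_and_nilpotent N.torsion
  refine ⟨hfin, N.free, ?_⟩
  have hex : ∀ x, ∃ m' : N.M, LocalizedModule.mk m' 1 = N.τ (LocalizedModule.mk x 1) := by
    intro x
    obtain ⟨m', hm'⟩ := h.2 (Submodule.mem_map_of_mem (f := N.τ.toLinearMap)
      (LinearMap.mem_range_self (LocalizedModule.mkLinearMap (zSubPowers ζ)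
        (ScalarExt (frobSeries F R) N.M)) x))
    exact ⟨m', hm'⟩
  choose Φ hΦ using hex
  -- Effectivity supplied a lift `Φ x` of `τ(x)` to `M`. Lifts are unique, so `Φ` inherits the
  -- linearity of `τ`.
  have hinj : ∀ {m m' : N.M}, (LocalizedModule.mk m 1 : LocalizedModule (zSubPowers ζ) N.M) =
      LocalizedModule.mk m' 1 → m = m' := lattice_injective (NeZero.ne ζ) hn
  have hadd : ∀ x y, Φ (x + y) = Φ x + Φ y := by
    intro x y
    apply hinj
    have e : (LocalizedModule.mk (x + y) 1 :
        LocalizedModule (zSubPowers ζ) (ScalarExt (frobSeries F R) N.M)) =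
        LocalizedModule.mk x 1 + LocalizedModule.mk y 1 := by
      rw [LocalizedModule.mk_add_mk, one_smul, one_smul, one_mul]
    rw [hΦ, e, map_add, ← hΦ, ← hΦ, LocalizedModule.mk_add_mk, one_smul, one_smul, one_mul]
  have hsmul : ∀ (a : R⟦X⟧) x, Φ (a • x) = a • Φ x := by
    intro a x
    apply hinj
    rw [hΦ, ← LocalizedModule.smul'_mk, map_smul, ← hΦ, LocalizedModule.smul'_mk]
  let φ : N.M →ₛₗ[frobSeries F R] N.M :=
    { toFun := fun m => Φ (ScalarExt.ι _ m)
      map_add' := fun x y => by rw [map_add, hadd]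
      map_smul' := fun a x => by rw [map_smulₛₗ, hsmul] }
  refine ⟨φ, fun m => (hΦ _).symm, ⟨n, hn⟩, fun m => ?_⟩
  have hΦφ : ∀ x, Φ x ∈ Submodule.span R (Set.range φ) := by
    intro x
    induction x using ScalarExt.induction with
    | h0 =>
      have h0 := hadd 0 0
      rw [add_zero, left_eq_add] at h0
      rw [h0]
      exact zero_mem _
    | hι b m =>
      rw [hsmul]
      exact smul_mem_span_range_frob φ hn b (Submodule.subset_span ⟨m, rfl⟩)
    | hadd x y hx hy =>
      rw [hadd]
      exact add_mem hx hy
  -- The height bound writes `(z - ζ)^d m` as `Φ x` for some `x` in `σ̂^* M`, and `Φ x` lies in the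
  -- span of `φ`.
  obtain ⟨_, ⟨x, rfl⟩, hx⟩ := h.1 (LocalizedModule.mk m 1) ⟨m, rfl⟩
  have hx' : N.τ (LocalizedModule.mk x 1) = _ := hx
  rw [← hΦ, LocalizedModule.smul'_mk] at hx'
  rw [← hinj hx']
  exact hΦφ x

end Models

section Construction

variable {F : Type*} [Field F] [Fintype F] {R : Type u} [CommRing R] [Algebra F R] {ζ : R}
variable {M : Type u} [AddCommGroup M] [Module R⟦X⟧ M] [Module R M] [IsScalarTower R R⟦X⟧ M]

/-- Every Frobenius module of height `≤ d` underlies a torsion local shtuka. -/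
theorem exists_of_isFrobeniusModel [IsDomain R] [IsPrincipalIdealRing R] [Module.Finite R M]
    [Module.Free R M] [NeZero ζ] {d : ℕ} {φ : M →ₛₗ[frobSeries F R] M}
    (h : IsFrobeniusModel ζ d φ) :
    ∃ (N : TorsionLocalShtuka F ζ) (e : N.M ≃ₗ[R⟦X⟧] M) (ψ : N.M →ₛₗ[frobSeries F R] N.M),
      N.IsEffective ∧ N.HeightLE d ∧ N.IsFrobenius ψ ∧ ∀ m, e (ψ m) = φ (e m) := by
  obtain ⟨n, hn⟩ := h.nilpotent
  let S := zSubPowers ζ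
  let Φ : ScalarExt (frobSeries F R) M →ₗ[R⟦X⟧] M :=
    ScalarExt.lift (RingHom.id _) φ.toAddMonoidHom (fun a m => φ.map_smulₛₗ a m)
  have hΦ : ∀ m, Φ (ScalarExt.ι _ m) = φ m := fun m => ScalarExt.lift_ι _ _ _ m
  have hΦr : ∀ (r : R) (x : ScalarExt (frobSeries F R) M), Φ (r • x) = r • Φ x := fun r x => by
    rw [← PowerSeries.C_smul, map_smul, PowerSeries.C_smul]
  let b := Module.Free.chooseBasis R M
  have hinj : Function.Injective Φ := by
    -- The elements `1 ⊗ b i` form an `R`-basis of `σ̂^* M`, and `Φ` sends them to the independent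
    -- family `φ(b i)`.
    let β : Module.Basis _ R (ScalarExt (frobSeries F R) M) :=
      ScalarExt.basis hn b (FiniteField.frobeniusAlgHom F R : R →+* R)
    have hβ : ∀ i, Φ (β i) = φ (b i) := fun i => by
      rw [← hΦ]
      exact congrArg Φ (ScalarExt.basis_apply hn b _ i)
    let Φ' : ScalarExt (frobSeries F R) M →ₗ[R] M :=
      { toFun := Φ, map_add' := Φ.map_add, map_smul' := hΦr }
    have hli : LinearIndependent R (Φ' ∘ β) := by
      have : Φ' ∘ β = fun i => φ (b i) := funext hβ
      rw [this]
      exact h.linearIndependent (NeZero.ne ζ) b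
    have hk : LinearMap.ker Φ' = ⊥ := by
      rw [LinearMap.ker_eq_bot']
      intro x hx
      rw [← β.sum_repr x, map_sum] at hx
      simp only [map_smul] at hx
      have := Fintype.linearIndependent_iff.1 hli _ hx
      rw [← β.sum_repr x]
      simp [this]
    exact fun x y hxy => LinearMap.ker_eq_bot.1 hk hxy
  let f := LocalizedModule.mkLinearMap S (ScalarExt (frobSeries F R) M)
  let g := LocalizedModule.mkLinearMap S M
  let t := IsLocalizedModule.map S f g Φ
  have ht : ∀ x, t (LocalizedModule.mk x 1) = LocalizedModule.mk (Φ x) 1 := fun x =>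
    IsLocalizedModule.map_apply S f g Φ x
  have htk : ∀ x s, t (LocalizedModule.mk x s) = LocalizedModule.mk (Φ x) s := fun x s => by
    have := IsLocalizedModule.map_mk' S f g Φ x s
    rwa [← IsLocalizedModule.mk_eq_mk', ← IsLocalizedModule.mk_eq_mk'] at this
  have hspan : ∀ m : M, ∃ x, Φ x = (PowerSeries.X - PowerSeries.C ζ : R⟦X⟧) ^ d • m := by
    intro m
    have hm := h.height m
    generalize (PowerSeries.X - PowerSeries.C ζ : R⟦X⟧) ^ d • m = y at hm
    induction hm using Submodule.span_induction with
    | mem x hx =>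
      obtain ⟨m, rfl⟩ := hx
      exact ⟨_, hΦ m⟩
    | zero => exact ⟨0, map_zero _⟩
    | add x y _ _ hx hy =>
      obtain ⟨x', rfl⟩ := hx
      obtain ⟨y', rfl⟩ := hy
      exact ⟨x' + y', map_add _ _ _⟩
    | smul r x _ hx =>
      obtain ⟨x', rfl⟩ := hx
      exact ⟨r • x', hΦr _ _⟩
  have hbij : Function.Bijective t := by
    refine ⟨IsLocalizedModule.map_injective S f g Φ hinj, fun y => ?_⟩
    induction y using LocalizedModule.induction_on with
    | h m s =>
      obtain ⟨x, hx⟩ := hspan m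
      -- If `Φ x = (z - ζ)^d m`, then `m / s` is the image of `x / ((z - ζ)^d s)`.
      let u : S := ⟨(PowerSeries.X - PowerSeries.C ζ : R⟦X⟧) ^ d, d, rfl⟩
      refine ⟨LocalizedModule.mk x (u * s), ?_⟩
      rw [htk, hx]
      exact LocalizedModule.mk_cancel_common_left u s m
  let N : TorsionLocalShtuka F ζ :=
    { M := M
      finitePresentation :=
        have := Module.Finite.of_restrictScalars_finite R R⟦X⟧ M
        Module.finitePresentation_of_finite _ _
      free := inferInstance
      torsion := fun m => ⟨n, hn m⟩
      τ := LinearEquiv.ofBijective t hbij }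
  have heff : N.frobLattice ≤ N.lattice := by
    rintro _ ⟨_, ⟨x, rfl⟩, rfl⟩
    exact ⟨Φ x, (ht x).symm⟩
  refine ⟨N, LinearEquiv.refl _ _, φ, heff, ⟨?_, heff⟩, fun m => ?_, fun _ => rfl⟩
  · rintro _ ⟨m, rfl⟩
    obtain ⟨x, hx⟩ := hspan m
    refine ⟨_, ⟨x, rfl⟩, ?_⟩
    refine (ht x).trans ?_
    rw [hx, ← LocalizedModule.smul'_mk]
    rfl
  · exact (ht _).trans (by rw [hΦ])

end Construction

end TorsionLocalShtuka

/-! ### Semilinear endomorphisms over separably closed fields -/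

section Lang

/-- The endomorphism `c ↦ c ^ #F` of an `F`-algebra. -/
abbrev frobCoeff (F L : Type*) [Field F] [Fintype F] [CommRing L] [Algebra F L] : L →+* L :=
  (FiniteField.frobeniusAlgHom F L : L →+* L)

variable {F : Type*} [Field F] [Fintype F] {L : Type*} [Field L] [Algebra F L]
variable {E : Type*} [AddCommGroup E] [Module L E]

theorem map_frobCoeff_smul (φ : E →ₛₗ[frobCoeff F L] E) (c : L) (x : E) :
    φ (c • x) = c ^ Fintype.card F • φ x := φ.map_smulₛₗ c x

/-- The span of the image of `φ` can be computed on generators, since scalars pass through `φ` as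
`q`-th powers. -/
theorem span_range_semilinear_comp (φ : E →ₛₗ[frobCoeff F L] E) {s : Set E}
    (hs : Submodule.span L s = ⊤) :
    Submodule.span L (φ '' s) = Submodule.span L (Set.range φ) := by
  apply le_antisymm (Submodule.span_mono (Set.image_subset_range _ _))
  rw [Submodule.span_le]
  rintro _ ⟨m, rfl⟩
  have hm : m ∈ Submodule.span L s := hs ▸ Submodule.mem_top
  induction hm using Submodule.span_induction with
  | mem x hx => exact Submodule.subset_span ⟨x, hx, rfl⟩
  | zero => rw [map_zero]; exact zero_mem _
  | add x y _ _ hx hy => rw [map_add]; exact add_mem hx hy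
  | smul r x _ hx => rw [map_frobCoeff_smul]; exact Submodule.smul_mem _ _ hx

/-- An étale semilinear endomorphism preserves linear independence. -/
theorem LinearIndependent.map_semilinear [FiniteDimensional L E] {φ : E →ₛₗ[frobCoeff F L] E}
    (hφ : Submodule.span L (Set.range φ) = ⊤) {κ : Type*} {v : κ → E}
    (hv : LinearIndependent L v) : LinearIndependent L fun i => φ (v i) := by
  let b := Module.Basis.extend hv.linearIndepOn_id
  have hb : Submodule.span L (Set.range fun i => φ (b i)) = ⊤ := by
    rw [← hφ, ← span_range_semilinear_comp φ b.span_eq, ← Set.range_comp]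
    rfl
  have : Finite (hv.linearIndepOn_id.extend (Set.subset_univ (Set.range v))) :=
    Module.Finite.finite_basis b
  let _ := Fintype.ofFinite (hv.linearIndepOn_id.extend (Set.subset_univ (Set.range v)))
  have hli : LinearIndependent L fun i => φ (b i) :=
    linearIndependent_of_top_le_span_of_card_eq_finrank hb.ge
      (Module.finrank_eq_card_basis b).symm
  let j : κ → hv.linearIndepOn_id.extend (Set.subset_univ (Set.range v)) := fun i =>
    ⟨v i, hv.linearIndepOn_id.subset_extend _ ⟨i, rfl⟩⟩
  have hj : Function.Injective j := fun x y hxy => hv.injective (congrArg Subtype.val hxy)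
  have h := hli.comp j hj
  have e : ((fun i => φ (b i)) ∘ j) = fun i => φ (v i) := by
    ext i
    simp [b, j]
  rwa [e] at h

open Polynomial in
/-- The solutions of `b₀ = c₀ b_s ^ q`, `b_{i+1} = b_i ^ q + c_{i+1} b_s ^ q`. -/
theorem exists_cyclic_solution (F : Type*) [Field F] [Fintype F] [Algebra F L] [IsSepClosed L]
    (c : ℕ → L) (hc : c 0 ≠ 0) (s : ℕ) :
    ∃ b : ℕ → L, b s ≠ 0 ∧ b 0 = c 0 * b s ^ Fintype.card F ∧
      ∀ i, b (i + 1) = b i ^ Fintype.card F + c (i + 1) * b s ^ Fintype.card F := by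
  set q := Fintype.card F with hqdef
  have hq : 2 ≤ q := Fintype.one_lt_card
  have hq0 : (q : L) = 0 := cast_card_eq_zero_of_algebra F
  -- `B i` expresses `b i` as a polynomial in the unknown `X = b s`. The system is then solved by a
  -- nonzero root of `B s - X`.
  let B : ℕ → L[X] := fun i =>
    Nat.rec (C (c 0) * X ^ q) (fun i p => p ^ q + C (c (i + 1)) * X ^ q) i
  have hB0 : B 0 = C (c 0) * X ^ q := rfl
  have hBs : ∀ i, B (i + 1) = B i ^ q + C (c (i + 1)) * X ^ q := fun i => rfl
  have hdeg : ∀ i, (B i).natDegree = q ^ (i + 1) := by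
    intro i
    induction i with
    | zero => rw [hB0, natDegree_C_mul_X_pow _ _ hc, zero_add, pow_one]
    | succ i ih =>
      rw [hBs, natDegree_add_eq_left_of_natDegree_lt, natDegree_pow, ih, ← pow_succ']
      rw [natDegree_pow, ih]
      refine lt_of_le_of_lt (natDegree_C_mul_X_pow_le _ _) ?_
      rw [← pow_succ']
      exact lt_self_pow₀ hq (by omega)
  have hder : ∀ i, derivative (B i) = 0 := by
    intro i
    cases i with
    | zero => simp [hB0, derivative_X_pow, hq0]
    | succ i => simp [hBs, derivative_pow, hq0]
  have heval : ∀ i, (B i).coeff 0 = 0 := by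
    intro i
    induction i with
    | zero => simp [hB0, show 0 ≠ q by omega]
    | succ i ih => simp [hBs, coeff_zero_eq_eval_zero] at ih ⊢; simp [ih, show q ≠ 0 by omega]
  obtain ⟨p, hp⟩ : X ∣ B s - X := by
    rw [X_dvd_iff]
    simp [heval]
  -- All exponents come from `q`-th powers and `q = 0` in `L`, so `B s` has derivative zero and `B s
  -- - X` is separable.
  have hd1 : derivative (B s - X) = -1 := by simp [hder]
  have hsep : (B s - X).Separable := by
    rw [Polynomial.Separable, hd1]
    exact isCoprime_one_right.neg_right
  have hnd : (B s - X).natDegree = q ^ (s + 1) := by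
    rw [sub_eq_add_neg, natDegree_add_eq_left_of_natDegree_lt, hdeg]
    rw [hdeg, natDegree_neg, natDegree_X]
    exact Nat.one_lt_pow (by omega) hq
  have h2 : 1 < q ^ (s + 1) := Nat.one_lt_pow (by omega) hq
  have hpdeg : p.degree ≠ 0 := by
    intro h
    have h' := natDegree_eq_of_degree_eq_some h
    have : (X * p).natDegree ≤ 1 := by
      refine natDegree_mul_le.trans ?_
      rw [natDegree_X, h']
      exact le_rfl
    rw [← hp, hnd] at this
    omega
  rw [hp] at hsep
  obtain ⟨x, hx⟩ := IsSepClosed.exists_root p hpdeg hsep.of_mul_right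
  -- The derivative of `B s - X = X * p` at zero is `p(0)`, which equals `-1`; so zero is not a root
  -- of `p`.
  have hx0 : x ≠ 0 := by
    rintro rfl
    have h := congrArg (eval 0) hd1
    rw [hp, derivative_mul] at h
    simp [hx.eq_zero] at h
  have hxB : (B s).eval x = x := by
    have h := congrArg (eval x) hp
    simp only [eval_sub, eval_X, eval_mul, hx.eq_zero, mul_zero] at h
    exact sub_eq_zero.1 h
  refine ⟨fun i => (B i).eval x, ?_, ?_, fun i => ?_⟩
  · simpa only [hxB] using hx0
  · simp only [hxB]
    simp [hB0]
  · simp only [hxB]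
    simp [hBs]

/-- The iterates `u i` of `φ` on a nonzero vector satisfy a first relation `u (s + 1) = ∑ c i • u i`
with `u 0, …, u s` independent. A vector `∑ b i • u i` is fixed once its coefficients solve the
cyclic system of `exists_cyclic_solution`, which has a nonzero solution because `c 0 ≠ 0`. -/
theorem exists_fixed_ne_zero [IsSepClosed L] [FiniteDimensional L E] [Nontrivial E]
    {φ : E →ₛₗ[frobCoeff F L] E} (hφ : Submodule.span L (Set.range φ) = ⊤) :
    ∃ w, w ≠ 0 ∧ φ w = w := by
  classical
  obtain ⟨v, hv⟩ := exists_ne (0 : E)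
  let u : ℕ → E := fun i => φ^[i] v
  have hu0 : u 0 = v := rfl
  have hus : ∀ i, u (i + 1) = φ (u i) := fun i => Function.iterate_succ_apply' _ _ _
  have hex : ∃ r, ¬ LinearIndependent L fun i : Fin (r + 1) => u i := by
    refine ⟨Module.finrank L E, fun h => ?_⟩
    have := h.fintype_card_le_finrank
    simp at this
  obtain ⟨r, hr, hmin⟩ : ∃ r, (¬ LinearIndependent L fun i : Fin (r + 1) => u i) ∧
      ∀ k < r, LinearIndependent L fun i : Fin (k + 1) => u i :=
    ⟨Nat.find hex, Nat.find_spec hex, fun k hk => not_not.1 (Nat.find_min hex hk)⟩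
  -- The case `r = 0` is excluded because a single nonzero vector is independent.
  obtain _ | s := r
  · refine absurd ?_ hr
    let _ : Unique (Fin (0 + 1)) := inferInstanceAs (Unique (Fin 1))
    exact linearIndependent_unique_iff.2 hv
  have hli := hmin s (Nat.lt_succ_self s)
  have hmem : u (s + 1) ∈ Submodule.span L (Set.range fun i : Fin (s + 1) => u i) := by
    by_contra hcon
    refine hr ?_
    have := linearIndependent_finSnoc.2 ⟨hli, hcon⟩
    convert this using 1
    ext i
    refine Fin.lastCases ?_ (fun j => ?_) i
    · simp
    · simp
  obtain ⟨c', hc'⟩ := (Submodule.mem_span_range_iff_exists_fun L).1 hmem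
  let c : ℕ → L := fun i => if h : i < s + 1 then c' ⟨i, h⟩ else 0
  have hc : ∑ i ∈ Finset.range (s + 1), c i • u i = u (s + 1) := by
    rw [Finset.sum_range, ← hc']
    refine Finset.sum_congr rfl fun i _ => ?_
    rw [show c i = c' i from dif_pos i.2]
  -- If `c 0 = 0`, the relation only involves `u 1, …, u (s + 1)`, that is, the images of `u 0, …, u
  -- s`; but an étale `φ` keeps those independent.
  have hc0 : c 0 ≠ 0 := by
    intro h0
    have hli' := hli.map_semilinear hφ
    rw [Finset.sum_range_succ', h0, zero_smul, add_zero] at hc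
    rw [Fintype.linearIndependent_iff] at hli'
    have := hli' (fun i => if (i : ℕ) = s then 1 else -c (i + 1)) (by
      rw [← Finset.sum_range (fun i => (if i = s then (1 : L) else -c (i + 1)) • φ (u i)),
        Finset.sum_range_succ, if_pos rfl, one_smul, ← hus, ← hc, ← Finset.sum_add_distrib]
      refine Finset.sum_eq_zero fun i hi => ?_
      rw [if_neg (Finset.mem_range.1 hi).ne, neg_smul, hus, neg_add_cancel]) (Fin.last s)
    simp at this
  obtain ⟨b, hbs, hb0, hb⟩ := exists_cyclic_solution F c hc0 s
  refine ⟨∑ i ∈ Finset.range (s + 1), b i • u i, fun h => hbs ?_, ?_⟩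
  · rw [Finset.sum_range] at h
    exact Fintype.linearIndependent_iff.1 hli (fun i => b i) h (Fin.last s)
  · rw [map_sum]
    simp only [map_frobCoeff_smul, ← hus]
    rw [Finset.sum_range_succ, ← hc, Finset.smul_sum, Finset.sum_range_succ' _ s,
      Finset.sum_range_succ' _ s, ← add_assoc, ← Finset.sum_add_distrib]
    congr 1
    · refine Finset.sum_congr rfl fun i _ => ?_
      rw [hb, add_smul, smul_smul, mul_comm (c (i + 1))]
    · rw [smul_smul, hb0, mul_comm]

/-- Lang's theorem: an étale semilinear endomorphism of a finite-dimensional space over a separably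
closed field has a basis of fixed vectors. -/
theorem span_fixed_eq_top [IsSepClosed L] [FiniteDimensional L E]
    {φ : E →ₛₗ[frobCoeff F L] E} (hφ : Submodule.span L (Set.range φ) = ⊤) :
    Submodule.span L {x | φ x = x} = ⊤ := by
  set W := Submodule.span L {x | φ x = x} with hW
  by_contra hne
  have hst : W ≤ W.comap φ := by
    rw [hW, Submodule.span_le]
    intro x hx
    change φ x ∈ Submodule.span L {x | φ x = x}
    rw [show φ x = x from hx]
    exact Submodule.subset_span hx
  let ψ : (E ⧸ W) →ₛₗ[frobCoeff F L] (E ⧸ W) := W.mapQ W φ hst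
  have hψ : ∀ x, ψ (W.mkQ x) = W.mkQ (φ x) := fun x => rfl
  -- If the fixed vectors did not span, the étale endomorphism induced on `E ⧸ W` would have a
  -- nonzero fixed vector. The aim is to lift it to a fixed vector of `E`.
  have : Nontrivial (E ⧸ W) := Submodule.Quotient.nontrivial_iff.2 hne
  have hspan : Submodule.span L (Set.range ψ) = ⊤ := by
    have h := congrArg (Submodule.map W.mkQ) hφ
    rw [Submodule.map_span, Submodule.map_top, Submodule.range_mkQ] at h
    rw [eq_top_iff, ← h]
    refine Submodule.span_mono ?_
    rintro _ ⟨_, ⟨x, rfl⟩, rfl⟩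
    exact ⟨W.mkQ x, hψ x⟩
  obtain ⟨w, hw0, hw⟩ := exists_fixed_ne_zero hspan
  obtain ⟨v, rfl⟩ := W.mkQ_surjective w
  rw [hψ, ← sub_eq_zero, ← map_sub, Submodule.mkQ_apply, Submodule.Quotient.mk_eq_zero] at hw
  -- `φ - 1` maps `W` onto `W`: on a multiple `r • x` of a fixed vector this is the Artin–Schreier
  -- equation `a^q - a = r`, solvable over a separably closed field.
  have hAS : ∀ y ∈ W, ∃ x : E, x ∈ W ∧ φ x - x = y := by
    intro y hy
    refine Submodule.closure_induction (p := fun y _ => ∃ x : E, x ∈ W ∧ φ x - x = y)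
      ⟨0, zero_mem _, by simp⟩ ?_ ?_ hy
    · rintro _ _ _ _ ⟨x, hx, rfl⟩ ⟨y, hy, rfl⟩
      exact ⟨x + y, add_mem hx hy, by rw [map_add]; abel⟩
    · intro r x hx
      obtain ⟨a, ha⟩ := IsSepClosed.exists_root_C_mul_X_pow_add_C_mul_X_add_C 1 (-1) (-r)
        (cast_card_eq_zero_of_algebra F : (Fintype.card F : L) = 0) Fintype.one_lt_card (by simp)
      refine ⟨a • x, Submodule.smul_mem _ _ (Submodule.subset_span hx), ?_⟩
      rw [map_frobCoeff_smul, show φ x = x from hx, ← sub_smul]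
      congr 1
      linear_combination ha
  -- Subtracting `x` makes the lift `v` fixed, so `v - x` and hence `v` lie in `W`, contrary to `w ≠
  -- 0`.
  obtain ⟨x, hx, hxv⟩ := hAS _ hw
  refine hw0 ?_
  rw [Submodule.mkQ_apply, Submodule.Quotient.mk_eq_zero, ← sub_add_cancel v x]
  refine add_mem (Submodule.subset_span ?_) hx
  change φ (v - x) = v - x
  rw [map_sub]
  rw [sub_eq_sub_iff_sub_eq_sub]
  exact hxv.symm

/-- In a basis of fixed vectors `φ` raises coordinates to the power `q`, so the coordinates of a
fixed vector are roots of `X^q - X` and lie in `F`. -/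
theorem exists_fixed_coeff {κ : Type*} [Fintype κ] {φ : E →ₛₗ[frobCoeff F L] E} {b : κ → E}
    (hb : LinearIndependent L b) (hφ : ∀ i, φ (b i) = b i) {x : E} (hx : φ x = x)
    (hmem : x ∈ Submodule.span L (Set.range b)) :
    ∃ a : κ → F, x = ∑ i, algebraMap F L (a i) • b i := by
  obtain ⟨c, rfl⟩ := (Submodule.mem_span_range_iff_exists_fun L).1 hmem
  have hc : ∀ i, c i ^ Fintype.card F = c i := by
    rw [map_sum] at hx
    simp only [map_frobCoeff_smul, hφ] at hx
    rw [← sub_eq_zero, ← Finset.sum_sub_distrib] at hx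
    simp only [← sub_smul] at hx
    exact fun i => sub_eq_zero.1 (Fintype.linearIndependent_iff.1 hb _ hx i)
  choose a ha using fun i => exists_algebraMap_eq_of_pow_card (hc i)
  exact ⟨a, by simp only [ha]⟩

theorem card_fixed {κ : Type*} [Fintype κ] {φ : E →ₛₗ[frobCoeff F L] E} {b : κ → E}
    (hb : LinearIndependent L b) (hφ : ∀ i, φ (b i) = b i) {T : Set E}
    (hT : ∀ x, x ∈ T ↔ φ x = x ∧ x ∈ Submodule.span L (Set.range b)) :
    Nat.card T = Fintype.card F ^ Fintype.card κ := by
  have hmem : ∀ a : κ → F, ∑ i, algebraMap F L (a i) • b i ∈ T := by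
    intro a
    rw [hT]
    refine ⟨?_, sum_mem fun i _ => Submodule.smul_mem _ _ (Submodule.subset_span ⟨i, rfl⟩)⟩
    rw [map_sum]
    simp only [map_frobCoeff_smul, hφ, ← map_pow, FiniteField.pow_card]
  let e : (κ → F) → T := fun a => ⟨_, hmem a⟩
  have he : Function.Bijective e := by
    refine ⟨fun a a' h => funext fun i => ?_, fun x => ?_⟩
    · have h' := congrArg Subtype.val h
      exact (algebraMap F L).injective
        (Fintype.linearIndependent_iffₛ.1 hb (fun i => algebraMap F L (a i))
          (fun i => algebraMap F L (a' i)) h' i)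
    · obtain ⟨h1, h2⟩ := (hT x).1 x.2
      obtain ⟨a, ha⟩ := exists_fixed_coeff hb hφ h1 h2
      exact ⟨a, Subtype.ext ha.symm⟩
  rw [← Nat.card_eq_of_bijective e he, Nat.card_fun, Nat.card_eq_fintype_card,
    Nat.card_eq_fintype_card]

end Lang

/-! ### The fibre and the size of the Tate module -/

namespace TorsionLocalShtuka

section FiberBasis

set_option linter.unusedSectionVars false

variable {F : Type*} [Field F] [Fintype F] {R : Type u} [CommRing R] [Algebra F R] {ζ : R}
variable (N : TorsionLocalShtuka F ζ) (K : Type*) [Field K] [Algebra R K]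
variable (L : Type*) [Field L] [Algebra K L] [Algebra R L] [IsScalarTower R K L]

instance Fiber.moduleCoeff : Module L (N.Fiber L) := ScalarExt.moduleCoeff _

instance Fiber.isScalarTower : IsScalarTower L L⟦X⟧ (N.Fiber L) := ScalarExt.isScalarTower_coeff _

theorem toFiber_smul_base (r : R) (m : N.M) :
    N.toFiber L (r • m) = algebraMap R L r • N.toFiber L m :=
  ScalarExt.ι_smul_base r m

variable {N} {n : ℕ} (hX : ∀ m : N.M, (PowerSeries.X : R⟦X⟧) ^ n • m = 0)
include hX

theorem X_pow_smul_fiber (x : N.Fiber L) : (PowerSeries.X : L⟦X⟧) ^ n • x = 0 :=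
  ScalarExt.X_pow_smul_eq_zero hX x

theorem span_range_toFiber : Submodule.span L (Set.range (N.toFiber L)) = ⊤ :=
  ScalarExt.span_range_ι hX

/-- The basis of the fibre induced by a basis of `M`. -/
def fiberBasis {κ : Type*} (b : Module.Basis κ R N.M) : Module.Basis κ L (N.Fiber L) :=
  ScalarExt.basis hX b (algebraMap R L)

theorem fiberBasis_apply {κ : Type*} (b : Module.Basis κ R N.M) (i : κ) :
    fiberBasis L hX b i = N.toFiber L (b i) :=
  ScalarExt.basis_apply hX b _ i

end FiberBasis

section TateModule

set_option linter.unusedSectionVars false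

variable {F : Type*} [Field F] [Fintype F] {R : Type u} [CommRing R] [Algebra F R] {ζ : R}
variable (N : TorsionLocalShtuka F ζ) (K : Type*) [Field K] [Algebra R K]
variable (L : Type*) [Field L] [Algebra K L] [Algebra R L] [IsScalarTower R K L]
variable [FaithfulSMul R K] [NeZero ζ] [Algebra F L]

/-- The endomorphism `x ↦ τ(σ̂^* x)` of the fibre as an `L`-semilinear map. -/
def phiCoeff : N.Fiber L →ₛₗ[frobCoeff F L] N.Fiber L where
  toFun := N.phi K L
  map_add' := map_add _
  map_smul' c x := frob_smul_base (N.phi K L) c x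

theorem mem_tate {x : N.Fiber L} : x ∈ N.tate K L ↔ N.phi K L x = x := Iff.rfl

theorem gal_smul_coeff (g : L ≃ₐ[K] L) (c : L) (x : N.Fiber L) :
    N.gal g (c • x) = g c • N.gal g x := by
  rw [← PowerSeries.C_smul, map_smulₛₗ, ← PowerSeries.C_smul (g c)]
  congr 1
  exact PowerSeries.map_C _ _

variable {N}

theorem phi_toFiber_of_isFrobenius {φ : N.M →ₛₗ[frobSeries F R] N.M} (hφ : N.IsFrobenius φ)
    (m : N.M) : N.phi K L (N.toFiber L m) = N.toFiber L (φ m) := by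
  rw [phi_toFiber]
  change N.locToFiber K L (N.τ (LocalizedModule.mk (ScalarExt.ι (frobSeries F R) m) 1)) = _
  rw [hφ m]
  exact LocalizedModule.liftSemilinear_mk_one _ _ (N.toFiber L) (isUnit_map_zSub K L) (φ m)

/-- The height condition puts `(z - ζ)^d m` in the span of the image of `φ`. Over `L` the element `z
- ζ` is a unit because its constant term is nonzero, so it can be divided out and the fibre is
étale. -/
theorem span_range_phiCoeff {φ : N.M →ₛₗ[frobSeries F R] N.M} (hφ : N.IsFrobenius φ) {d : ℕ}
    (h : IsFrobeniusModel ζ d φ) : Submodule.span L (Set.range (N.phiCoeff K L)) = ⊤ := by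
  obtain ⟨n, hn⟩ := h.nilpotent
  rw [eq_top_iff, ← span_range_toFiber L hn, Submodule.span_le]
  rintro _ ⟨m, rfl⟩
  have hmem : ∀ y ∈ Submodule.span R (Set.range φ),
      N.toFiber L y ∈ Submodule.span L (Set.range (N.phi K L)) := by
    intro y hy
    induction hy using Submodule.span_induction with
    | mem x hx =>
      obtain ⟨m, rfl⟩ := hx
      exact Submodule.subset_span ⟨N.toFiber L m, phi_toFiber_of_isFrobenius K L hφ m⟩
    | zero => rw [map_zero]; exact zero_mem _
    | add x y _ _ hx hy => rw [map_add]; exact add_mem hx hy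
    | smul r x _ hx => rw [toFiber_smul_base]; exact Submodule.smul_mem _ _ hx
  obtain ⟨u, hu⟩ := isUnit_map_zSub K L (ζ := ζ)
    ((PowerSeries.X - PowerSeries.C ζ : R⟦X⟧) ^ d) ⟨d, rfl⟩
  have h1 := smul_mem_span_range_frob (N.phi K L) (X_pow_smul_fiber L hn) (↑u⁻¹ : L⟦X⟧)
    (hmem _ (h.height m))
  rw [map_smulₛₗ, ← hu, smul_smul, Units.inv_mul, one_smul] at h1
  exact h1

theorem span_tate [IsSepClosed L] [Module.Finite R N.M] [Module.Free R N.M]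
    {φ : N.M →ₛₗ[frobSeries F R] N.M} (hφ : N.IsFrobenius φ) {d : ℕ}
    (h : IsFrobeniusModel ζ d φ) : Submodule.span L (N.tate K L : Set (N.Fiber L)) = ⊤ := by
  obtain ⟨n, hn⟩ := h.nilpotent
  have : FiniteDimensional L (N.Fiber L) :=
    Module.Finite.of_basis (fiberBasis L hn (Module.Free.chooseBasis R N.M))
  have hset : (N.tate K L : Set (N.Fiber L)) = {x | N.phiCoeff K L x = x} := rfl
  rw [hset]
  exact span_fixed_eq_top (span_range_phiCoeff K L hφ h)

theorem finrank_fiber [IsDomain R] [Module.Finite R N.M] [Module.Free R N.M]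
    {n : ℕ} (hX : ∀ m : N.M, (PowerSeries.X : R⟦X⟧) ^ n • m = 0) :
    Module.finrank L (N.Fiber L) = Module.finrank R N.M := by
  rw [Module.finrank_eq_card_basis (fiberBasis L hX (Module.Free.chooseBasis R N.M)),
    Module.finrank_eq_card_basis (Module.Free.chooseBasis R N.M)]

/-- A set of fixed vectors that spans a subspace contains a basis of it. -/
theorem exists_linearIndependent_fixed [Module.Finite R N.M] [Module.Free R N.M]
    {n : ℕ} (hX : ∀ m : N.M, (PowerSeries.X : R⟦X⟧) ^ n • m = 0) (T : Set (N.Fiber L)) :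
    ∃ (r : ℕ) (b : Fin r → N.Fiber L), (∀ i, b i ∈ T) ∧ LinearIndependent L b ∧
      Submodule.span L (Set.range b) = Submodule.span L T ∧
      r = Module.finrank L (Submodule.span L T) := by
  have : FiniteDimensional L (N.Fiber L) :=
    Module.Finite.of_basis (fiberBasis L hX (Module.Free.chooseBasis R N.M))
  obtain ⟨s, hsT, hs, hli⟩ := exists_linearIndependent L T
  have : Finite s := hli.finite
  let e := Finite.equivFin s
  refine ⟨Nat.card s, fun i => (e.symm i : N.Fiber L), fun i => hsT (e.symm i).2,
    hli.comp _ e.symm.injective, ?_, ?_⟩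
  · rw [← hs]
    congr 1
    ext x
    constructor
    · rintro ⟨i, rfl⟩
      exact (e.symm i).2
    · intro hx
      exact ⟨e ⟨x, hx⟩, congrArg Subtype.val (e.symm_apply_apply ⟨x, hx⟩)⟩
  · let _ := Fintype.ofFinite s
    rw [← hs, Nat.card_eq_fintype_card, finrank_span_set_eq_card hli, Set.toFinset_card]

theorem card_tate [IsDomain R] [IsSepClosed L] [Module.Finite R N.M] [Module.Free R N.M]
    {φ : N.M →ₛₗ[frobSeries F R] N.M} (hφ : N.IsFrobenius φ) {d : ℕ}
    (h : IsFrobeniusModel ζ d φ) :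
    Nat.card (N.tate K L) = Fintype.card F ^ Module.finrank R N.M := by
  obtain ⟨n, hn⟩ := h.nilpotent
  obtain ⟨r, b, hbT, hli, hspan, hr⟩ :=
    exists_linearIndependent_fixed L hn (N.tate K L : Set (N.Fiber L))
  rw [span_tate K L hφ h] at hspan hr
  rw [finrank_top, finrank_fiber L hn] at hr
  rw [← hr]
  have := card_fixed (φ := N.phiCoeff K L) hli hbT (T := (N.tate K L : Set (N.Fiber L)))
    (fun x => by
      rw [hspan]
      exact ⟨fun hx => ⟨hx, Submodule.mem_top⟩, fun hx => hx.1⟩)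
  rwa [Fintype.card_fin] at this

/-- The Tate module is a torsion Galois representation. -/
theorem isTorsionGaloisRep_tateRep [IsDomain R] [IsScalarTower F R L] [IsSepClosure K L]
    [Module.Finite R N.M] [Module.Free R N.M]
    {φ : N.M →ₛₗ[frobSeries F R] N.M} (hφ : N.IsFrobenius φ) {d : ℕ}
    (h : IsFrobeniusModel ζ d φ) : IsTorsionGaloisRep (N.tateRep K L) := by
  have := IsSepClosure.sep_closed K (K := L)
  have hfin : Finite (N.tate K L) := by
    apply Nat.finite_of_card_ne_zero
    rw [card_tate K L hφ h]
    exact pow_ne_zero _ Fintype.card_ne_zero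
  obtain ⟨n, hn⟩ := h.nilpotent
  refine ⟨?_, ?_, ?_⟩
  · rw [isFiniteLength_iff_isNoetherian_isArtinian]
    exact ⟨inferInstance, inferInstance⟩
  · intro x
    refine ⟨⟨PowerSeries.X ^ n, mem_nonZeroDivisors_of_ne_zero
      (pow_ne_zero _ PowerSeries.X_ne_zero)⟩, Subtype.ext ?_⟩
    change (PowerSeries.X ^ n : F⟦X⟧) • (x : N.Fiber L) = 0
    rw [const_smul_def, map_pow, PowerSeries.map_X, X_pow_smul_fiber L hn]
  · rintro ⟨x, hx⟩
    let b := fiberBasis L hn (Module.Free.chooseBasis R N.M)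
    -- The group acts on coordinates with respect to a basis coming from `M`. The stabilizer of `x`
    -- is thus a finite intersection of stabilizers of elements algebraic over `K`, which are open.
    have hset : {g : L ≃ₐ[K] L | N.tateRep K L g ⟨x, hx⟩ = ⟨x, hx⟩} =
        ⋂ i, (MulAction.stabilizer (L ≃ₐ[K] L) (b.repr x i) : Set (L ≃ₐ[K] L)) := by
      ext g
      rw [Set.mem_iInter]
      have hg : N.gal g x = ∑ i, g (b.repr x i) • b i := by
        conv_lhs => rw [← b.sum_repr x]
        rw [map_sum]
        refine Finset.sum_congr rfl fun i _ => ?_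
        rw [gal_smul_coeff, fiberBasis_apply, gal_toFiber]
      have hiff : N.gal g x = x ↔ ∀ i, g (b.repr x i) = b.repr x i := by
        constructor
        · intro he i
          have := congrArg (fun y => b.repr y i) hg
          rw [he] at this
          exact (this.trans (by rw [b.repr_sum_self])).symm
        · intro he
          rw [hg]
          simp only [he, b.sum_repr]
      exact Subtype.ext_iff.trans hiff
    change IsOpen {g : L ≃ₐ[K] L | N.tateRep K L g ⟨x, hx⟩ = ⟨x, hx⟩}
    rw [hset]
    exact isOpen_iInter_of_finite fun i => stabilizer_isOpen_of_isIntegral _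

end TateModule

end TorsionLocalShtuka

/-! ### Saturated submodules of Frobenius modules -/

section Saturated

set_option linter.unusedSectionVars false

variable {F : Type*} [Field F] [Fintype F] {R : Type*} [CommRing R] [Algebra F R]
variable {M : Type*} [AddCommGroup M] [Module R⟦X⟧ M] [Module R M] [IsScalarTower R R⟦X⟧ M]

/-- The restriction of a semilinear endomorphism to a stable submodule. -/
def frobRestrict (φ : M →ₛₗ[frobSeries F R] M) (P : Submodule R⟦X⟧ M) (hP : ∀ m ∈ P, φ m ∈ P) :
    P →ₛₗ[frobSeries F R] P where
  toFun m := ⟨φ m, hP m m.2⟩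
  map_add' _ _ := Subtype.ext (map_add φ _ _)
  map_smul' _ _ := Subtype.ext (map_smulₛₗ φ _ _)

/-- The endomorphism of the quotient by a stable submodule. -/
def frobQuotient (φ : M →ₛₗ[frobSeries F R] M) (P : Submodule R⟦X⟧ M) (hP : ∀ m ∈ P, φ m ∈ P) :
    (M ⧸ P) →ₛₗ[frobSeries F R] (M ⧸ P) :=
  P.mapQ P φ hP

theorem frobQuotient_mkQ (φ : M →ₛₗ[frobSeries F R] M) (P : Submodule R⟦X⟧ M)
    (hP : ∀ m ∈ P, φ m ∈ P) (m : M) : frobQuotient φ P hP (P.mkQ m) = P.mkQ (φ m) := rfl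

theorem mkQ_smul_base (P : Submodule R⟦X⟧ M) (r : R) (m : M) : P.mkQ (r • m) = r • P.mkQ m := rfl

variable [IsDomain R] [IsPrincipalIdealRing R] [Module.Finite R M]

theorem finite_submodule (P : Submodule R⟦X⟧ M) : Module.Finite R P :=
  inferInstanceAs (Module.Finite R (P.restrictScalars R))

theorem free_submodule [Module.Free R M] (P : Submodule R⟦X⟧ M) : Module.Free R P :=
  inferInstanceAs (Module.Free R (P.restrictScalars R))

theorem free_quotient {P : Submodule R⟦X⟧ M} (hsat : ∀ (r : R) (m : M), r ≠ 0 → r • m ∈ P → m ∈ P) :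
    Module.Free R (M ⧸ P) := by
  have : Module.IsTorsionFree R (M ⧸ P) := by
    refine Module.IsTorsionFree.of_smul_eq_zero fun r m h => ?_
    obtain ⟨m, rfl⟩ := P.mkQ_surjective m
    rw [← mkQ_smul_base, Submodule.mkQ_apply, Submodule.Quotient.mk_eq_zero] at h
    rw [Submodule.mkQ_apply, Submodule.Quotient.mk_eq_zero]
    by_cases hr : r = 0
    · exact Or.inl hr
    · exact Or.inr (hsat r m hr h)
  infer_instance

/-- A saturated submodule is a direct summand over `R`. -/
theorem exists_retraction {P : Submodule R⟦X⟧ M}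
    (hsat : ∀ (r : R) (m : M), r ≠ 0 → r • m ∈ P → m ∈ P) :
    ∃ ρ : M →ₗ[R] P, ∀ m : P, ρ m = m := by
  have := free_quotient hsat
  obtain ⟨s, hs⟩ := Module.projective_lifting_property (P.mkQ.restrictScalars R)
    (LinearMap.id : (M ⧸ P) →ₗ[R] (M ⧸ P)) P.mkQ_surjective
  have hs' : ∀ m, P.mkQ (s m) = m := fun m => LinearMap.congr_fun hs m
  refine ⟨{ toFun := fun m => ⟨m - s (P.mkQ m), ?_⟩, map_add' := fun x y => Subtype.ext ?_,
            map_smul' := fun r x => Subtype.ext ?_ }, fun m => Subtype.ext ?_⟩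
  · rw [← Submodule.Quotient.mk_eq_zero, ← Submodule.mkQ_apply, map_sub, hs', sub_self]
  · simp only [map_add, Submodule.coe_add]
    abel
  · change r • x - s (P.mkQ (r • x)) = r • (x - s (P.mkQ x))
    rw [mkQ_smul_base, map_smul, smul_sub]
  · change (m : M) - s (P.mkQ m) = m
    rw [show P.mkQ (m : M) = 0 from (Submodule.Quotient.mk_eq_zero _).2 m.2, map_zero, sub_zero]

theorem finrank_quotient_saturated (P : Submodule R⟦X⟧ M) :
    Module.finrank R (M ⧸ P) + Module.finrank R P = Module.finrank R M :=
  Submodule.finrank_quotient_add_finrank (P.restrictScalars R)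

namespace IsFrobeniusModel

variable {ζ : R} {d : ℕ} {φ : M →ₛₗ[frobSeries F R] M} (h : IsFrobeniusModel ζ d φ)
  {P : Submodule R⟦X⟧ M} (hP : ∀ m ∈ P, φ m ∈ P)
include h

theorem quotient : IsFrobeniusModel ζ d (frobQuotient φ P hP) := by
  obtain ⟨n, hn⟩ := h.nilpotent
  refine ⟨⟨n, fun m => ?_⟩, fun m => ?_⟩
  · obtain ⟨m, rfl⟩ := P.mkQ_surjective m
    rw [← map_smul, hn, map_zero]
  · obtain ⟨m, rfl⟩ := P.mkQ_surjective m
    rw [← map_smul]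
    have := h.height m
    generalize (PowerSeries.X - PowerSeries.C ζ : R⟦X⟧) ^ d • m = y at this
    induction this using Submodule.span_induction with
    | mem x hx =>
      obtain ⟨m, rfl⟩ := hx
      exact Submodule.subset_span ⟨P.mkQ m, rfl⟩
    | zero => rw [map_zero]; exact zero_mem _
    | add x y _ _ hx hy => rw [map_add]; exact add_mem hx hy
    | smul r x _ hx => rw [mkQ_smul_base]; exact Submodule.smul_mem _ _ hx

/-- For `m` in `P`, expand `(z - ζ)^d m` in `φ(P)` and the images of lifts `c'` of a basis of `M ⧸
P`. Modulo `P` the left side vanishes, and injectivity of the linearized Frobenius of the quotient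
kills the coefficients at `c'`. Saturation enters through the freeness of `M ⧸ P`. -/
theorem restrict (hζ : ζ ≠ 0) (hsat : ∀ (r : R) (m : M), r ≠ 0 → r • m ∈ P → m ∈ P) :
    IsFrobeniusModel ζ d (frobRestrict φ P hP) := by
  obtain ⟨n, hn⟩ := h.nilpotent
  refine ⟨⟨n, fun m => Subtype.ext (hn m)⟩, fun m => ?_⟩
  have := free_quotient hsat
  let c := Module.Free.chooseBasis R (M ⧸ P)
  choose c' hc' using fun i => P.mkQ_surjective (c i)
  have hspan : Submodule.span R (Set.range (Sum.elim (Subtype.val : P → M) c')) = ⊤ := by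
    rw [eq_top_iff]
    rintro x -
    let y := ∑ i, c.repr (P.mkQ x) i • c' i
    have hy : P.mkQ y = P.mkQ x := by
      rw [map_sum]
      simp only [mkQ_smul_base, hc']
      exact c.sum_repr _
    have hxy : x - y ∈ P := by
      rw [← Submodule.Quotient.mk_eq_zero, ← Submodule.mkQ_apply, map_sub, hy, sub_self]
    rw [← sub_add_cancel x y]
    exact add_mem (Submodule.subset_span ⟨Sum.inl ⟨_, hxy⟩, rfl⟩)
      (sum_mem fun i _ => Submodule.smul_mem _ _ (Submodule.subset_span ⟨Sum.inr i, rfl⟩))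
  have hm := h.height (m : M)
  rw [span_range_frob φ hspan] at hm
  have hr : (Set.range fun i => φ (Sum.elim (Subtype.val : P → M) c' i)) =
      (Set.range fun x : P => φ x) ∪ Set.range fun i => φ (c' i) := by
    ext x
    simp
  rw [hr, Submodule.span_union, Submodule.mem_sup] at hm
  obtain ⟨x, hx, y, hy, hxy⟩ := hm
  have hxP : ∃ x' : P, (x' : M) = x ∧
      x' ∈ Submodule.span R (Set.range (frobRestrict φ P hP)) := by
    clear hxy
    induction hx using Submodule.span_induction with
    | mem x hx =>
      obtain ⟨m, rfl⟩ := hx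
      exact ⟨frobRestrict φ P hP m, rfl, Submodule.subset_span ⟨m, rfl⟩⟩
    | zero => exact ⟨0, rfl, zero_mem _⟩
    | add x y _ _ hx hy =>
      obtain ⟨x, rfl, hx⟩ := hx
      obtain ⟨y, rfl, hy⟩ := hy
      exact ⟨x + y, rfl, add_mem hx hy⟩
    | smul r x _ hx =>
      obtain ⟨x, rfl, hx⟩ := hx
      exact ⟨r • x, rfl, Submodule.smul_mem _ _ hx⟩
  obtain ⟨x, rfl, hx⟩ := hxP
  obtain ⟨a, rfl⟩ := (Submodule.mem_span_range_iff_exists_fun R).1 hy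
  have hz : ∑ i, a i • frobQuotient φ P hP (c i) = 0 := by
    have h1 := congrArg P.mkQ hxy
    rw [map_add, show P.mkQ (x : M) = 0 from (Submodule.Quotient.mk_eq_zero _).2 x.2, zero_add,
      map_sum, show P.mkQ ((PowerSeries.X - PowerSeries.C ζ : R⟦X⟧) ^ d • (m : M)) = 0 from
        (Submodule.Quotient.mk_eq_zero _).2 (P.smul_mem _ m.2)] at h1
    rw [← h1]
    refine Finset.sum_congr rfl fun i _ => ?_
    rw [mkQ_smul_base, ← frobQuotient_mkQ φ P hP, hc']
  have ha := Fintype.linearIndependent_iff.1 ((h.quotient hP).linearIndependent hζ c) a hz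
  have hxm : x = (PowerSeries.X - PowerSeries.C ζ : R⟦X⟧) ^ d • m := by
    apply Subtype.ext
    simpa [ha] using hxy
  rwa [← hxm]

end IsFrobeniusModel

end Saturated

/-! ### Galois descent of subspaces -/

section Descent

variable {K L : Type*} [Field K] [Field L] [Algebra K L] [IsGalois K L]
variable {E : Type*} [AddCommGroup E] [Module L E] {κ : Type*} [Fintype κ]

/-- A Galois stable subspace is spanned by its vectors with coordinates in the base field. -/
theorem le_span_of_galois_stable (e : Module.Basis κ L E) (γ : (L ≃ₐ[K] L) → E → E)
    (hγ : ∀ g x i, e.repr (γ g x) i = g (e.repr x i)) (W : Submodule L E)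
    (hW : ∀ g, ∀ x ∈ W, γ g x ∈ W) :
    W ≤ Submodule.span L {x | x ∈ W ∧ ∀ i, e.repr x i ∈ Set.range (algebraMap K L)} := by
  classical
  -- `I` is a minimal set of coordinates that detects the vectors of `W`. By minimality each `i` in
  -- `I` has a vector of `W` with coordinates one at `i` and zero elsewhere on `I`: a reduced
  -- echelon basis.
  obtain ⟨I, hI, hmin⟩ := (wellFounded_lt (α := Finset κ)).has_min
    {I : Finset κ | ∀ x ∈ W, (∀ i ∈ I, e.repr x i = 0) → x = 0}
    ⟨Finset.univ, fun x _ hx => e.repr.injective (by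
      ext i
      simpa using hx i (Finset.mem_univ i))⟩
  have hex : ∀ i : I, ∃ w ∈ W, ∀ j ∈ I, e.repr w j = if j = i then 1 else 0 := by
    rintro ⟨i, hi⟩
    have h1 := hmin (I.erase i)
    have h2 : ¬ (∀ x ∈ W, (∀ j ∈ I.erase i, e.repr x j = 0) → x = 0) :=
      fun hcon => h1 hcon (Finset.erase_ssubset hi)
    push Not at h2
    obtain ⟨w, hw, hwI, hw0⟩ := h2
    have hwi : e.repr w i ≠ 0 := by
      intro hcon
      refine hw0 (hI w hw fun j hj => ?_)
      by_cases hji : j = i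
      · rw [hji, hcon]
      · exact hwI j (Finset.mem_erase.2 ⟨hji, hj⟩)
    refine ⟨(e.repr w i)⁻¹ • w, W.smul_mem _ hw, fun j hj => ?_⟩
    rw [map_smul, Finsupp.smul_apply, smul_eq_mul]
    by_cases hji : j = i
    · rw [hji, if_pos rfl, inv_mul_cancel₀ hwi]
    · rw [if_neg hji, hwI j (Finset.mem_erase.2 ⟨hji, hj⟩), mul_zero]
  choose w hwW hw using hex
  have hwK : ∀ (i : I) j, e.repr (w i) j ∈ Set.range (algebraMap K L) := by
    intro i j
    rw [InfiniteGalois.mem_range_algebraMap_iff_fixed]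
    intro g
    -- Applying `g` does not change the coordinates `0` and `1` on `I`, and these determine a vector
    -- of `W`; so the echelon basis is Galois invariant.
    have h0 : γ g (w i) - w i = 0 := by
      refine hI _ (W.sub_mem (hW g _ (hwW i)) (hwW i)) fun k hk => ?_
      rw [map_sub, Finsupp.sub_apply, hγ, hw i k hk]
      split_ifs <;> simp
    rw [← hγ, sub_eq_zero.1 h0]
  intro x hx
  have h0 : x - ∑ i : I, e.repr x i • w i = 0 := by
    refine hI _ (W.sub_mem hx (W.sum_mem fun i _ => W.smul_mem _ (hwW i))) fun k hk => ?_
    rw [map_sub, Finsupp.sub_apply, map_sum, Finsupp.finsetSum_apply, sub_eq_zero]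
    simp only [map_smul, Finsupp.smul_apply, hw _ k hk, smul_eq_mul, mul_ite, mul_one, mul_zero]
    rw [Finset.sum_eq_single ⟨k, hk⟩]
    · rw [if_pos rfl]
    · rintro ⟨j, hj⟩ _ hjk
      exact if_neg fun h => hjk (Subtype.ext h.symm)
    · exact fun h => absurd (Finset.mem_univ _) h
  rw [sub_eq_zero.1 h0]
  exact sum_mem fun i _ => Submodule.smul_mem _ _ (Submodule.subset_span ⟨hwW i, hwK i⟩)

end Descent

/-! ### Equivalences of representations from intertwining maps -/

section RepEquiv

variable {A G V V' W : Type*} [CommRing A] [Group G] [AddCommGroup V] [Module A V]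
  [AddCommGroup V'] [Module A V'] [AddCommGroup W] [Module A W]
  {ρ : Representation A G V} {ρ' : Representation A G V'} {σ : Representation A G W}

theorem Representation.nonempty_equiv_of_range_eq (f : Representation.IntertwiningMap ρ σ)
    (f' : Representation.IntertwiningMap ρ' σ) (hf : Function.Injective f)
    (hf' : Function.Injective f') (h : Set.range f = Set.range f') :
    Nonempty (Representation.Equiv ρ ρ') := by
  have hr : LinearMap.range f.toLinearMap = LinearMap.range f'.toLinearMap :=
    SetLike.coe_injective h
  let e : V ≃ₗ[A] V' := (LinearEquiv.ofInjective f.toLinearMap hf).trans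
    ((LinearEquiv.ofEq _ _ hr).trans (LinearEquiv.ofInjective f'.toLinearMap hf').symm)
  have he : ∀ x, f' (e x) = f x := fun x =>
    congrArg Subtype.val ((LinearEquiv.ofInjective f'.toLinearMap hf').apply_symm_apply
      ((LinearEquiv.ofEq _ _ hr) (LinearEquiv.ofInjective f.toLinearMap hf x)))
  refine ⟨Representation.Equiv.mk e fun g => LinearMap.ext fun x => hf' ?_⟩
  change f' (e (ρ g x)) = f' (ρ' g (e x))
  rw [he, f.isIntertwining, f'.isIntertwining, he]

theorem Representation.nonempty_equiv_of_ker_eq (f : Representation.IntertwiningMap σ ρ)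
    (f' : Representation.IntertwiningMap σ ρ') (hf : Function.Surjective f)
    (hf' : Function.Surjective f') (h : ∀ x, f x = 0 ↔ f' x = 0) :
    Nonempty (Representation.Equiv ρ ρ') := by
  have hk : LinearMap.ker f.toLinearMap = LinearMap.ker f'.toLinearMap :=
    SetLike.ext h
  let e : V ≃ₗ[A] V' := (LinearMap.quotKerEquivOfSurjective f.toLinearMap hf).symm.trans
    ((Submodule.quotEquivOfEq _ _ hk).trans
      (LinearMap.quotKerEquivOfSurjective f'.toLinearMap hf'))
  have he : ∀ x, e (f x) = f' x := by
    intro x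
    have h1 : (LinearMap.quotKerEquivOfSurjective f.toLinearMap hf).symm (f x) =
        Submodule.Quotient.mk x := by
      rw [LinearEquiv.symm_apply_eq]
      rfl
    simp only [e, LinearEquiv.trans_apply, h1]
    rfl
  refine ⟨Representation.Equiv.mk e fun g => LinearMap.ext fun y => ?_⟩
  obtain ⟨x, rfl⟩ := hf y
  change e (ρ g (f x)) = ρ' g (e (f x))
  rw [he, ← f.isIntertwining, he, f'.isIntertwining]

end RepEquiv

/-! ### Morphisms of Tate modules, and the lattice cut out by a subrepresentation -/

namespace TorsionLocalShtuka

section Functoriality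

set_option linter.unusedSectionVars false

variable {F : Type*} [Field F] [Fintype F] {R : Type u} [CommRing R] [Algebra F R] {ζ : R}
variable {N N' : TorsionLocalShtuka F ζ} (K : Type*) [Field K] [Algebra R K]
variable (L : Type*) [Field L] [Algebra K L] [Algebra R L] [IsScalarTower R K L]

/-- The map between fibres induced by a linear map. -/
def fiberMap (f : N.M →ₗ[R⟦X⟧] N'.M) : N.Fiber L →ₗ[L⟦X⟧] N'.Fiber L :=
  ScalarExt.lift (RingHom.id _) ((N'.toFiber L).toAddMonoidHom.comp f.toAddMonoidHom)
    (fun a m => by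
      change N'.toFiber L (f (a • m)) = PowerSeries.map (algebraMap R L) a • N'.toFiber L (f m)
      rw [map_smul, map_smulₛₗ])

theorem fiberMap_toFiber (f : N.M →ₗ[R⟦X⟧] N'.M) (m : N.M) :
    fiberMap L f (N.toFiber L m) = N'.toFiber L (f m) :=
  ScalarExt.lift_ι _ _ _ m

theorem fiberMap_smul_coeff (f : N.M →ₗ[R⟦X⟧] N'.M) (c : L) (x : N.Fiber L) :
    fiberMap L f (c • x) = c • fiberMap L f x := by
  rw [← PowerSeries.C_smul, map_smul, PowerSeries.C_smul]

/-- The map between fibres as an `L`-linear map. -/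
def fiberMapCoeff (f : N.M →ₗ[R⟦X⟧] N'.M) : N.Fiber L →ₗ[L] N'.Fiber L where
  toFun := fiberMap L f
  map_add' := map_add _
  map_smul' := fiberMap_smul_coeff L f

variable {K L} in
theorem fiberMap_gal (f : N.M →ₗ[R⟦X⟧] N'.M) (g : L ≃ₐ[K] L) (x : N.Fiber L) :
    fiberMap L f (N.gal g x) = N'.gal g (fiberMap L f x) := by
  induction x using fiber_induction with
  | h0 => simp
  | hι b m => rw [map_smulₛₗ, map_smul, map_smul, map_smulₛₗ, gal_toFiber, fiberMap_toFiber,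
      gal_toFiber]
  | hadd x y hx hy => simp only [map_add, hx, hy]

variable [FaithfulSMul R K] [NeZero ζ] [Algebra F L]

theorem fiberMap_phi {φ : N.M →ₛₗ[frobSeries F R] N.M} (hφ : N.IsFrobenius φ)
    {φ' : N'.M →ₛₗ[frobSeries F R] N'.M} (hφ' : N'.IsFrobenius φ') {f : N.M →ₗ[R⟦X⟧] N'.M}
    (hf : ∀ m, f (φ m) = φ' (f m)) (x : N.Fiber L) :
    fiberMap L f (N.phi K L x) = N'.phi K L (fiberMap L f x) := by
  induction x using fiber_induction with
  | h0 => simp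
  | hι b m => rw [map_smulₛₗ, map_smul, map_smul, map_smulₛₗ, phi_toFiber_of_isFrobenius K L hφ,
      fiberMap_toFiber, fiberMap_toFiber, phi_toFiber_of_isFrobenius K L hφ', hf]
  | hadd x y hx hy => simp only [map_add, hx, hy]

/-- The map between Tate modules induced by a morphism. -/
def tateMap [IsScalarTower F R L] {φ : N.M →ₛₗ[frobSeries F R] N.M} (hφ : N.IsFrobenius φ)
    {φ' : N'.M →ₛₗ[frobSeries F R] N'.M} (hφ' : N'.IsFrobenius φ') {f : N.M →ₗ[R⟦X⟧] N'.M}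
    (hf : ∀ m, f (φ m) = φ' (f m)) :
    Representation.IntertwiningMap (N.tateRep K L) (N'.tateRep K L) where
  toFun x := ⟨fiberMap L f x, by
    rw [mem_tate, ← fiberMap_phi K L hφ hφ' hf]
    exact congrArg _ x.2⟩
  map_add' x y := Subtype.ext (map_add (fiberMap L f) _ _)
  map_smul' a x := Subtype.ext (map_smul (fiberMap L f) _ _)
  isIntertwining' g := LinearMap.ext fun x => Subtype.ext (fiberMap_gal f g x)

end Functoriality

section Span

set_option linter.unusedSectionVars false

variable {F : Type*} [Field F] [Fintype F] {R : Type u} [CommRing R] [Algebra F R] {ζ : R}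
variable {N : TorsionLocalShtuka F ζ} {K : Type*} [Field K] [Algebra R K]
variable {L : Type*} [Field L] [Algebra K L] [Algebra R L] [IsScalarTower R K L]
variable [FaithfulSMul R K] [NeZero ζ] [Algebra F L]

/-- The subspace of the fibre spanned by a submodule of the Tate module. -/
def spanTate (T : Submodule F⟦X⟧ (N.tate K L)) : Submodule L (N.Fiber L) :=
  Submodule.span L (Subtype.val '' (T : Set (N.tate K L)))

variable (T : Submodule F⟦X⟧ (N.tate K L))

/-- A power series acts through finitely many powers of `z`, and `T` is stable under `z`. So the
span over `L` is already stable under `L⟦z⟧`. -/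
theorem smul_mem_spanTate {n : ℕ} (hX : ∀ m : N.M, (PowerSeries.X : R⟦X⟧) ^ n • m = 0)
    (a : L⟦X⟧) {x : N.Fiber L} (hx : x ∈ spanTate T) : a • x ∈ spanTate T := by
  refine Submodule.closure_induction (p := fun x _ => a • x ∈ spanTate T) ?_ ?_ ?_ hx
  · rw [smul_zero]
    exact zero_mem _
  · intro x y _ _ hx hy
    rw [smul_add]
    exact add_mem hx hy
  · rintro c _ ⟨t, ht, rfl⟩
    rw [← PowerSeries.smul_comm_base,
      PowerSeries.smul_eq_sum_of_X_pow_smul_eq_zero (X_pow_smul_fiber L hX _)]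
    refine Submodule.smul_mem _ _ (sum_mem fun k _ => Submodule.smul_mem _ _
      (Submodule.subset_span ⟨(PowerSeries.X : F⟦X⟧) ^ k • t, T.smul_mem _ ht, ?_⟩))
    change (PowerSeries.X : F⟦X⟧) ^ k • (t : N.Fiber L) = _
    rw [const_smul_def, map_pow, PowerSeries.map_X]

theorem phi_mem_spanTate {x : N.Fiber L} (hx : x ∈ spanTate T) : N.phi K L x ∈ spanTate T := by
  induction hx using Submodule.span_induction with
  | mem x hx =>
    obtain ⟨t, ht, rfl⟩ := hx
    rw [show N.phi K L t = t from t.2]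
    exact Submodule.subset_span ⟨t, ht, rfl⟩
  | zero => rw [map_zero]; exact zero_mem _
  | add x y _ _ hx hy => rw [map_add]; exact add_mem hx hy
  | smul r x _ hx => rw [frob_smul_base]; exact Submodule.smul_mem _ _ hx

theorem gal_mem_spanTate [IsScalarTower F R L] (hT : ∀ g, ∀ t ∈ T, N.tateRep K L g t ∈ T)
    (g : L ≃ₐ[K] L) {x : N.Fiber L} (hx : x ∈ spanTate T) : N.gal g x ∈ spanTate T := by
  induction hx using Submodule.span_induction with
  | mem x hx =>
    obtain ⟨t, ht, rfl⟩ := hx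
    exact Submodule.subset_span ⟨_, hT g t ht, rfl⟩
  | zero => rw [map_zero]; exact zero_mem _
  | add x y _ _ hx hy => rw [map_add]; exact add_mem hx hy
  | smul r x _ hx => rw [gal_smul_coeff]; exact Submodule.smul_mem _ _ hx

variable [Module.Finite R N.M] [Module.Free R N.M]

/-- The span has an `L`-basis chosen from `T`. A Tate vector in the span has coordinates in `F` with
respect to it, so no new fixed vectors appear. -/
theorem mem_spanTate_iff {n : ℕ} (hX : ∀ m : N.M, (PowerSeries.X : R⟦X⟧) ^ n • m = 0)
    (x : N.tate K L) : (x : N.Fiber L) ∈ spanTate T ↔ x ∈ T := by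
  refine ⟨fun hx => ?_, fun hx => Submodule.subset_span ⟨x, hx, rfl⟩⟩
  obtain ⟨r, b, hbT, hli, hspan, -⟩ := exists_linearIndependent_fixed L hX
    (Subtype.val '' (T : Set (N.tate K L)))
  choose t ht hbt using hbT
  have hmem : (x : N.Fiber L) ∈ Submodule.span L (Set.range b) := by
    rw [hspan]
    exact hx
  obtain ⟨a, ha⟩ := exists_fixed_coeff (φ := N.phiCoeff K L) hli
    (fun i => by rw [← hbt]; exact (t i).2) x.2 hmem
  have hxt : x = ∑ i, (PowerSeries.C (a i) : F⟦X⟧) • t i := by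
    apply Subtype.ext
    rw [ha, AddSubmonoidClass.coe_finsetSum]
    refine Finset.sum_congr rfl fun i _ => ?_
    change _ = (PowerSeries.C (a i) : F⟦X⟧) • (t i : N.Fiber L)
    rw [const_smul_def, PowerSeries.map_C, PowerSeries.C_smul, hbt]
  rw [hxt]
  exact sum_mem fun i _ => T.smul_mem _ (ht i)

theorem card_submodule_tate {n : ℕ} (hX : ∀ m : N.M, (PowerSeries.X : R⟦X⟧) ^ n • m = 0) :
    Nat.card T = Fintype.card F ^ Module.finrank L (spanTate T) := by
  obtain ⟨r, b, hbT, hli, hspan, hr⟩ := exists_linearIndependent_fixed L hX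
    (Subtype.val '' (T : Set (N.tate K L)))
  have h1 := card_fixed (φ := N.phiCoeff K L) hli (fun i => by
    obtain ⟨t, -, ht⟩ := hbT i
    rw [← ht]
    exact t.2) (T := Subtype.val '' (T : Set (N.tate K L))) (fun x => by
      rw [hspan]
      constructor
      · rintro ⟨t, ht, rfl⟩
        exact ⟨t.2, Submodule.subset_span ⟨t, ht, rfl⟩⟩
      · rintro ⟨h1, h2⟩
        exact ⟨⟨x, h1⟩, (mem_spanTate_iff T hX ⟨x, h1⟩).1 h2, rfl⟩)
  rw [Fintype.card_fin, hr, Nat.card_image_of_injective Subtype.val_injective] at h1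
  exact h1

/-- The lattice of elements of `M` whose image in the fibre lies in the span of `T`. -/
def subLattice {n : ℕ} (hX : ∀ m : N.M, (PowerSeries.X : R⟦X⟧) ^ n • m = 0) :
    Submodule R⟦X⟧ N.M where
  carrier := {m | N.toFiber L m ∈ spanTate T}
  zero_mem' := by
    change N.toFiber L 0 ∈ spanTate T
    rw [map_zero]
    exact zero_mem _
  add_mem' {x y} hx hy := by
    change N.toFiber L (x + y) ∈ spanTate T
    rw [map_add]
    exact add_mem hx hy
  smul_mem' a x hx := by
    change N.toFiber L (a • x) ∈ spanTate T
    rw [map_smulₛₗ]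
    exact smul_mem_spanTate T hX _ hx

variable {n : ℕ} (hX : ∀ m : N.M, (PowerSeries.X : R⟦X⟧) ^ n • m = 0)

theorem mem_subLattice {m : N.M} : m ∈ subLattice T hX ↔ N.toFiber L m ∈ spanTate T := Iff.rfl

theorem subLattice_stable {φ : N.M →ₛₗ[frobSeries F R] N.M} (hφ : N.IsFrobenius φ)
    (m : N.M) (hm : m ∈ subLattice T hX) : φ m ∈ subLattice T hX := by
  rw [mem_subLattice, ← phi_toFiber_of_isFrobenius K L hφ]
  exact phi_mem_spanTate T hm

theorem subLattice_saturated (r : R) (m : N.M) (hr : r ≠ 0) (h : r • m ∈ subLattice T hX) :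
    m ∈ subLattice T hX := by
  have hr' : algebraMap R L r ≠ 0 := by
    rw [IsScalarTower.algebraMap_apply R K L]
    simpa using hr
  rw [mem_subLattice, toFiber_smul_base] at h
  rw [mem_subLattice]
  have := Submodule.smul_mem _ (algebraMap R L r)⁻¹ h
  rwa [smul_smul, inv_mul_cancel₀ hr', one_smul] at this

/-- By Galois descent the span of a stable `T` is generated by vectors with coordinates in `K`.
Clearing denominators moves these into `M`, hence into the sublattice. -/
theorem span_toFiber_subLattice [IsDomain R] [IsFractionRing R K] [IsGalois K L]
    [IsScalarTower F R L]
    (hT : ∀ g, ∀ t ∈ T, N.tateRep K L g t ∈ T) :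
    Submodule.span L (N.toFiber L '' (subLattice T hX)) = spanTate T := by
  apply le_antisymm
  · rw [Submodule.span_le]
    rintro _ ⟨m, hm, rfl⟩
    exact hm
  let b := Module.Free.chooseBasis R N.M
  let e := fiberBasis L hX b
  have he : ∀ i, e i = N.toFiber L (b i) := fiberBasis_apply L hX b
  refine (le_span_of_galois_stable (K := K) e (fun g => N.gal g) ?_ (spanTate T)
    fun g x hx => gal_mem_spanTate T hT g hx).trans ?_
  · intro g x i
    have hg : N.gal g x = ∑ i, g (e.repr x i) • e i := by
      conv_lhs => rw [← e.sum_repr x]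
      rw [map_sum]
      refine Finset.sum_congr rfl fun i _ => ?_
      rw [gal_smul_coeff, he, gal_toFiber]
    rw [hg, e.repr_sum_self]
  · rw [Submodule.span_le]
    rintro x ⟨hxW, hxK⟩
    choose k hk using hxK
    -- `s` is a common denominator of the coordinates of `x`, so `s x` comes from `M`.
    obtain ⟨s, hs⟩ := IsLocalization.exist_integer_multiples_of_finite (nonZeroDivisors R) k
    choose c hc using hs
    have hs0 : algebraMap R L s ≠ 0 := by
      rw [IsScalarTower.algebraMap_apply R K L]
      simp
    have hx : N.toFiber L (∑ i, c i • b i) = algebraMap R L s • x := by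
      conv_rhs => rw [← e.sum_repr x]
      rw [map_sum, Finset.smul_sum]
      refine Finset.sum_congr rfl fun i _ => ?_
      rw [toFiber_smul_base, he, smul_smul, ← hk, IsScalarTower.algebraMap_apply R K L, hc,
        Algebra.smul_def, map_mul, ← IsScalarTower.algebraMap_apply R K L]
    have hx' : x = (algebraMap R L s)⁻¹ • N.toFiber L (∑ i, c i • b i) := by
      rw [hx, smul_smul, inv_mul_cancel₀ hs0, one_smul]
    rw [hx']
    refine Submodule.smul_mem _ _ (Submodule.subset_span ⟨_, ?_, rfl⟩)
    change N.toFiber L _ ∈ spanTate T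
    rw [hx]
    exact Submodule.smul_mem _ _ hxW

end Span

end TorsionLocalShtuka

/-! ### Subobjects and quotients of Tate modules -/

namespace TorsionLocalShtuka

section Model

variable {F : Type*} [Field F] [Fintype F] {R : Type u} [CommRing R] [Algebra F R] {ζ : R}
variable [IsDomain R] [IsPrincipalIdealRing R] [NeZero ζ]

/-- A torsion local shtuka that is a model of a Frobenius module, with its structure. -/
theorem exists_model {M : Type u} [AddCommGroup M] [Module R⟦X⟧ M] [Module R M]
    [IsScalarTower R R⟦X⟧ M] [Module.Finite R M] [Module.Free R M] {d : ℕ}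
    {φ : M →ₛₗ[frobSeries F R] M} (h : IsFrobeniusModel ζ d φ) :
    ∃ (N : TorsionLocalShtuka F ζ) (e : N.M ≃ₗ[R⟦X⟧] M) (ψ : N.M →ₛₗ[frobSeries F R] N.M),
      N.IsEffective ∧ N.HeightLE d ∧ N.IsFrobenius ψ ∧ (∀ m, e (ψ m) = φ (e m)) ∧
      IsFrobeniusModel ζ d ψ ∧ Module.Finite R N.M ∧ Module.Free R N.M ∧
      Module.finrank R N.M = Module.finrank R M := by
  obtain ⟨N, e, ψ, heff, hht, hψ, he⟩ := exists_of_isFrobeniusModel h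
  obtain ⟨hfin, hfree, -⟩ := hht.exists_isFrobenius
  refine ⟨N, e, ψ, heff, hht, hψ, he, ?_, hfin, hfree,
    LinearEquiv.finrank_eq (e.restrictScalars R)⟩
  obtain ⟨n, hX⟩ := h.nilpotent
  refine ⟨⟨n, fun m => e.injective (by rw [map_smul, hX, map_zero])⟩, fun m => ?_⟩
  have h2 := Submodule.mem_map_of_mem (f := (e.symm.restrictScalars R).toLinearMap)
    (h.height (e m))
  rw [Submodule.map_span, ← Set.range_comp] at h2
  convert h2 using 1
  · congr 1
    ext (x : N.M)
    constructor
    · rintro ⟨m, rfl⟩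
      refine ⟨e m, ?_⟩
      change e.symm (φ (e m)) = _
      rw [← he, e.symm_apply_apply]
    · rintro ⟨y, rfl⟩
      refine ⟨e.symm y, e.injective ?_⟩
      change _ = e (e.symm _)
      rw [he, e.apply_symm_apply, e.apply_symm_apply]
  · change _ = e.symm _
    rw [map_smul, e.symm_apply_apply]

end Model

section SubQuotient

set_option linter.unusedSectionVars false

variable {F : Type*} [Field F] [Fintype F] {R : Type u} [CommRing R] [Algebra F R] {ζ : R}
variable {N : TorsionLocalShtuka F ζ} {K : Type*} [Field K] [Algebra R K]
variable {L : Type*} [Field L] [Algebra K L] [Algebra R L] [IsScalarTower R K L]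
variable [IsDomain R] [IsPrincipalIdealRing R] [IsFractionRing R K] [NeZero ζ] [Algebra F L]
  [IsScalarTower F R L]

/-- Composing the coordinates of `P` with an `R`-linear retraction `M → P` gives functionals on all
of `M` that are dual to the basis, and duality survives the extension of scalars. -/
theorem linearIndependent_toFiber_submodule [Module.Finite R N.M]
    {n : ℕ} (hX : ∀ m : N.M, (PowerSeries.X : R⟦X⟧) ^ n • m = 0) {P : Submodule R⟦X⟧ N.M}
    (hsat : ∀ (r : R) (m : N.M), r ≠ 0 → r • m ∈ P → m ∈ P) {κ : Type*}
    (b : Module.Basis κ R P) : LinearIndependent L fun i => N.toFiber L (b i) := by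
  classical
  obtain ⟨ρ, hρ⟩ := exists_retraction hsat
  refine ScalarExt.linearIndependent_ι hX (c := fun i => b.coord i ∘ₗ ρ) fun i j => ?_
  simp [hρ, Finsupp.single_apply, eq_comm]

theorem span_toFiber_basis {P : Submodule R⟦X⟧ N.M} {κ : Type*} (b : Module.Basis κ R P) :
    Submodule.span L (Set.range fun i => N.toFiber L (b i)) =
      Submodule.span L (N.toFiber L '' P) := by
  apply le_antisymm
  · refine Submodule.span_mono ?_
    rintro _ ⟨i, rfl⟩
    exact ⟨b i, (b i).2, rfl⟩
  · rw [Submodule.span_le]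
    rintro _ ⟨m, hm, rfl⟩
    have : ∀ x : P, N.toFiber L x ∈
        Submodule.span L (Set.range fun i => N.toFiber L (b i)) := by
      intro x
      have hx : x ∈ Submodule.span R (Set.range b) := b.span_eq ▸ Submodule.mem_top
      induction hx using Submodule.span_induction with
      | mem x hx =>
        obtain ⟨i, rfl⟩ := hx
        exact Submodule.subset_span ⟨i, rfl⟩
      | zero => rw [ZeroMemClass.coe_zero, map_zero]; exact zero_mem _
      | add x y _ _ hx hy => rw [Submodule.coe_add, map_add]; exact add_mem hx hy
      | smul r x _ hx =>
        rw [show ((r • x : P) : N.M) = r • (x : N.M) from rfl, toFiber_smul_base]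
        exact Submodule.smul_mem _ _ hx
    exact this ⟨m, hm⟩

variable [IsSepClosure K L] [Module.Finite R N.M] [Module.Free R N.M]
  {φ : N.M →ₛₗ[frobSeries F R] N.M} (hφ : N.IsFrobenius φ) {d : ℕ} (h : IsFrobeniusModel ζ d φ)
  (T : Submodule F⟦X⟧ (N.tate K L)) (hT : ∀ g, ∀ t ∈ T, N.tateRep K L g t ∈ T)
include hφ h hT

/-- A subrepresentation of a Tate module is a Tate module. -/
theorem exists_sub : ∃ (N' : TorsionLocalShtuka F ζ)
    (f : Representation.IntertwiningMap (N'.tateRep K L) (N.tateRep K L)),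
      N'.IsEffective ∧ N'.HeightLE d ∧ Function.Injective f ∧ Set.range f = T := by
  obtain ⟨n, hX⟩ := h.nilpotent
  let P := subLattice T hX
  have hsat := subLattice_saturated T hX
  have hP := subLattice_stable T hX hφ
  have := finite_submodule P
  have := free_submodule P
  obtain ⟨N', e, ψ, heff, hht, hψ, heψ⟩ :=
    exists_of_isFrobeniusModel (h.restrict hP (NeZero.ne ζ) hsat)
  have hcomm : ∀ m, (P.subtype ∘ₗ e.toLinearMap) (ψ m) = φ ((P.subtype ∘ₗ e.toLinearMap) m) :=
    fun m => congrArg Subtype.val (heψ m)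
  have hX' : ∀ m : N'.M, (PowerSeries.X : R⟦X⟧) ^ n • m = 0 := fun m => e.injective (by
    rw [map_smul, map_zero]
    exact Subtype.ext (hX _))
  let b := Module.Free.chooseBasis R P
  let b' := b.map (e.symm.restrictScalars R)
  have hb' : ∀ i, (P.subtype ∘ₗ e.toLinearMap) (b' i) = b i := fun i =>
    congrArg Subtype.val (e.apply_symm_apply (b i))
  let β := fiberBasis L hX' b'
  have hβ : ∀ i, fiberMapCoeff L (P.subtype ∘ₗ e.toLinearMap) (β i) = N.toFiber L (b i) := by
    intro i
    change fiberMap L (P.subtype ∘ₗ e.toLinearMap) (fiberBasis L hX' b' i) = _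
    rw [fiberBasis_apply, fiberMap_toFiber, hb']
  have hinj : Function.Injective (fiberMapCoeff L (P.subtype ∘ₗ e.toLinearMap)) := by
    refine LinearMap.ker_eq_bot.1 (LinearMap.ker_eq_bot'.2 fun x hx => ?_)
    rw [← β.sum_repr x, map_sum] at hx
    simp only [map_smul, hβ] at hx
    have := Fintype.linearIndependent_iff.1
      (linearIndependent_toFiber_submodule (L := L) hX hsat b) _ hx
    rw [← β.sum_repr x]
    simp [this]
  have hrange : LinearMap.range (fiberMapCoeff L (P.subtype ∘ₗ e.toLinearMap)) = spanTate T := by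
    rw [← span_toFiber_subLattice T hX hT, ← span_toFiber_basis b, LinearMap.range_eq_map,
      ← β.span_eq, Submodule.map_span, ← Set.range_comp]
    congr 2
    ext i
    exact hβ i
  refine ⟨N', tateMap K L hψ hφ hcomm, heff, hht, fun x y hxy => ?_, ?_⟩
  · exact Subtype.ext (hinj (congrArg Subtype.val hxy))
  · ext t
    constructor
    · rintro ⟨x, rfl⟩
      change _ ∈ T
      rw [← mem_spanTate_iff T hX, ← hrange]
      exact ⟨x, rfl⟩
    · intro ht
      have ht' := (mem_spanTate_iff T hX t).2 ht
      rw [← hrange] at ht'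
      obtain ⟨x, hx⟩ := ht'
      refine ⟨⟨x, ?_⟩, Subtype.ext hx⟩
      -- The preimage of a fixed vector is fixed, because the map of fibres is injective and
      -- commutes with the Frobenius.
      apply hinj
      refine (fiberMap_phi K L hψ hφ hcomm x).trans ?_
      change N.phi K L (fiberMapCoeff L (P.subtype ∘ₗ e.toLinearMap) x) = _
      rw [hx]
      exact t.2

/-- A quotient of a Tate module is a Tate module. -/
theorem exists_quotient : ∃ (N' : TorsionLocalShtuka F ζ)
    (f : Representation.IntertwiningMap (N.tateRep K L) (N'.tateRep K L)),
      N'.IsEffective ∧ N'.HeightLE d ∧ Function.Surjective f ∧ ∀ x, f x = 0 ↔ x ∈ T := by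
  have := IsSepClosure.sep_closed K (K := L)
  obtain ⟨n, hX⟩ := h.nilpotent
  let P := subLattice T hX
  have hsat := subLattice_saturated T hX
  have hP := subLattice_stable T hX hφ
  have := finite_submodule P
  have := free_submodule P
  have := free_quotient hsat
  obtain ⟨N', e, ψ, heff, hht, hψ, heψ, hmodel', _, _, hrank'⟩ := exists_model (h.quotient hP)
  let f : N.M →ₗ[R⟦X⟧] N'.M := e.symm.toLinearMap ∘ₗ P.mkQ
  have hcomm : ∀ m, f (φ m) = ψ (f m) := by
    intro m
    apply e.injective
    rw [heψ]
    change e (e.symm (P.mkQ (φ m))) = frobQuotient φ P hP (e (e.symm (P.mkQ m)))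
    rw [e.apply_symm_apply, e.apply_symm_apply]
    rfl
  have hX' : ∀ m : N'.M, (PowerSeries.X : R⟦X⟧) ^ n • m = 0 := fun m => by
    obtain ⟨x, hx⟩ := P.mkQ_surjective (e m)
    apply e.injective
    rw [map_smul, map_zero, ← hx, ← map_smul, hX, map_zero]
  let b := Module.Free.chooseBasis R P
  have hdim : Module.finrank L (spanTate T) = Module.finrank R P := by
    rw [← span_toFiber_subLattice T hX hT, ← span_toFiber_basis b,
      finrank_span_eq_card (linearIndependent_toFiber_submodule (L := L) hX hsat b),
      Module.finrank_eq_card_basis b]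
  have : FiniteDimensional L (N.Fiber L) :=
    Module.Finite.of_basis (fiberBasis L hX (Module.Free.chooseBasis R N.M))
  have hsurj : LinearMap.range (fiberMapCoeff L f) = ⊤ := by
    rw [eq_top_iff, ← span_range_toFiber L hX', Submodule.span_le]
    rintro _ ⟨m, rfl⟩
    obtain ⟨x, hx⟩ := P.mkQ_surjective (e m)
    refine ⟨N.toFiber L x, (fiberMap_toFiber L f x).trans ?_⟩
    congr 1
    change e.symm (P.mkQ x) = m
    rw [hx, e.symm_apply_apply]
  have hle : spanTate T ≤ LinearMap.ker (fiberMapCoeff L f) := by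
    rw [← span_toFiber_subLattice T hX hT, Submodule.span_le]
    rintro _ ⟨m, hm, rfl⟩
    change fiberMap L f (N.toFiber L m) = 0
    rw [fiberMap_toFiber]
    change N'.toFiber L (e.symm (P.mkQ m)) = 0
    rw [show P.mkQ m = 0 from (Submodule.Quotient.mk_eq_zero _).2 hm, map_zero, map_zero]
  have hrank := finrank_quotient_saturated P
  rw [← hrank'] at hrank
  -- One inclusion is clear. Both sides have dimension `rank P`: the left by descent, the right by
  -- rank–nullity for the surjection of fibres.
  have hker : spanTate T = LinearMap.ker (fiberMapCoeff L f) := by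
    apply Submodule.eq_of_le_of_finrank_eq hle
    have h1 := LinearMap.finrank_range_add_finrank_ker (fiberMapCoeff L f)
    rw [hsurj, finrank_top, finrank_fiber L hX, finrank_fiber L hX'] at h1
    omega
  have hk : ∀ x, tateMap K L hφ hψ hcomm x = 0 ↔ x ∈ T := by
    intro x
    rw [← mem_spanTate_iff T hX, hker, Subtype.ext_iff]
    rfl
  refine ⟨N', tateMap K L hφ hψ hcomm, heff, hht, ?_, hk⟩
  let g := (tateMap K L hφ hψ hcomm).toLinearMap
  have hkg : LinearMap.ker g = T := SetLike.ext hk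
  -- Surjectivity on Tate modules is a count: the image has `q^(rank M - rank P)` elements, and so
  -- does the Tate module of the quotient model.
  have hc := Submodule.card_eq_card_quotient_mul_card (LinearMap.ker g)
  rw [Nat.card_congr g.quotKerEquivRange.toEquiv, hkg, card_tate K L hφ h,
    card_submodule_tate T hX, hdim, ← hrank, add_comm, pow_add] at hc
  have hc' := Nat.eq_of_mul_eq_mul_left (pow_pos Fintype.card_pos _) hc
  rw [← card_tate K L hψ hmodel'] at hc'
  have hfin : Finite (N'.tate K L) := by
    apply Nat.finite_of_card_ne_zero
    rw [card_tate K L hψ hmodel']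
    exact pow_ne_zero _ Fintype.card_ne_zero
  have hr : (LinearMap.range g : Set (N'.tate K L)) = Set.univ := by
    apply Set.eq_of_subset_of_ncard_le (Set.subset_univ _)
    rw [Set.ncard_univ, hc']
    exact le_rfl
  intro y
  have hy : y ∈ (LinearMap.range g : Set (N'.tate K L)) := hr ▸ Set.mem_univ y
  exact hy

end SubQuotient

end TorsionLocalShtuka

/-! ### Closure under subobjects and quotients for abstract representations -/

section Objects

set_option linter.unusedSectionVars false

variable {F : Type*} [Field F] [Fintype F] {R : Type u} [CommRing R] [Algebra F R] {ζ : R}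
variable {K : Type*} [Field K] [Algebra R K]
variable {L : Type*} [Field L] [Algebra K L] [Algebra R L] [IsScalarTower R K L]
variable [IsDomain R] [IsPrincipalIdealRing R] [IsFractionRing R K] [NeZero ζ] [Algebra F L]
  [IsScalarTower F R L] [IsSepClosure K L]
variable {T : Type*} [AddCommGroup T] [Module F⟦X⟧ T]

theorem IsTorsionGaloisRep.of_equiv {T' : Type*} [AddCommGroup T'] [Module F⟦X⟧ T']
    {ρ : Representation F⟦X⟧ (L ≃ₐ[K] L) T} {ρ' : Representation F⟦X⟧ (L ≃ₐ[K] L) T'}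
    (h : IsTorsionGaloisRep ρ') (e : Representation.Equiv ρ ρ') : IsTorsionGaloisRep ρ := by
  have he : Function.Injective e := e.toLinearEquiv.injective
  refine ⟨?_, fun {x} => ?_, fun t => ?_⟩
  · exact e.toLinearEquiv.symm.isFiniteLength h.finiteLength
  · obtain ⟨a, ha⟩ := h.torsion (x := e x)
    refine ⟨a, he ?_⟩
    exact ((map_smul e.toLinearMap (a : F⟦X⟧) x).trans ha).trans (map_zero e.toLinearMap).symm
  · convert h.discrete (e t) using 1
    ext g
    change ρ g t = t ↔ ρ' g (e t) = e t
    have : ρ' g (e t) = e (ρ g t) :=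
      (Representation.IntertwiningMap.isIntertwining _ _ e.toIntertwiningMap g t).symm
    rw [this]
    exact he.eq_iff.symm

/-- Finite length, torsion and discreteness hold for every Tate module of bounded height. Hence each
closure property only requires the construction of a model. -/
theorem AdmitsEffectiveModel.isEffectiveTorsionRep {d : ℕ}
    {ρ : Representation F⟦X⟧ (L ≃ₐ[K] L) T} (h : AdmitsEffectiveModel ζ d ρ) :
    IsEffectiveTorsionRep ζ d ρ := by
  refine ⟨?_, h⟩
  obtain ⟨N, -, hN, ⟨e⟩⟩ := h
  obtain ⟨_, _, φ, hφ, hm⟩ := hN.exists_isFrobenius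
  exact (TorsionLocalShtuka.isTorsionGaloisRep_tateRep K L hφ hm).of_equiv e

theorem AdmitsEffectiveModel.sub {S : Type*} [AddCommGroup S] [Module F⟦X⟧ S] {d : ℕ}
    {ρ : Representation F⟦X⟧ (L ≃ₐ[K] L) T} {σ : Representation F⟦X⟧ (L ≃ₐ[K] L) S}
    (h : AdmitsEffectiveModel ζ d ρ) (i : Representation.IntertwiningMap σ ρ)
    (hi : Function.Injective i) : AdmitsEffectiveModel ζ d σ := by
  obtain ⟨N, -, hN, ⟨e⟩⟩ := h
  obtain ⟨_, _, φ, hφ, hm⟩ := hN.exists_isFrobenius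
  let j := e.toIntertwiningMap.comp i
  have hj : Function.Injective j := e.toLinearEquiv.injective.comp hi
  obtain ⟨N', f, heff, hht, hf, hr⟩ := TorsionLocalShtuka.exists_sub hφ hm
    (LinearMap.range j.toLinearMap) (by
      rintro g _ ⟨s, rfl⟩
      exact ⟨σ g s, Representation.IntertwiningMap.isIntertwining _ _ j g s⟩)
  exact ⟨N', heff, hht, Representation.nonempty_equiv_of_range_eq j f hj hf hr.symm⟩

theorem AdmitsEffectiveModel.quotient {S : Type*} [AddCommGroup S] [Module F⟦X⟧ S] {d : ℕ}
    {ρ : Representation F⟦X⟧ (L ≃ₐ[K] L) T} {σ : Representation F⟦X⟧ (L ≃ₐ[K] L) S}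
    (h : AdmitsEffectiveModel ζ d ρ) (p : Representation.IntertwiningMap ρ σ)
    (hp : Function.Surjective p) : AdmitsEffectiveModel ζ d σ := by
  obtain ⟨N, -, hN, ⟨e⟩⟩ := h
  obtain ⟨_, _, φ, hφ, hm⟩ := hN.exists_isFrobenius
  let j := p.comp e.symm.toIntertwiningMap
  have hj : Function.Surjective j := hp.comp e.toLinearEquiv.symm.surjective
  obtain ⟨N', f, heff, hht, hf, hk⟩ := TorsionLocalShtuka.exists_quotient hφ hm
    (LinearMap.ker j.toLinearMap) (by
      intro g t ht
      have ht' : j t = 0 := ht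
      change j (N.tateRep K L g t) = 0
      rw [j.isIntertwining, ht', map_zero])
  exact ⟨N', heff, hht, Representation.nonempty_equiv_of_ker_eq j f hj hf
    fun x => (hk x).symm⟩

end Objects

/-- Used for products and for duality: an explicit equivariant injection is enough once the
cardinalities are known. -/
theorem Representation.nonempty_equiv_of_card_le {A G V W : Type*} [CommRing A] [Group G]
    [AddCommGroup V] [Module A V] [AddCommGroup W] [Module A W]
    {ρ : Representation A G V} {σ : Representation A G W} [Finite W]
    (f : Representation.IntertwiningMap ρ σ) (hf : Function.Injective f)
    (hcard : Nat.card W ≤ Nat.card V) : Nonempty (Representation.Equiv σ ρ) := by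
  have : Finite V := Finite.of_injective f hf
  have hr : Set.range f = Set.univ := by
    apply Set.eq_of_subset_of_ncard_le (Set.subset_univ _)
    rw [Set.ncard_univ, ← Set.image_univ, Set.ncard_image_of_injective _ hf, Set.ncard_univ]
    exact hcard
  have hb : Function.Bijective f := ⟨hf, Set.range_eq_univ.1 hr⟩
  exact ⟨(Representation.IntertwiningMap.ofBijective f hb).symm⟩

/-! ### Products -/

section Products

variable {F : Type*} [Field F] [Fintype F] {R : Type*} [CommRing R] [Algebra F R]
variable {ι : Type*} {M : ι → Type*} [∀ i, AddCommGroup (M i)] [∀ i, Module R⟦X⟧ (M i)]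

/-- The product of a family of semilinear endomorphisms. -/
def frobPi (φ : ∀ i, M i →ₛₗ[frobSeries F R] M i) :
    (∀ i, M i) →ₛₗ[frobSeries F R] (∀ i, M i) where
  toFun m i := φ i (m i)
  map_add' _ _ := funext fun i => map_add (φ i) _ _
  map_smul' _ _ := funext fun i => map_smulₛₗ (φ i) _ _

theorem IsFrobeniusModel.pi [Finite ι] [∀ i, Module R (M i)] [∀ i, IsScalarTower R R⟦X⟧ (M i)]
    {ζ : R} {d : ℕ} {φ : ∀ i, M i →ₛₗ[frobSeries F R] M i}
    (h : ∀ i, IsFrobeniusModel ζ d (φ i)) : IsFrobeniusModel ζ d (frobPi φ) := by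
  classical
  let _ := Fintype.ofFinite ι
  choose n hn using fun i => (h i).nilpotent
  refine ⟨⟨Finset.univ.sup n, fun m => funext fun i => ?_⟩, fun m => ?_⟩
  · obtain ⟨k, hk⟩ := Nat.exists_eq_add_of_le' (Finset.le_sup (f := n) (Finset.mem_univ i))
    rw [hk, pow_add, Pi.smul_apply, mul_smul, hn, smul_zero]
    rfl
  · have key : ∀ i, ∀ y ∈ Submodule.span R (Set.range (φ i)),
        Pi.single i y ∈ Submodule.span R (Set.range (frobPi φ)) := by
      intro i y hy
      induction hy using Submodule.span_induction with
      | mem x hx =>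
        obtain ⟨m, rfl⟩ := hx
        refine Submodule.subset_span ⟨Pi.single i m, funext fun j => ?_⟩
        change φ j (Pi.single i m j) = _
        rw [Pi.apply_single (fun j => φ j) (fun j => map_zero (φ j))]
      | zero => rw [Pi.single_zero]; exact zero_mem _
      | add x y _ _ hx hy => rw [Pi.single_add]; exact add_mem hx hy
      | smul r x _ hx => rw [Pi.single_smul]; exact Submodule.smul_mem _ _ hx
    rw [← Finset.univ_sum_single ((PowerSeries.X - PowerSeries.C ζ : R⟦X⟧) ^ d • m)]
    exact sum_mem fun i _ => key i _ ((h i).height (m i))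

end Products

section ProductObjects

variable {F : Type*} [Field F] [Fintype F] {R : Type u} [CommRing R] [Algebra F R] {ζ : R}
variable {K : Type*} [Field K] [Algebra R K]
variable {L : Type*} [Field L] [Algebra K L] [Algebra R L] [IsScalarTower R K L]
variable [IsDomain R] [IsPrincipalIdealRing R] [IsFractionRing R K] [NeZero ζ] [Algebra F L]
  [IsScalarTower F R L] [IsSepClosure K L]

open TorsionLocalShtuka in
-- The product of the models maps to each factor. Together the induced maps embed its Tate module
-- into the product, and both have `q^(∑ rank)` elements. Indexing by `Fin n` keeps the product
-- module in the universe of `R`.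
theorem AdmitsEffectiveModel.piFin {n d : ℕ} {T : Fin n → Type*} [∀ j, AddCommGroup (T j)]
    [∀ j, Module F⟦X⟧ (T j)] {ρ : ∀ j, Representation F⟦X⟧ (L ≃ₐ[K] L) (T j)}
    (h : ∀ j, AdmitsEffectiveModel ζ d (ρ j)) :
    AdmitsEffectiveModel ζ d (Representation.piRep ρ) := by
  have := IsSepClosure.sep_closed K (K := L)
  choose N _ hN he using h
  choose hfin hfree φ hφ hm using fun j => (hN j).exists_isFrobenius
  let ε := fun j => (he j).some
  obtain ⟨N', e, ψ, heff, hht, hψ, hψe, hmodel, hfin', hfree', hrank⟩ :=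
    exists_model (IsFrobeniusModel.pi hm)
  let f : ∀ j, N'.M →ₗ[R⟦X⟧] (N j).M := fun j => LinearMap.proj j ∘ₗ e.toLinearMap
  have hf : ∀ j m, f j (ψ m) = φ j (f j m) := fun j m => congrFun (hψe m) j
  let t : ∀ j, Representation.IntertwiningMap (N'.tateRep K L) (ρ j) := fun j =>
    (ε j).symm.toIntertwiningMap.comp (tateMap K L hψ (hφ j) (hf j))
  let θ : Representation.IntertwiningMap (N'.tateRep K L) (Representation.piRep ρ) :=
    { toLinearMap := LinearMap.pi fun j => (t j).toLinearMap
      isIntertwining' := fun g => LinearMap.ext fun x => funext fun j =>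
        Representation.IntertwiningMap.isIntertwining _ _ (t j) g x }
  have hinj : Function.Injective θ := by
    refine (injective_iff_map_eq_zero _).2 fun x hx => ?_
    have hx' : ∀ j, fiberMap L (f j) (x : N'.Fiber L) = 0 := by
      intro j
      have h1 : (ε j).symm (tateMap K L hψ (hφ j) (hf j) x) = 0 := congrFun hx j
      have h2 := (ε j).toLinearEquiv.symm.injective (h1.trans (map_zero _).symm)
      exact congrArg Subtype.val h2
    -- The inclusions `s j` and projections `f j` satisfy `∑ s j ∘ f j = id`. This identity persists
    -- on fibres and recovers `x` from its components.
    let s : ∀ j, (N j).M →ₗ[R⟦X⟧] N'.M := fun j =>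
      e.symm.toLinearMap ∘ₗ LinearMap.single R⟦X⟧ (fun j => (N j).M) j
    have hs : ∀ m, ∑ j, s j (f j m) = m := by
      intro m
      apply e.injective
      rw [map_sum]
      simp only [s, LinearMap.comp_apply, LinearEquiv.coe_coe, e.apply_symm_apply]
      exact Finset.univ_sum_single (e m)
    have hsum : ∀ y : N'.Fiber L, ∑ j, fiberMap L (s j) (fiberMap L (f j) y) = y := by
      intro y
      induction y using fiber_induction with
      | h0 => simp
      | hι b m =>
        simp only [map_smul, fiberMap_toFiber]
        rw [← Finset.smul_sum, ← map_sum, hs]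
      | hadd x y hx hy =>
        simp only [map_add, Finset.sum_add_distrib, hx, hy]
    apply Subtype.ext
    rw [← hsum x]
    simp [hx']
  have hcard : ∀ j, Nat.card (T j) = Fintype.card F ^ Module.finrank R (N j).M := fun j => by
    rw [Nat.card_congr (ε j).toLinearEquiv.toEquiv, card_tate K L (hφ j) (hm j)]
  have hT : ∀ j, Finite (T j) := fun j => Nat.finite_of_card_ne_zero (by
    rw [hcard]
    exact pow_ne_zero _ Fintype.card_ne_zero)
  refine ⟨N', heff, hht, Representation.nonempty_equiv_of_card_le θ hinj ?_⟩
  rw [card_tate K L hψ hmodel, hrank, Module.finrank_pi_fintype, Nat.card_pi,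
    ← Finset.prod_pow_eq_pow_sum]
  simp only [hcard]
  exact le_rfl

theorem AdmitsEffectiveModel.pi {ι : Type*} [Finite ι] {d : ℕ} {T : ι → Type*}
    [∀ j, AddCommGroup (T j)] [∀ j, Module F⟦X⟧ (T j)]
    {ρ : ∀ j, Representation F⟦X⟧ (L ≃ₐ[K] L) (T j)} (h : ∀ j, AdmitsEffectiveModel ζ d (ρ j)) :
    AdmitsEffectiveModel ζ d (Representation.piRep ρ) := by
  let e := Finite.equivFin ι
  let f : Representation.IntertwiningMap (Representation.piRep ρ)
      (Representation.piRep fun k => ρ (e.symm k)) :=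
    { toFun := fun x k => x (e.symm k)
      map_add' := fun _ _ => rfl
      map_smul' := fun _ _ => rfl
      isIntertwining' := fun _ => rfl }
  refine (AdmitsEffectiveModel.piFin fun k => h (e.symm k)).sub f fun x y hxy => funext fun j => ?_
  obtain ⟨k, rfl⟩ := e.symm.surjective j
  exact congrFun hxy k

end ProductObjects

/-! ### The dual of a Frobenius module -/

section SeriesDual

/-- The `R`-linear dual of an `R⟦z⟧`-module, with the action of `R⟦z⟧` through the argument. -/
def SeriesDual (R M : Type*) [CommRing R] [AddCommGroup M] [Module R M] : Type _ := M →ₗ[R] R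

namespace SeriesDual

variable {R M : Type*} [CommRing R] [AddCommGroup M] [Module R M]

instance : AddCommGroup (SeriesDual R M) := inferInstanceAs (AddCommGroup (M →ₗ[R] R))

instance : Module R (SeriesDual R M) := inferInstanceAs (Module R (M →ₗ[R] R))

instance : FunLike (SeriesDual R M) M R := inferInstanceAs (FunLike (M →ₗ[R] R) M R)

instance : LinearMapClass (SeriesDual R M) R M R :=
  inferInstanceAs (LinearMapClass (M →ₗ[R] R) R M R)

instance [Module.Finite R M] [Module.Free R M] : Module.Finite R (SeriesDual R M) :=
  inferInstanceAs (Module.Finite R (M →ₗ[R] R))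

instance [Module.Finite R M] [Module.Free R M] : Module.Free R (SeriesDual R M) :=
  inferInstanceAs (Module.Free R (M →ₗ[R] R))

theorem ext {f g : SeriesDual R M} (h : ∀ m, f m = g m) : f = g := LinearMap.ext h

/-- A linear form as an element of the dual. -/
def of (f : M →ₗ[R] R) : SeriesDual R M := f

theorem of_apply (f : M →ₗ[R] R) (m : M) : of f m = f m := rfl

theorem add_apply (f g : SeriesDual R M) (m : M) : (f + g) m = f m + g m := rfl

theorem smul_base_apply (r : R) (f : SeriesDual R M) (m : M) : (r • f) m = r * f m := rfl

theorem sum_apply {κ : Type*} (s : Finset κ) (f : κ → SeriesDual R M) (m : M) :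
    (∑ i ∈ s, f i) m = ∑ i ∈ s, f i m :=
  LinearMap.sum_apply s (fun i => (f i : M →ₗ[R] R)) m

theorem finrank_eq [Module.Finite R M] [Module.Free R M] :
    Module.finrank R (SeriesDual R M) = Module.finrank R M := by
  classical
  exact (LinearEquiv.finrank_eq (Module.Free.chooseBasis R M).toDualEquiv).symm

variable [Module R⟦X⟧ M] [IsScalarTower R R⟦X⟧ M]

instance : SMul R⟦X⟧ (SeriesDual R M) where
  smul a f := of
    { toFun := fun m => f (a • m)
      map_add' := fun x y => by rw [smul_add, map_add]
      map_smul' := fun r x => by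
        rw [← PowerSeries.smul_comm_base, map_smul]
        rfl }

theorem smul_apply (a : R⟦X⟧) (f : SeriesDual R M) (m : M) : (a • f) m = f (a • m) := rfl

instance : Module R⟦X⟧ (SeriesDual R M) where
  one_smul f := ext fun m => by rw [smul_apply, one_smul]
  mul_smul a b f := ext fun m => by
    rw [smul_apply, smul_apply, smul_apply, smul_smul, mul_comm]
  smul_zero a := ext fun m => rfl
  smul_add a f g := ext fun m => rfl
  add_smul a b f := ext fun m => by
    rw [smul_apply, add_smul, map_add]
    rfl
  zero_smul f := ext fun m => by
    rw [smul_apply, zero_smul, map_zero]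
    rfl

instance : IsScalarTower R R⟦X⟧ (SeriesDual R M) :=
  ⟨fun r a f => ext fun m => by
    rw [smul_apply, smul_assoc, map_smul]
    rfl⟩

end SeriesDual

end SeriesDual

section DualModel

set_option linter.unusedSectionVars false

variable {F : Type*} [Field F] [Fintype F] {R : Type*} [CommRing R] [Algebra F R]
variable {M : Type*} [AddCommGroup M] [Module R⟦X⟧ M] [Module R M] [IsScalarTower R R⟦X⟧ M]
variable {φ : M →ₛₗ[frobSeries F R] M} {κ : Type*} [Fintype κ] {b : Module.Basis κ R M}
  {ζ : R} {d : ℕ}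

/-- The coordinates of `(z - ζ) ^ d m` with respect to `φ(b)`. -/
structure IsDualCoord (φ : M →ₛₗ[frobSeries F R] M) (b : Module.Basis κ R M) (ζ : R) (d : ℕ)
    (c : M →ₗ[R] (κ → R)) : Prop where
  linearIndependent : LinearIndependent R fun i => φ (b i)
  sum_eq : ∀ m, ∑ j, c m j • φ (b j) = (PowerSeries.X - PowerSeries.C ζ : R⟦X⟧) ^ d • m

/-- The `φ(b j)` are a basis of their span, which contains `(z - ζ)^d M`. The map `c` plays the role
of `(z - ζ)^d φ⁻¹`, and its transpose becomes the Frobenius of the dual. -/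
theorem IsFrobeniusModel.exists_isDualCoord [IsDomain R] [IsPrincipalIdealRing R]
    [Module.Finite R M] (h : IsFrobeniusModel ζ d φ) (hζ : ζ ≠ 0) (b : Module.Basis κ R M) :
    ∃ c, IsDualCoord φ b ζ d c := by
  have hli := h.linearIndependent hζ b
  have hmem : ∀ m, (PowerSeries.X - PowerSeries.C ζ : R⟦X⟧) ^ d • m ∈
      Submodule.span R (Set.range fun i => φ (b i)) := fun m => by
    rw [← span_range_frob φ b.span_eq]
    exact h.height m
  let z : M →ₗ[R] Submodule.span R (Set.range fun i => φ (b i)) :=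
    ((LinearMap.lsmul R⟦X⟧ M
      ((PowerSeries.X - PowerSeries.C ζ : R⟦X⟧) ^ d)).restrictScalars R).codRestrict _ hmem
  refine ⟨(Finsupp.linearEquivFunOnFinite R R κ).toLinearMap ∘ₗ hli.repr ∘ₗ z, hli, fun m => ?_⟩
  have h1 := hli.linearCombination_repr (z m)
  rw [Finsupp.linearCombination_apply, Finsupp.sum_fintype _ _ (by simp)] at h1
  exact h1

namespace IsDualCoord

variable {c : M →ₗ[R] (κ → R)} (hc : IsDualCoord φ b ζ d c)
include hc

theorem eq_of_sum_eq {m : M} {x : κ → R}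
    (h : ∑ j, x j • φ (b j) = (PowerSeries.X - PowerSeries.C ζ : R⟦X⟧) ^ d • m) : c m = x :=
  funext fun j => Fintype.linearIndependent_iffₛ.1 hc.linearIndependent _ _
    ((hc.sum_eq m).trans h.symm) j

theorem frob_eq_sum (m : M) : φ m = ∑ k, b.repr m k ^ Fintype.card F • φ (b k) := by
  conv_lhs => rw [← b.sum_repr m]
  rw [map_sum]
  simp only [frob_smul_base]

/-- Multiplying the expansion of `(z - ζ)^d m` by `σ̂(a)` turns `φ(b j)` into `φ(a b j)`, and
re-expanding gives the coordinates. This is what makes `dualFrob` semilinear over power series. -/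
theorem coord_frob_smul (a : R⟦X⟧) (m : M) :
    c (frobSeries F R a • m) =
      fun k => ∑ j, b.repr (a • b j) k ^ Fintype.card F * c m j := by
  apply hc.eq_of_sum_eq
  rw [smul_comm, ← hc.sum_eq, Finset.smul_sum]
  simp only [← PowerSeries.smul_comm_base, ← map_smulₛₗ]
  simp only [hc.frob_eq_sum (a • b _), Finset.smul_sum, Finset.sum_smul, smul_smul]
  rw [Finset.sum_comm]
  simp only [mul_comm]

theorem coord_frob {n : ℕ} (hX : ∀ m : M, (PowerSeries.X : R⟦X⟧) ^ n • m = 0) (m : M) :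
    c (φ m) = fun j => ∑ s ∈ Finset.range n,
      PowerSeries.coeff s ((PowerSeries.X - PowerSeries.C ζ : R⟦X⟧) ^ d) *
        b.repr ((PowerSeries.X : R⟦X⟧) ^ s • m) j ^ Fintype.card F := by
  apply hc.eq_of_sum_eq
  rw [PowerSeries.smul_eq_sum_of_X_pow_smul_eq_zero (hX _)]
  simp only [Finset.sum_smul, mul_smul]
  rw [Finset.sum_comm]
  refine Finset.sum_congr rfl fun s _ => ?_
  rw [← Finset.smul_sum, ← hc.frob_eq_sum, frob_X_pow_smul]

omit hc in
theorem apply_pow_eq_sum (f : M →ₗ[R] R) (m : M) :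
    f m ^ Fintype.card F = ∑ k, b.repr m k ^ Fintype.card F * f (b k) ^ Fintype.card F := by
  conv_lhs => rw [← b.sum_repr m]
  rw [map_sum]
  change frobCoeff F R _ = _
  rw [map_sum]
  refine Finset.sum_congr rfl fun k _ => ?_
  rw [map_smul, smul_eq_mul, map_mul]
  rfl

/-- The Frobenius of the dual: `f ↦ ∑ f(bⱼ) ^ q cⱼ`. -/
def dualFrob : SeriesDual R M →ₛₗ[frobSeries F R] SeriesDual R M where
  toFun f := SeriesDual.of
    { toFun := fun m => ∑ j, f (b j) ^ Fintype.card F * c m j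
      map_add' := fun x y => by
        rw [map_add]
        simp only [Pi.add_apply, mul_add, Finset.sum_add_distrib]
      map_smul' := fun r x => by
        rw [map_smul]
        simp only [Pi.smul_apply, smul_eq_mul, Finset.mul_sum, RingHom.id_apply]
        exact Finset.sum_congr rfl fun _ _ => by ring }
  map_add' f g := SeriesDual.ext fun m => by
    change ∑ j, (f (b j) + g (b j)) ^ Fintype.card F * c m j =
      ∑ j, f (b j) ^ Fintype.card F * c m j + ∑ j, g (b j) ^ Fintype.card F * c m j
    rw [← Finset.sum_add_distrib]
    refine Finset.sum_congr rfl fun j _ => ?_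
    rw [← add_mul]
    congr 1
    exact map_add (frobCoeff F R) _ _
  map_smul' a f := SeriesDual.ext fun m => by
    change ∑ j, f (a • b j) ^ Fintype.card F * c m j =
      ∑ k, f (b k) ^ Fintype.card F * c (frobSeries F R a • m) k
    rw [hc.coord_frob_smul]
    simp only [Finset.mul_sum]
    rw [Finset.sum_comm]
    refine Finset.sum_congr rfl fun j _ => ?_
    have h1 : f (a • b j) ^ Fintype.card F = _ :=
      apply_pow_eq_sum (F := F) (b := b) (f : M →ₗ[R] R) (a • b j)
    rw [h1, Finset.sum_mul]
    refine Finset.sum_congr rfl fun k _ => ?_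
    change _ * f (b k) ^ Fintype.card F * _ = _
    ring

theorem dualFrob_apply (f : SeriesDual R M) (m : M) :
    hc.dualFrob f m = ∑ j, f (b j) ^ Fintype.card F * c m j := rfl

/-- This is the constant-term form of the relation `⟨φ' f, φ m⟩ = (z - ζ)^d σ̂⟨f, m⟩` for the
evaluation pairing, obtained by expanding `(z - ζ)^d` in powers of `z`, which commute with `φ`. -/
theorem dualFrob_frob {n : ℕ} (hX : ∀ m : M, (PowerSeries.X : R⟦X⟧) ^ n • m = 0)
    (f : SeriesDual R M) (m : M) : hc.dualFrob f (φ m) = ∑ s ∈ Finset.range n,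
      PowerSeries.coeff s ((PowerSeries.X - PowerSeries.C ζ : R⟦X⟧) ^ d) *
        f ((PowerSeries.X : R⟦X⟧) ^ s • m) ^ Fintype.card F := by
  rw [dualFrob_apply, hc.coord_frob hX]
  simp only [Finset.mul_sum]
  rw [Finset.sum_comm]
  refine Finset.sum_congr rfl fun s _ => ?_
  have h1 : f ((PowerSeries.X : R⟦X⟧) ^ s • m) ^ Fintype.card F = _ :=
    apply_pow_eq_sum (F := F) (b := b) (f : M →ₗ[R] R) _
  rw [h1, Finset.mul_sum]
  refine Finset.sum_congr rfl fun k _ => ?_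
  change f (b k) ^ Fintype.card F * _ = _ * (_ * f (b k) ^ Fintype.card F)
  ring

theorem isFrobeniusModel_dualFrob {n : ℕ} (hX : ∀ m : M, (PowerSeries.X : R⟦X⟧) ^ n • m = 0) :
    IsFrobeniusModel ζ d hc.dualFrob := by
  classical
  refine ⟨⟨n, fun f => SeriesDual.ext fun m => ?_⟩, fun f => ?_⟩
  · rw [SeriesDual.smul_apply, hX, map_zero]
    rfl
  · have hf : (PowerSeries.X - PowerSeries.C ζ : R⟦X⟧) ^ d • f =
        ∑ j, f (φ (b j)) • hc.dualFrob (SeriesDual.of (b.coord j)) := by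
      refine SeriesDual.ext fun m => ?_
      rw [SeriesDual.smul_apply, ← hc.sum_eq, map_sum, SeriesDual.sum_apply]
      refine Finset.sum_congr rfl fun j _ => ?_
      rw [map_smul, SeriesDual.smul_base_apply, dualFrob_apply, smul_eq_mul, mul_comm]
      congr 1
      rw [Finset.sum_eq_single j]
      · simp [SeriesDual.of_apply]
      · intro i _ hij
        simp [SeriesDual.of_apply, hij]
      · exact fun h => absurd (Finset.mem_univ j) h
    rw [hf]
    exact sum_mem fun j _ => Submodule.smul_mem _ _ (Submodule.subset_span ⟨_, rfl⟩)

end IsDualCoord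

end DualModel

/-! ### The pairing between the fibres of a model and of its dual -/

namespace TruncSeries

variable {L L' : Type*} [CommRing L] [CommRing L'] {n : ℕ}

/-- The map `L⟦z⟧ / z ^ (n + 1) → L'⟦z⟧ / z ^ (n + 1)` induced by a map of coefficients. -/
def map (h : L →+* L') : TruncSeries L n →+* TruncSeries L' n :=
  Ideal.quotientMap _ (PowerSeries.map h) (by
    rw [Ideal.span_le, Set.singleton_subset_iff]
    change PowerSeries.map h _ ∈ Ideal.span _
    rw [map_pow, PowerSeries.map_X]
    exact Ideal.subset_span rfl)

theorem map_mk (h : L →+* L') (a : L⟦X⟧) :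
    map h (Ideal.Quotient.mk _ a : TruncSeries L n) =
      Ideal.Quotient.mk _ (PowerSeries.map h a) := rfl

theorem smul_mk (a c : L⟦X⟧) : a • (Ideal.Quotient.mk _ c : TruncSeries L n) =
    Ideal.Quotient.mk _ (a * c) := rfl

theorem map_smul' (h : L →+* L') (a : L⟦X⟧) (x : TruncSeries L n) :
    map h (a • x) = PowerSeries.map h a • map h x := by
  obtain ⟨c, rfl⟩ := Ideal.Quotient.mk_surjective x
  rw [smul_mk, map_mk, map_mk, smul_mk, map_mul]

theorem map_injective {h : L →+* L'} (hh : Function.Injective h) :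
    Function.Injective (map h : TruncSeries L n → TruncSeries L' n) := by
  intro x y hxy
  obtain ⟨x, rfl⟩ := Ideal.Quotient.mk_surjective x
  obtain ⟨y, rfl⟩ := Ideal.Quotient.mk_surjective y
  rw [map_mk, map_mk, mk_eq_mk_iff] at hxy
  rw [mk_eq_mk_iff]
  intro k hk
  apply hh
  simpa using hxy k hk

/-- The Frobenius invariants of `L⟦z⟧ / z ^ (n + 1)` are defined over the finite field. -/
theorem exists_map_eq {F L : Type*} [Field F] [Fintype F] [Field L] [Algebra F L]
    {x : TruncSeries L n} (hx : map (frobCoeff F L) x = x) :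
    ∃ v : TruncSeries F n, map (algebraMap F L) v = x := by
  obtain ⟨x, rfl⟩ := Ideal.Quotient.mk_surjective x
  rw [map_mk, mk_eq_mk_iff] at hx
  have hco : ∀ k, ∃ a : F, k ≤ n → algebraMap F L a = PowerSeries.coeff k x := by
    intro k
    by_cases hk : k ≤ n
    · have := hx k hk
      rw [PowerSeries.coeff_map] at this
      obtain ⟨a, ha⟩ := exists_algebraMap_eq_of_pow_card (F := F) this
      exact ⟨a, fun _ => ha⟩
    · exact ⟨0, fun h => absurd h hk⟩
  choose v hv using hco
  refine ⟨Ideal.Quotient.mk _ (PowerSeries.mk v), ?_⟩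
  rw [map_mk, mk_eq_mk_iff]
  intro k hk
  rw [PowerSeries.coeff_map, PowerSeries.coeff_mk, hv k hk]

end TruncSeries

section ResiduePairing

variable {R M : Type*} [CommRing R] [AddCommGroup M] [Module R⟦X⟧ M] [Module R M]
  [IsScalarTower R R⟦X⟧ M] (L : Type*) [CommRing L] [Algebra R L]
  {n : ℕ} (hX : ∀ m : M, (PowerSeries.X : R⟦X⟧) ^ (n + 1) • m = 0)

/-- The residue pairing `(f, m) ↦ ∑ k ≤ n, f (z ^ (n - k) m) z ^ k`. -/
def residuePairing (f : SeriesDual R M) :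
    M →ₛₗ[PowerSeries.map (algebraMap R L)] TruncSeries L n :=
  residueHom hX (f := algebraMap R L)
    { toFun := fun m => algebraMap R L (f m)
      map_add' := fun x y => by rw [map_add, map_add]
      map_smul' := fun r x => by rw [map_smul, smul_eq_mul, map_mul, smul_eq_mul] }

theorem residuePairing_apply (f : SeriesDual R M) (m : M) :
    residuePairing L hX f m = Ideal.Quotient.mk _ (PowerSeries.mk fun k =>
      algebraMap R L (f ((PowerSeries.X : R⟦X⟧) ^ (n - k) • m))) := rfl

theorem residuePairing_add (f g : SeriesDual R M) (m : M) :
    residuePairing L hX (f + g) m = residuePairing L hX f m + residuePairing L hX g m := by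
  rw [residuePairing_apply, residuePairing_apply, residuePairing_apply, ← map_add]
  congr 1
  ext k
  simp [SeriesDual.add_apply]

theorem residuePairing_smul (a : R⟦X⟧) (f : SeriesDual R M) (m : M) :
    residuePairing L hX (a • f) m =
      PowerSeries.map (algebraMap R L) a • residuePairing L hX f m := by
  rw [← map_smulₛₗ, residuePairing_apply, residuePairing_apply]
  simp only [SeriesDual.smul_apply, smul_comm a]

theorem topCoeff_residuePairing (f : SeriesDual R M) (m : M) :
    TruncSeries.topCoeff L n (residuePairing L hX f m) = algebraMap R L (f m) :=
  topCoeff_residueHom hX _ m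

/-- The twisted adjunction: the coefficient of `z^k` is `dualFrob_frob` applied to `z^(n-k) m`. -/
theorem residuePairing_dualFrob {F : Type*} [Field F] [Fintype F] [Algebra F R] [Algebra F L]
    {φ : M →ₛₗ[frobSeries F R] M} {κ : Type*} [Fintype κ]
    {b : Module.Basis κ R M} {ζ : R} {d : ℕ} {c : M →ₗ[R] (κ → R)}
    (hc : IsDualCoord φ b ζ d c) (f : SeriesDual R M) (m : M) :
    residuePairing L hX (hc.dualFrob f) (φ m) =
      PowerSeries.map (algebraMap R L) ((PowerSeries.X - PowerSeries.C ζ) ^ d) •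
        TruncSeries.map (frobCoeff F L) (residuePairing L hX f m) := by
  rw [residuePairing_apply, residuePairing_apply, TruncSeries.map_mk, TruncSeries.smul_mk,
    TruncSeries.mk_eq_mk_iff]
  intro k hk
  rw [PowerSeries.coeff_mk, ← frob_X_pow_smul, hc.dualFrob_frob hX, map_sum,
    PowerSeries.coeff_mul, Finset.Nat.sum_antidiagonal_eq_sum_range_succ_mk]
  symm
  -- The Cauchy product runs over `s ≤ k`, while `dualFrob_frob` gives `s ≤ n`. The terms with `s >
  -- k` vanish because `z^(s+n-k)` kills `m`.
  refine Finset.sum_subset_zero_on_sdiff (Finset.range_mono (by omega)) ?_ ?_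
  · intro s hs
    rw [Finset.mem_sdiff, Finset.mem_range, Finset.mem_range] at hs
    rw [smul_smul, ← pow_add, show s + (n - k) = (s + (n - k) - (n + 1)) + (n + 1) by omega,
      pow_add, mul_smul, hX, smul_zero, map_zero, zero_pow Fintype.card_ne_zero, mul_zero,
      map_zero]
  · intro s hs
    rw [Finset.mem_range] at hs
    rw [PowerSeries.coeff_map, PowerSeries.coeff_map, PowerSeries.coeff_mk, smul_smul, ← pow_add,
      map_mul, show s + (n - k) = n - (k - s) by omega]
    exact congrArg _ (map_pow (algebraMap R L) _ _).symm

end ResiduePairing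

namespace TorsionLocalShtuka

section FiberPairing

variable {F : Type*} [Field F] [Fintype F] {R : Type u} [CommRing R] [Algebra F R] {ζ : R}
variable {N N' : TorsionLocalShtuka F ζ} {n : ℕ}
  (hX : ∀ m : N.M, (PowerSeries.X : R⟦X⟧) ^ (n + 1) • m = 0)
  (e : N'.M ≃ₗ[R⟦X⟧] SeriesDual R N.M) (L : Type*) [Field L] [Algebra R L]

/-- The pairing of the fibre with an element of the dual. -/
def fiberResidue (f : SeriesDual R N.M) : N.Fiber L →ₗ[L⟦X⟧] TruncSeries L n :=
  ScalarExt.lift (RingHom.id _) (residuePairing L hX f).toAddMonoidHom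
    (fun a m => (residuePairing L hX f).map_smulₛₗ a m)

theorem fiberResidue_toFiber (f : SeriesDual R N.M) (m : N.M) :
    fiberResidue hX L f (N.toFiber L m) = residuePairing L hX f m :=
  ScalarExt.lift_ι _ _ _ m

theorem fiber_hom_ext {A : Type*} [AddCommGroup A] [Module L⟦X⟧ A]
    {f g : N.Fiber L →ₗ[L⟦X⟧] A} (h : ∀ m, f (N.toFiber L m) = g (N.toFiber L m)) : f = g := by
  refine LinearMap.ext fun x => ?_
  induction x using fiber_induction with
  | h0 => rw [map_zero, map_zero]
  | hι b m => rw [map_smul, map_smul, h]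
  | hadd x y hx hy => rw [map_add, map_add, hx, hy]

/-- The pairing between the fibre of a shtuka and that of its dual. -/
def fiberPairing : N'.Fiber L →ₗ[L⟦X⟧] N.Fiber L →ₗ[L⟦X⟧] TruncSeries L n :=
  ScalarExt.lift (RingHom.id _)
    { toFun := fun x => fiberResidue hX L (e x)
      map_zero' := fiber_hom_ext L fun m => by
        rw [fiberResidue_toFiber, map_zero]
        have := residuePairing_smul L hX 0 0 m
        rwa [map_zero, zero_smul, zero_smul] at this
      map_add' := fun x y => fiber_hom_ext L fun m => by
        rw [LinearMap.add_apply, fiberResidue_toFiber, fiberResidue_toFiber,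
          fiberResidue_toFiber, map_add, residuePairing_add] }
    (fun a x => fiber_hom_ext L fun m => by
      change fiberResidue hX L (e (a • x)) (N.toFiber L m) =
        PowerSeries.map (algebraMap R L) a • fiberResidue hX L (e x) (N.toFiber L m)
      rw [fiberResidue_toFiber, fiberResidue_toFiber, map_smul, residuePairing_smul])

theorem fiberPairing_toFiber (x : N'.M) (m : N.M) :
    fiberPairing hX e L (N'.toFiber L x) (N.toFiber L m) = residuePairing L hX (e x) m := by
  rw [← fiberResidue_toFiber]
  exact LinearMap.congr_fun (ScalarExt.lift_ι _ _ _ x) _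

theorem fiberPairing_smul_smul (a c : L⟦X⟧) (x : N'.Fiber L) (y : N.Fiber L) :
    fiberPairing hX e L (a • x) (c • y) = a • c • fiberPairing hX e L x y := by
  rw [map_smul, map_smul, LinearMap.smul_apply, smul_comm]

/-- The top coefficient of the pairing is the evaluation pairing. On the basis of `M` and its dual
basis it is the identity matrix, so pairing with basis vectors reads off the coordinates of `x`. -/
theorem fiberPairing_left_injective {κ : Type*} [Fintype κ] [DecidableEq κ]
    (b : Module.Basis κ R N.M) {n' : ℕ}
    (hX' : ∀ m : N'.M, (PowerSeries.X : R⟦X⟧) ^ n' • m = 0)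
    {x : N'.Fiber L} (hx : ∀ y, fiberPairing hX e L x y = 0) : x = 0 := by
  let bd : Module.Basis κ R (SeriesDual R N.M) := b.dualBasis
  have hbd : ∀ i j, bd i (b j) = if j = i then 1 else 0 := fun i j => b.dualBasis_apply_self i j
  let β := fiberBasis L hX' (bd.map (e.symm.restrictScalars R))
  have hβ : ∀ i, β i = N'.toFiber L (e.symm (bd i)) := fun i => fiberBasis_apply L hX' _ i
  rw [← β.sum_repr x]
  refine Finset.sum_eq_zero fun j _ => ?_
  have h1 := congrArg (TruncSeries.topCoeff L n) (hx (N.toFiber L (b j)))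
  rw [← β.sum_repr x, map_sum, LinearMap.sum_apply, map_sum, map_zero,
    Finset.sum_eq_single j] at h1
  · rw [← PowerSeries.C_smul, map_smul, LinearMap.smul_apply, TruncSeries.topCoeff_C_smul, hβ,
      fiberPairing_toFiber, topCoeff_residuePairing, e.apply_symm_apply, hbd, if_pos rfl, map_one,
      mul_one] at h1
    rw [h1, zero_smul]
  · intro i _ hij
    rw [← PowerSeries.C_smul, map_smul, LinearMap.smul_apply, TruncSeries.topCoeff_C_smul, hβ,
      fiberPairing_toFiber, topCoeff_residuePairing, e.apply_symm_apply, hbd,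
      if_neg (Ne.symm hij), map_zero, mul_zero]
  · exact fun h => absurd (Finset.mem_univ j) h

variable (K : Type*) [Field K] [Algebra R K] [Algebra K L] [IsScalarTower R K L]

variable {K L} in
theorem fiberPairing_gal (g : L ≃ₐ[K] L) (x : N'.Fiber L) (y : N.Fiber L) :
    fiberPairing hX e L (N'.gal g x) (N.gal g y) =
      TruncSeries.map (g : L →+* L) (fiberPairing hX e L x y) := by
  have hmap : ∀ (a : L⟦X⟧) (z : TruncSeries L n), TruncSeries.map (g : L →+* L) (a • z) =
      galSeries g a • TruncSeries.map (g : L →+* L) z := TruncSeries.map_smul' _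
  induction x using fiber_induction with
  | h0 => simp
  | hι a x =>
    induction y using fiber_induction with
    | h0 => simp
    | hι c y =>
      rw [(N'.gal g).map_smulₛₗ, (N.gal g).map_smulₛₗ, fiberPairing_smul_smul,
        fiberPairing_smul_smul, hmap, hmap, gal_toFiber, gal_toFiber, fiberPairing_toFiber]
      congr 2
      rw [residuePairing_apply, TruncSeries.map_mk]
      congr 1
      ext k
      simp [IsScalarTower.algebraMap_apply R K L]
    | hadd y y' hy hy' => simp only [map_add, hy, hy']
  | hadd x x' hx hx' => simp only [map_add, LinearMap.add_apply, hx, hx']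

/-- On Tate vectors both Frobenii act trivially, so this becomes the equation `B = (z - ζ)^d σ̂(B)`
for the value of the pairing. -/
theorem fiberPairing_phi [FaithfulSMul R K] [NeZero ζ] [Algebra F L]
    {φ : N.M →ₛₗ[frobSeries F R] N.M} (hφ : N.IsFrobenius φ)
    {ψ : N'.M →ₛₗ[frobSeries F R] N'.M} (hψ : N'.IsFrobenius ψ) {κ : Type*} [Fintype κ]
    {b : Module.Basis κ R N.M} {d : ℕ} {c : N.M →ₗ[R] (κ → R)}
    (hc : IsDualCoord φ b ζ d c) (he : ∀ m, e (ψ m) = hc.dualFrob (e m))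
    (x : N'.Fiber L) (y : N.Fiber L) :
    fiberPairing hX e L (N'.phi K L x) (N.phi K L y) =
      PowerSeries.map (algebraMap R L) ((PowerSeries.X - PowerSeries.C ζ) ^ d) •
        TruncSeries.map (frobCoeff F L) (fiberPairing hX e L x y) := by
  have hmap : ∀ (a : L⟦X⟧) (z : TruncSeries L n), TruncSeries.map (frobCoeff F L) (a • z) =
      frobSeries F L a • TruncSeries.map (frobCoeff F L) z := TruncSeries.map_smul' _
  induction x using fiber_induction with
  | h0 => simp
  | hι a x =>
    induction y using fiber_induction with
    | h0 => simp
    | hι c y =>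
      rw [(N'.phi K L).map_smulₛₗ, (N.phi K L).map_smulₛₗ, fiberPairing_smul_smul,
        fiberPairing_smul_smul, hmap, hmap, phi_toFiber_of_isFrobenius K L hφ,
        phi_toFiber_of_isFrobenius K L hψ, fiberPairing_toFiber, fiberPairing_toFiber, he,
        residuePairing_dualFrob]
      simp only [smul_smul]
      congr 1
      ring
    | hadd y y' hy hy' => simp only [map_add, hy, hy', smul_add]
  | hadd x x' hx hx' => simp only [map_add, LinearMap.add_apply, hx, hx', smul_add]

end FiberPairing

end TorsionLocalShtuka

/-! ### Torsion in the quotient of the fraction field -/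

section FractionQuotient

variable {F : Type*} [Field F]

theorem algebraMap_X_ne_zero :
    algebraMap F⟦X⟧ (FractionRing F⟦X⟧) PowerSeries.X ≠ 0 := by
  rw [Ne, IsFractionRing.to_map_eq_zero_iff]
  exact PowerSeries.X_ne_zero

/-- The embedding `a ↦ a / z ^ (n + 1)` of `F⟦z⟧ / z ^ (n + 1)` into `Q / A`. -/
def TruncSeries.toFractionQuotient (F : Type*) [Field F] (n : ℕ) :
    TruncSeries F n →ₗ[F⟦X⟧] FractionQuotient F⟦X⟧ :=
  Submodule.liftQ (Ideal.span {(PowerSeries.X : F⟦X⟧) ^ (n + 1)})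
    (Submodule.mkQ _ ∘ₗ LinearMap.toSpanSingleton F⟦X⟧ (FractionRing F⟦X⟧)
      (algebraMap F⟦X⟧ (FractionRing F⟦X⟧) PowerSeries.X ^ (n + 1))⁻¹) (by
    intro a ha
    obtain ⟨c, rfl⟩ := Ideal.mem_span_singleton.1 ha
    rw [LinearMap.mem_ker, LinearMap.comp_apply, Submodule.mkQ_apply,
      Submodule.Quotient.mk_eq_zero]
    refine ⟨c, ?_⟩
    rw [LinearMap.toSpanSingleton_apply, Algebra.smul_def, map_mul, map_pow,
      Algebra.linearMap_apply]
    field_simp [algebraMap_X_ne_zero])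

theorem TruncSeries.toFractionQuotient_injective (F : Type*) [Field F] (n : ℕ) :
    Function.Injective (TruncSeries.toFractionQuotient F n) := by
  refine (injective_iff_map_eq_zero _).2 fun x hx => ?_
  obtain ⟨a, rfl⟩ := Ideal.Quotient.mk_surjective x
  have hx' : (Submodule.Quotient.mk (a • (algebraMap F⟦X⟧ (FractionRing F⟦X⟧) PowerSeries.X ^
      (n + 1))⁻¹) : FractionQuotient F⟦X⟧) = 0 := hx
  rw [Submodule.Quotient.mk_eq_zero] at hx'
  obtain ⟨c, hc⟩ := hx'
  rw [Ideal.Quotient.eq_zero_iff_mem, Ideal.mem_span_singleton]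
  refine ⟨c, IsFractionRing.injective F⟦X⟧ (FractionRing F⟦X⟧) ?_⟩
  rw [Algebra.linearMap_apply, Algebra.smul_def] at hc
  rw [map_mul, map_pow, hc]
  field_simp [algebraMap_X_ne_zero]

/-- The class of `1 / z` in `Q / A`. -/
def socleElement (F : Type*) [Field F] : FractionQuotient F⟦X⟧ :=
  Submodule.Quotient.mk (algebraMap F⟦X⟧ (FractionRing F⟦X⟧) PowerSeries.X)⁻¹

theorem socleElement_ne_zero : socleElement F ≠ 0 := by
  rw [Ne, socleElement, Submodule.Quotient.mk_eq_zero]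
  rintro ⟨c, hc⟩
  have h1 : c * PowerSeries.X = 1 := by
    apply IsFractionRing.injective F⟦X⟧ (FractionRing F⟦X⟧)
    rw [map_mul, ← Algebra.linearMap_apply, hc, map_one, inv_mul_cancel₀ algebraMap_X_ne_zero]
  have h2 := congrArg (PowerSeries.coeff 0) h1
  simp at h2

/-- Such an `x` is the class of some `b / z`, and modulo `A` only the constant term of `b` matters.
So the `z`-torsion of `Q / A` is one-dimensional over `F`. -/
theorem exists_eq_smul_socleElement {x : FractionQuotient F⟦X⟧}
    (hx : (PowerSeries.X : F⟦X⟧) • x = 0) :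
    ∃ c : F, x = (PowerSeries.C c : F⟦X⟧) • socleElement F := by
  obtain ⟨w, rfl⟩ := Submodule.Quotient.mk_surjective _ x
  rw [← Submodule.Quotient.mk_smul, Submodule.Quotient.mk_eq_zero] at hx
  obtain ⟨b, hb⟩ := hx
  rw [Algebra.linearMap_apply, Algebra.smul_def] at hb
  obtain ⟨b', hb'⟩ : (PowerSeries.X : F⟦X⟧) ∣ b - PowerSeries.C (PowerSeries.constantCoeff b) := by
    rw [PowerSeries.X_dvd_iff]
    simp
  refine ⟨PowerSeries.constantCoeff b, ?_⟩
  rw [socleElement, ← Submodule.Quotient.mk_smul, Submodule.Quotient.eq]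
  refine ⟨b', ?_⟩
  rw [Algebra.linearMap_apply, Algebra.smul_def]
  have h1 := congrArg (algebraMap F⟦X⟧ (FractionRing F⟦X⟧)) hb'
  rw [map_sub, map_mul, hb] at h1
  have h0 := algebraMap_X_ne_zero (F := F)
  field_simp
  linear_combination -h1

/-- The Matlis dual of a finite torsion module is finite and not larger than the module. -/
theorem finite_and_card_fractionQuotient_dual_le [Finite F] {T : Type*}
    [AddCommGroup T] [Module F⟦X⟧ T] [Finite T] {n : ℕ}
    (hT : ∀ t : T, (PowerSeries.X : F⟦X⟧) ^ n • t = 0) :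
    Finite (T →ₗ[F⟦X⟧] FractionQuotient F⟦X⟧) ∧
      Nat.card (T →ₗ[F⟦X⟧] FractionQuotient F⟦X⟧) ≤ Nat.card T := by
  let _ : Module F T := Module.compHom T (PowerSeries.C : F →+* F⟦X⟧)
  have : IsScalarTower F F⟦X⟧ T := ⟨fun r a x => by
    rw [PowerSeries.smul_eq_C_mul, mul_smul]
    rfl⟩
  -- Composition with an `F`-linear form `r` that does not vanish on the socle embeds `Hom_A(T, Q /
  -- A)` into the `F`-dual of `T`, which has as many elements as `T`.
  obtain ⟨r, hr⟩ : ∃ r : Module.Dual F (FractionQuotient F⟦X⟧), r (socleElement F) ≠ 0 := by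
    by_contra! hcon
    exact socleElement_ne_zero ((Module.forall_dual_apply_eq_zero_iff F _).1 hcon)
  -- A nonzero cyclic submodule killed by a power of `z` contains the socle, so `r` cannot vanish on
  -- it.
  have key : ∀ k : ℕ, ∀ x : FractionQuotient F⟦X⟧, (PowerSeries.X : F⟦X⟧) ^ k • x = 0 →
      (∀ a : F⟦X⟧, r (a • x) = 0) → x = 0 := by
    intro k
    induction k with
    | zero =>
      intro x hx _
      rwa [pow_zero, one_smul] at hx
    | succ k ih =>
      intro x hx ha
      refine ih x ?_ ha
      rw [pow_succ', mul_smul] at hx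
      obtain ⟨c, hc⟩ := exists_eq_smul_socleElement hx
      have h1 := ha ((PowerSeries.X : F⟦X⟧) ^ k)
      rw [hc, PowerSeries.C_smul, map_smul, smul_eq_mul] at h1
      rw [hc, (mul_eq_zero.1 h1).resolve_right hr, map_zero, zero_smul]
  let Ψ : (T →ₗ[F⟦X⟧] FractionQuotient F⟦X⟧) → (T →ₗ[F] F) := fun h =>
    r ∘ₗ h.restrictScalars F
  have hΨ : Function.Injective Ψ := by
    intro h h' hh
    refine LinearMap.ext fun t => ?_
    rw [← sub_eq_zero]
    refine key n _ ?_ fun a => ?_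
    · rw [← LinearMap.sub_apply, ← map_smul, hT, map_zero]
    · rw [← LinearMap.sub_apply, ← map_smul, LinearMap.sub_apply, map_sub, sub_eq_zero]
      exact LinearMap.congr_fun hh (a • t)
  have : Finite (T →ₗ[F] F) := Finite.of_injective _ DFunLike.coe_injective
  refine ⟨Finite.of_injective Ψ hΨ, (Nat.card_le_card_of_injective Ψ hΨ).trans ?_⟩
  rw [Module.natCard_eq_pow_finrank (K := F) (V := T),
    Module.natCard_eq_pow_finrank (K := F) (V := T →ₗ[F] F)]
  exact (congrArg _ Subspace.dual_finrank_eq).le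

end FractionQuotient

/-! ### Twisted duality -/

section Duality

variable {F : Type*} [Field F] [Fintype F] {R : Type u} [CommRing R] [Algebra F R] {ζ : R}
variable {K : Type*} [Field K] [Algebra R K]
variable {L : Type*} [Field L] [Algebra K L] [Algebra R L] [IsScalarTower R K L]
variable [IsDomain R] [IsPrincipalIdealRing R] [IsFractionRing R K] [NeZero ζ] [Algebra F L]
  [IsScalarTower F R L] [IsSepClosure K L]
variable {T : Type*} [AddCommGroup T] [Module F⟦X⟧ T]

open TorsionLocalShtuka in
-- Pairing the Tate modules of `M` and of its dual and rescaling by `ℓ₊^d` gives values in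
-- `F⟦z⟧/z^(n+1)`, embedded in `Q / A` by division by `z^(n+1)`. This defines an equivariant
-- injection into the twisted dual; since `Hom_A(T, Q / A)` is not larger than `T`, it is bijective.
theorem AdmitsEffectiveModel.dual {d : ℕ} {ρ : Representation F⟦X⟧ (L ≃ₐ[K] L) T}
    (h : AdmitsEffectiveModel ζ d ρ) : AdmitsEffectiveModel ζ d
      (ρ.pontryaginDual.twist (cyclotomicChar F ζ K L ^ (-(d : ℤ)))) := by
  classical
  have := IsSepClosure.sep_closed K (K := L)
  obtain ⟨N, -, hN, ⟨ε⟩⟩ := h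
  obtain ⟨_, _, φ, hφ, hm⟩ := hN.exists_isFrobenius
  obtain ⟨n, hn⟩ := hm.nilpotent
  have hX : ∀ m : N.M, (PowerSeries.X : R⟦X⟧) ^ (n + 1) • m = 0 := fun m => by
    rw [pow_succ', mul_smul, hn, smul_zero]
  let b := Module.Free.chooseBasis R N.M
  obtain ⟨c, hc⟩ := hm.exists_isDualCoord (NeZero.ne ζ) b
  obtain ⟨N', e, ψ, heff, hht, hψ, hψe, hmodel, _, _, hrank⟩ :=
    exists_model (hc.isFrobeniusModel_dualFrob hX)
  obtain ⟨n', hX'⟩ := hmodel.nilpotent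
  let B := fiberPairing hX e L
  obtain ⟨ℓ, hℓ⟩ := exists_isDivisionTower_algebraMap F ζ K L
  have hζ : algebraMap R L ζ ≠ 0 := by
    rw [IsScalarTower.algebraMap_apply R K L]
    simpa using NeZero.ne ζ
  let l : L⟦X⟧ := PowerSeries.mk ℓ
  have hlu : IsUnit l := hℓ.isUnit_mk hζ
  have hlf : frobSeries F L l = PowerSeries.map (algebraMap R L)
      (PowerSeries.X - PowerSeries.C ζ) * l := by
    rw [map_sub, PowerSeries.map_X, PowerSeries.map_C]
    exact hℓ.frobSeries_mk
  have hlg : ∀ g : L ≃ₐ[K] L, galSeries g l =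
      PowerSeries.map (algebraMap F L) (cyclotomicChar F ζ K L g) * l :=
    galSeries_mk_eq_cyclotomicChar_mul F ζ K L hℓ
  -- From `B = (z - ζ)^d σ̂(B)` and `σ̂(ℓ₊) = (z - ζ) ℓ₊` it follows that `ℓ₊^d B` is invariant
  -- under `σ̂`, hence defined over `F`.
  have hv : ∀ (x : N'.tate K L) (y : N.tate K L), ∃ v : TruncSeries F n,
      TruncSeries.map (algebraMap F L) v = l ^ d • B x y := by
    intro x y
    apply TruncSeries.exists_map_eq
    have h1 := fiberPairing_phi hX e L K hφ hψ hc hψe x y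
    rw [show N'.phi K L x = x from x.2, show N.phi K L y = y from y.2] at h1
    refine (TruncSeries.map_smul' _ _ _).trans ?_
    change frobSeries F L (l ^ d) • TruncSeries.map (frobCoeff F L) (B x y) = _
    rw [map_pow, hlf, mul_pow, mul_comm, mul_smul, ← map_pow]
    exact congrArg _ h1.symm
  choose v hv using hv
  have hinj := TruncSeries.map_injective (n := n) (algebraMap F L).injective
  have hmaps : ∀ (a : F⟦X⟧) (x : TruncSeries F n), TruncSeries.map (algebraMap F L) (a • x) =
      PowerSeries.map (algebraMap F L) a • TruncSeries.map (algebraMap F L) x :=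
    TruncSeries.map_smul' _
  have hadd₁ : ∀ x x' y, v (x + x') y = v x y + v x' y := fun x x' y => hinj (by
    rw [map_add, hv, hv, hv, ← smul_add, Submodule.coe_add, map_add, LinearMap.add_apply])
  have hadd₂ : ∀ x y y', v x (y + y') = v x y + v x y' := fun x y y' => hinj (by
    rw [map_add, hv, hv, hv, ← smul_add, Submodule.coe_add, map_add])
  have hsmul₁ : ∀ (a : F⟦X⟧) x y, v (a • x) y = a • v x y := fun a x y => hinj (by
    rw [hmaps, hv, hv, smul_comm, Submodule.coe_smul, const_smul_def, map_smul,
      LinearMap.smul_apply])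
  have hsmul₂ : ∀ (a : F⟦X⟧) x y, v x (a • y) = a • v x y := fun a x y => hinj (by
    rw [hmaps, hv, hv, smul_comm, Submodule.coe_smul, const_smul_def, map_smul])
  -- The pairing is equivariant and `g(ℓ₊^d) = χ(g)^d ℓ₊^d`, while `ℓ₊^d B` has coefficients in `F`
  -- and is fixed by `g`. Comparing leaves the factor `χ(g)^d`.
  have hgal : ∀ g x y, ((cyclotomicChar F ζ K L g ^ d : F⟦X⟧ˣ) : F⟦X⟧) •
      v (N'.tateRep K L g x) (N.tateRep K L g y) = v x y := by
    intro g x y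
    apply hinj
    have h1 : B (N'.gal g x) (N.gal g y) = TruncSeries.map (g : L →+* L) (B x y) :=
      fiberPairing_gal hX e g x y
    have h2 : TruncSeries.map (g : L →+* L) (TruncSeries.map (algebraMap F L) (v x y)) =
        TruncSeries.map (algebraMap F L) (v x y) := by
      obtain ⟨a, ha⟩ := Ideal.Quotient.mk_surjective (v x y)
      rw [← ha, TruncSeries.map_mk, TruncSeries.map_mk]
      exact congrArg _ (galSeries_map_const R g a)
    rw [hmaps, hv]
    change _ • l ^ d • B (N'.gal g x) (N.gal g y) = _
    rw [h1, ← h2, hv, TruncSeries.map_smul' (g : L →+* L)]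
    change _ = galSeries g (l ^ d) • _
    rw [map_pow, hlg, mul_pow, mul_smul, Units.val_pow_eq_pow_val, map_pow]
  let θ : Representation.IntertwiningMap (N'.tateRep K L)
      (ρ.pontryaginDual.twist (cyclotomicChar F ζ K L ^ (-(d : ℤ)))) :=
    { toFun := fun x =>
        { toFun := fun t => TruncSeries.toFractionQuotient F n (v x (ε t))
          map_add' := fun t t' => by
            rw [← map_add, ← hadd₂]
            congr 2
            exact map_add ε.toLinearMap t t'
          map_smul' := fun a t => by
            rw [RingHom.id_apply, ← map_smul, ← hsmul₂]
            congr 2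
            exact map_smul ε.toLinearMap a t }
      map_add' := fun x x' => LinearMap.ext fun t => by
        change TruncSeries.toFractionQuotient F n (v (x + x') (ε t)) =
          TruncSeries.toFractionQuotient F n _ + TruncSeries.toFractionQuotient F n _
        rw [hadd₁, map_add]
      map_smul' := fun a x => LinearMap.ext fun t => by
        change TruncSeries.toFractionQuotient F n (v (a • x) (ε t)) =
          a • TruncSeries.toFractionQuotient F n _
        rw [hsmul₁, map_smul]
      isIntertwining' := fun g => LinearMap.ext fun x => LinearMap.ext fun t => by
        change TruncSeries.toFractionQuotient F n (v (N'.tateRep K L g x) (ε t)) =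
          (((cyclotomicChar F ζ K L ^ (-(d : ℤ))) g : F⟦X⟧ˣ) : F⟦X⟧) •
            TruncSeries.toFractionQuotient F n (v x (ε (ρ g⁻¹ t)))
        have h1 : ε (ρ g⁻¹ t) = N.tateRep K L g⁻¹ (ε t) :=
          Representation.IntertwiningMap.isIntertwining _ _ ε.toIntertwiningMap g⁻¹ t
        have h2 : N.tateRep K L g (N.tateRep K L g⁻¹ (ε t)) = ε t := by
          rw [← Module.End.mul_apply, ← map_mul, mul_inv_cancel, map_one, Module.End.one_apply]
        have h3 := hgal g x (N.tateRep K L g⁻¹ (ε t))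
        rw [h2] at h3
        have h4 : (cyclotomicChar F ζ K L ^ (-(d : ℤ))) g =
            (cyclotomicChar F ζ K L g ^ d)⁻¹ := by
          rw [MonoidHom.zpow_apply, zpow_neg, zpow_natCast]
        rw [h1, ← h3, h4, ← map_smul, smul_smul, Units.inv_mul, one_smul] }
  have hθ : Function.Injective θ := by
    refine (injective_iff_map_eq_zero _).2 fun x hx => ?_
    have h1 : ∀ y : N.tate K L, B x y = 0 := by
      intro y
      have h2 : TruncSeries.toFractionQuotient F n (v x (ε (ε.symm y))) = 0 :=
        LinearMap.congr_fun hx (ε.symm y)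
      rw [ε.apply_symm_apply] at h2
      have h3 : v x y = 0 :=
        TruncSeries.toFractionQuotient_injective F n (h2.trans (map_zero _).symm)
      have h4 := hv x y
      rw [h3, map_zero] at h4
      exact ((hlu.pow d).smul_eq_zero).1 h4.symm
    apply Subtype.ext
    refine fiberPairing_left_injective hX e L b hX' fun y => ?_
    -- Vanishing of the pairing on Tate vectors suffices, because by Lang's theorem they span the
    -- fibre over `L`.
    have hy : y ∈ Submodule.span L (N.tate K L : Set (N.Fiber L)) := by
      rw [span_tate K L hφ hm]
      exact Submodule.mem_top
    induction hy using Submodule.span_induction with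
    | mem y hy => exact h1 ⟨y, hy⟩
    | zero => rw [map_zero]
    | add y y' _ _ hy hy' => rw [map_add, hy, hy', add_zero]
    | smul a y _ hy => rw [← PowerSeries.C_smul, map_smul, hy, smul_zero]
  have hcardT : Nat.card T = Nat.card (N'.tate K L) := by
    rw [Nat.card_congr ε.toLinearEquiv.toEquiv, card_tate K L hφ hm, card_tate K L hψ hmodel,
      hrank, SeriesDual.finrank_eq]
  have hT : ∀ t : T, (PowerSeries.X : F⟦X⟧) ^ n • t = 0 := fun t => by
    apply ε.toLinearEquiv.injective
    rw [map_smul, map_zero]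
    apply Subtype.ext
    rw [Submodule.coe_smul, const_smul_def, map_pow, PowerSeries.map_X, X_pow_smul_fiber L hn]
    rfl
  have hfinT : Finite T := Nat.finite_of_card_ne_zero (by
    rw [hcardT, card_tate K L hψ hmodel]
    exact pow_ne_zero _ Fintype.card_ne_zero)
  obtain ⟨_, hle⟩ := finite_and_card_fractionQuotient_dual_le hT
  exact ⟨N', heff, hht, Representation.nonempty_equiv_of_card_le θ hθ
    (hle.trans hcardT.le)⟩

end Duality

end

/-! ### The three closure properties -/

theorem mainTheorem9
    {F : Type*} [Field F] [Fintype F]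
    {R : Type u} [CommRing R] [IsDomain R] [IsDiscreteValuationRing R]
    [IsAdicComplete (IsLocalRing.maximalIdeal R) R] [Algebra F R]
    (ζ : R) [NeZero ζ] (hζ : ζ ∈ IsLocalRing.maximalIdeal R)
    {K : Type*} [Field K] [Algebra R K] [IsFractionRing R K]
    {L : Type*} [Field L] [Algebra K L] [IsSepClosure K L]
    [Algebra R L] [IsScalarTower R K L] [Algebra F L] [IsScalarTower F R L] (d : ℕ) :
    -- stability under subquotients
    (∀ {T S T' : Type*} [AddCommGroup T] [Module F⟦X⟧ T] [AddCommGroup S] [Module F⟦X⟧ S]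
      [AddCommGroup T'] [Module F⟦X⟧ T'] (ρ : Representation F⟦X⟧ (L ≃ₐ[K] L) T)
      (ρS : Representation F⟦X⟧ (L ≃ₐ[K] L) S) (ρ' : Representation F⟦X⟧ (L ≃ₐ[K] L) T')
      (i : Representation.IntertwiningMap ρS ρ) (p : Representation.IntertwiningMap ρS ρ'),
      Function.Injective i → Function.Surjective p →
      IsEffectiveTorsionRep ζ d ρ → IsEffectiveTorsionRep ζ d ρ') ∧
    -- stability under (finite) direct products
    (∀ {ι : Type*} [Finite ι] {T : ι → Type*} [∀ j, AddCommGroup (T j)]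
      [∀ j, Module F⟦X⟧ (T j)] (ρ : ∀ j, Representation F⟦X⟧ (L ≃ₐ[K] L) (T j)),
      (∀ j, IsEffectiveTorsionRep ζ d (ρ j)) →
      IsEffectiveTorsionRep ζ d (Representation.piRep ρ)) ∧
    -- stability under the twisted duality `T ↦ Hom(T, Q / A) ⊗ χ ^ (-d)`
    (∀ {T : Type*} [AddCommGroup T] [Module F⟦X⟧ T]
      (ρ : Representation F⟦X⟧ (L ≃ₐ[K] L) T), IsEffectiveTorsionRep ζ d ρ →
      IsEffectiveTorsionRep ζ d
        (ρ.pontryaginDual.twist (cyclotomicChar F ζ K L ^ (-(d : ℤ))))) := by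
  refine ⟨?_, ?_, ?_⟩
  · intro T S T' _ _ _ _ _ _ ρ ρS ρ' i p hi hp h
    exact ((h.2.sub i hi).quotient p hp).isEffectiveTorsionRep
  · intro ι _ T _ _ ρ h
    exact (AdmitsEffectiveModel.pi fun j => (h j).2).isEffectiveTorsionRep
  · intro T _ _ ρ h
    exact h.2.dual.isEffectiveTorsionRep
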